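/- Let $G=\mathrm{SU}(3)$ and let $K=\mathrm{S}(\mathrm U(2)\times\mathrm U(1))$ be the subgroup of block diagonal matrices, with Haar measure $dk$ of total mass $1$. For $g\in G$ let $A(g)$ be the left upper $2\times2$ block of $g$. For $n\in\mathbb Z$ and $\ell\in\mathbb Z_{\ge0}$ let $\pi=\pi_{n,\ell}$, $\pi(A)=(\det A)^nA^\ell$ for $A\in\mathrm{GL}(2,\mathbb C)$, where $A^\ell$ is the $\ell$-th symmetric power of $A$ acting on $V_\pi=\mathrm{Sym}^\ell(\mathbb C^2)$; it is also regarded as a representation of $K$ by $k\mapsto\pi(A(k))$. Put $v_i=e_1^{\ell-i}e_2^{i}\in V_\pi$ $(0\le i\le\ell)$ and $\chi(k)=(\ell+1)\operatorname{tr}\pi(A(k))$ for $k\in K$. A spherical function of type $(n,\ell)$ is a continuous map $\Phi:G\to\mathrm{End}(V)$, with $V$ a finite dimensional complex vector space, such that $\Phi(e)=I$ and $\Phi(x)\Phi(y)=\int_K\chi(k^{-1})\Phi(xky)\,dk$ for all $x,y\in G$. It is irreducible if $V\ne0$ and no subspace of $V$ other than $0$ and $V$ is invariant under all $\Phi(g)$,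 $g\in G$. **Proposition.** Let $\Phi:G\to\mathrm{End}(V)$ be an irreducible spherical function of type $(n,\ell)$. Then there is a linear isomorphism $T:V\to V_\pi$ with $T\,\Phi(k)=\pi(A(k))\,T$ for all $k\in K$. For every such $T$, put $H(g)=T\,\Phi(g)\,T^{-1}\,\pi(A(g))^{-1}$ for $g\in G$ with $\det A(g)\neq0$. Then for every $r\ge 0$ and every $g\in G$ with $\det A(g)\ne0$, $g_{13}/g_{33}=r$ and $g_{23}=0$, the operator $H(g)$ is diagonal in the basis $\{v_i\}$, and its diagonal entries $h_0,\dots,h_\ell$ depend only on $r$. With $t=(1+r^2)^{-1}\in(0,1]$ this gives a function $H(t)=(h_0(t),\dots,h_\ell(t))^{T}$, and 1. $H$ is not identically zero on $(0,1)$, is real analytic on $(0,1)$, and extends to a function that is analytic at $t=0$; 2. there are $\lambda,\mu\in\mathbb C$ with $DH=\lambda H$ and $EH=\mu H$ on $(0,1)$; 3. if $n+\ell<0$, then $H(t)$ has a zero of order at least $-n-\ell$ at $t=0$. Here $$DH=t(1-t)H''+(A_0-tA_1)H'+\tfrac1{1-t}(B_0-tB_1)H,$$ $$EH=t(1-t)MH''+(C_0-tC_1)H'+\tfrac1{1-t}(D_0+tD_1)H,$$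 where $E_{ij}$ $(0\le i,j\le\ell)$ are the matrix units, sums run over $0\le i\le\ell$ (terms with an index out of range being omitted), and $$\begin{aligned} A_0&=\textstyle\sum(n+\ell-i+1)E_{ii},\qquad A_1=\sum(n+\ell-i+3)E_{ii},\\ B_0&=\textstyle\sum(i+1)(\ell-i)(E_{i,i+1}-E_{ii}),\qquad B_1=\sum i(\ell-i+1)(E_{ii}-E_{i,i-1}),\\ M&=\textstyle\sum(n-\ell+3i)E_{ii},\\ C_0&=\textstyle\sum(n-\ell+3i)(n+\ell-i+1)E_{ii}-3\sum(i+1)(\ell-i)E_{i,i+1},\\ C_1&=\textstyle\sum(n-\ell+3i)(n+\ell-i+3)E_{ii}-3\sum i(\ell-i+1)E_{i,i-1},\\ D_0&=\textstyle\sum(n+2\ell-3i)(i+1)(\ell-i)(E_{i,i+1}-E_{ii})-3\sum(n+\ell-i+1)i(\ell-i+1)(E_{ii}-E_{i,i-1}),\\ D_1&=\textstyle\sum(2n+\ell+3)i(\ell-i+1)(E_{ii}-E_{i,i-1}). \end{aligned}$$ -/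

import Mathlib

open MeasureTheory Matrix

/-! ### The pair `(G, K) = (SU(3), S(U(2) × U(1)))` -/

/-- The group `G = SU(3)`, with the topology induced from the `3 × 3` matrices. -/
abbrev SU3 : Type := Matrix.specialUnitaryGroup (Fin 3) ℂ

/-- The subgroup `K = S(U(2) × U(1))` of the block diagonal elements of `SU(3)`. -/
def subK : Subgroup SU3 where
  carrier := {g | g.1 0 2 = 0 ∧ g.1 1 2 = 0 ∧ g.1 2 0 = 0 ∧ g.1 2 1 = 0}
  one_mem' := by
    refine ⟨?_, ?_, ?_, ?_⟩ <;> simp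
  mul_mem' := by
    rintro a b ⟨h1, h2, h3, h4⟩ ⟨k1, k2, k3, k4⟩
    refine ⟨?_, ?_, ?_, ?_⟩ <;>
      simp [Matrix.mul_apply, Fin.sum_univ_three, h1, h2, h3, h4, k1, k2, k3, k4]
  inv_mem' := by
    rintro a ⟨h1, h2, h3, h4⟩
    have h : (a⁻¹).1 = star a.1 := rfl
    simp only [Set.mem_ofPred_eq]
    rw [h]
    refine ⟨?_, ?_, ?_, ?_⟩ <;> simp [Matrix.star_apply, h1, h2, h3, h4]

instance instIsTopologicalGroupSU3 : IsTopologicalGroup SU3 where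
  continuous_inv := by
    have h : Continuous fun g : SU3 => star g.1 := continuous_star.comp continuous_subtype_val
    exact h.subtype_mk _

theorem isClosed_subK : IsClosed (subK : Set SU3) := by
  have hc : ∀ i j : Fin 3, Continuous fun g : SU3 => g.1 i j := fun i j =>
    continuous_subtype_val.matrix_elem i j
  have e : ∀ i j : Fin 3, IsClosed {g : SU3 | g.1 i j = 0} := fun i j =>
    isClosed_eq (hc i j) continuous_const
  exact (e 0 2).inter ((e 1 2).inter ((e 2 0).inter (e 2 1)))

instance instCompactSpaceSU3 : CompactSpace SU3 := by
  have hc : IsClosed (Matrix.specialUnitaryGroup (Fin 3) ℂ : Set (Matrix (Fin 3) (Fin 3) ℂ)) := by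
    have h1 : IsClosed (Matrix.unitaryGroup (Fin 3) ℂ : Set (Matrix (Fin 3) (Fin 3) ℂ)) :=
      isClosed_unitary
    have h2 : IsClosed {A : Matrix (Fin 3) (Fin 3) ℂ | A.det = 1} :=
      isClosed_eq (continuous_id.matrix_det) continuous_const
    exact h1.inter h2
  have hK : IsCompact (Set.univ.pi fun _ : Fin 3 => Set.univ.pi fun _ : Fin 3 =>
      Metric.closedBall (0 : ℂ) 1) :=
    isCompact_univ_pi fun _ => isCompact_univ_pi fun _ => isCompact_closedBall _ _
  refine isCompact_iff_compactSpace.mp (IsCompact.of_isClosed_subset hK hc ?_)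
  intro A hA i _ j _
  simpa using entry_norm_bound_of_unitary
    (Matrix.specialUnitaryGroup_le_unitaryGroup hA) i j

instance instCompactSpaceSubK : CompactSpace subK :=
  isCompact_iff_compactSpace.mp isClosed_subK.isCompact

noncomputable instance instMeasurableSpaceSubK : MeasurableSpace subK := borel subK

instance instBorelSpaceSubK : BorelSpace subK := ⟨rfl⟩

/-- The Haar measure `dk` of `K`, normalized to total mass one. -/
noncomputable def haarK : Measure subK := Measure.haarMeasure ⊤

/-- The left upper `2 × 2` block `A(g)`. -/
def upperBlock (g : SU3) : Matrix (Fin 2) (Fin 2) ℂ :=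
  g.1.submatrix Fin.castSucc Fin.castSucc

/-! ### The representations `π_{n,ℓ}` -/

/-- The `ℓ`-th symmetric power of `ℂ²`, as the space of homogeneous polynomials of degree `ℓ` in
the vectors `e₁ = X 0`, `e₂ = X 1` of the standard basis of `ℂ²`. -/
abbrev SymPow (l : ℕ) : Type := MvPolynomial.homogeneousSubmodule (Fin 2) ℂ l

/-- The `ℓ`-th symmetric power `A^ℓ` of a `2 × 2` matrix: the restriction to `SymPow l` of the
algebra homomorphism with `e_j ↦ A e_j = ∑ i, A i j e_i`. -/
noncomputable def symPowMap (l : ℕ) (A : Matrix (Fin 2) (Fin 2) ℂ) :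
    Module.End ℂ (SymPow l) :=
  LinearMap.restrict
    (MvPolynomial.aeval (R := ℂ) fun j : Fin 2 =>
      ∑ i : Fin 2, MvPolynomial.C (A i j) * MvPolynomial.X (R := ℂ) i).toLinearMap
    (by
      intro p hp
      rw [MvPolynomial.mem_homogeneousSubmodule] at hp ⊢
      have h := hp.aeval (S := ℂ) (n := 1) (fun j : Fin 2 =>
        ∑ i : Fin 2, MvPolynomial.C (A i j) * MvPolynomial.X (R := ℂ) i)
        (fun j => MvPolynomial.IsHomogeneous.sum _ _ _ fun i _ => by
          simpa using (MvPolynomial.isHomogeneous_C (Fin 2) (A i j)).mul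
            (MvPolynomial.isHomogeneous_X ℂ i))
      simpa using h)

/-- `π_{n,ℓ}(A) = (det A)^n A^ℓ`, meaningful for invertible `A` (and for all `A` if `n ≥ 0`). -/
noncomputable def piRep (n : ℤ) (l : ℕ) (A : Matrix (Fin 2) (Fin 2) ℂ) :
    Module.End ℂ (SymPow l) :=
  A.det ^ n • symPowMap l A

/-- The weight vectors `v_i = e₁^{ℓ-i} e₂^i`, `0 ≤ i ≤ ℓ`. -/
noncomputable def weightVec (l : ℕ) (i : Fin (l + 1)) : SymPow l :=
  ⟨MvPolynomial.X 0 ^ (l - (i : ℕ)) * MvPolynomial.X 1 ^ (i : ℕ), by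
    rw [MvPolynomial.mem_homogeneousSubmodule]
    have h := (MvPolynomial.isHomogeneous_X_pow (R := ℂ) (0 : Fin 2) (l - (i : ℕ))).mul
      (MvPolynomial.isHomogeneous_X_pow (R := ℂ) (1 : Fin 2) (i : ℕ))
    rwa [Nat.sub_add_cancel (Nat.lt_succ_iff.mp i.isLt)] at h⟩

/-- `χ_δ = d(δ) ξ_δ` on `K` for the class `δ` of `π_{n,ℓ}`: the dimension `ℓ + 1` times the
character. -/
noncomputable def chiK (n : ℤ) (l : ℕ) (k : subK) : ℂ :=
  ((l : ℂ) + 1) * LinearMap.trace ℂ (SymPow l) (piRep n l (upperBlock k.1))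

/-! ### Spherical functions -/

section Spherical

variable {V : Type*} [NormedAddCommGroup V] [NormedSpace ℂ V]

/-- Spherical functions on `G` of type `(n,ℓ)`. -/
structure IsSphericalFunction (n : ℤ) (l : ℕ) (Φ : SU3 → (V →L[ℂ] V)) : Prop where
  continuous : Continuous Φ
  map_one : Φ 1 = 1
  mul_eq : ∀ x y : SU3, Φ x * Φ y = ∫ k : subK, chiK n l k⁻¹ • Φ (x * k.1 * y) ∂haarK

/-- The operators `Φ g`, `g ∈ G`, act irreducibly on `V`. -/
def IsIrreducibleFamily (Φ : SU3 → (V →L[ℂ] V)) : Prop :=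
  Nontrivial V ∧
    ∀ W : Submodule ℂ V, (∀ g : SU3, ∀ v ∈ W, Φ g v ∈ W) → W = ⊥ ∨ W = ⊤

/-- `T` identifies `V`, as a representation of `K` through `Φ`, with `(V_π, π)`, `π = π_{n,ℓ}`. -/
def IsKIdentification (n : ℤ) {l : ℕ} (Φ : SU3 → (V →L[ℂ] V)) (T : V ≃ₗ[ℂ] SymPow l) : Prop :=
  ∀ k ∈ subK, ∀ v : V, T (Φ k v) = piRep n l (upperBlock k) (T v)

/-- The function `H(g) = Φ(g) Φ_π(g)⁻¹`, where `Φ_π(g) = π(A(g))`, on the set of all `g ∈ G` with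
`det A(g) ≠ 0`; here `Φ` is viewed as a function with values in `End(V_π)` by means of `T`. -/
noncomputable def sphericalH (n : ℤ) {l : ℕ} (Φ : SU3 → (V →L[ℂ] V)) (T : V ≃ₗ[ℂ] SymPow l)
    (g : SU3) : Module.End ℂ (SymPow l) :=
  T.conj (Φ g : V →ₗ[ℂ] V) * Ring.inverse (piRep n l (upperBlock g))

/-- `H = (h_0, …, h_ℓ)`, as a function of the variable `t = (1 + r²)⁻¹ ∈ (0, 1]`, is the function
attached to `Φ`: the value of `g ↦ Φ(g) Φ_π(g)⁻¹` at the point `(r, 0)`, `r ≥ 0`, of the affine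
plane `ℂ²`, i.e. at any `g` with `det A(g) ≠ 0` and `p(g) = g · (0 : 0 : 1) = (r : 0 : 1)`, is
diagonal in the basis `v_i` with the eigenvalues `h_i(t)`. -/
def IsAttachedFunction (n : ℤ) {l : ℕ} (Φ : SU3 → (V →L[ℂ] V)) (T : V ≃ₗ[ℂ] SymPow l)
    (H : ℝ → Fin (l + 1) → ℂ) : Prop :=
  ∀ r : ℝ, 0 ≤ r → ∀ g : SU3, (upperBlock g).det ≠ 0 →
    g.1 0 2 / g.1 2 2 = (r : ℂ) → g.1 1 2 / g.1 2 2 = 0 →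
    ∀ i : Fin (l + 1), sphericalH n Φ T g (weightVec l i) = H ((1 + r ^ 2)⁻¹) i • weightVec l i

end Spherical

/-! ### The differential operators `D` and `E` in the variable `t` -/

/-- The tridiagonal matrix `∑ (lo i E_{i,i-1} + di i E_{i,i} + up i E_{i,i+1})`, with indices in
`{0, …, ℓ}` (terms with an index out of this range are omitted). -/
def tridiag (l : ℕ) (lo di up : ℕ → ℂ) : Matrix (Fin (l + 1)) (Fin (l + 1)) ℂ :=
  Matrix.of fun i j =>
    if (j : ℕ) + 1 = i then lo i else if (j : ℕ) = i then di i else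
      if (j : ℕ) = i + 1 then up i else 0

def coeffA0 (n : ℤ) (l : ℕ) : Matrix (Fin (l + 1)) (Fin (l + 1)) ℂ :=
  tridiag l 0 (fun i => n + l - i + 1) 0

def coeffA1 (n : ℤ) (l : ℕ) : Matrix (Fin (l + 1)) (Fin (l + 1)) ℂ :=
  tridiag l 0 (fun i => n + l - i + 3) 0

def coeffB0 (l : ℕ) : Matrix (Fin (l + 1)) (Fin (l + 1)) ℂ :=
  tridiag l 0 (fun i => -((i + 1) * (l - i))) (fun i => (i + 1) * (l - i))

def coeffB1 (l : ℕ) : Matrix (Fin (l + 1)) (Fin (l + 1)) ℂ :=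
  tridiag l (fun i => -(i * (l - i + 1))) (fun i => i * (l - i + 1)) 0

def coeffM (n : ℤ) (l : ℕ) : Matrix (Fin (l + 1)) (Fin (l + 1)) ℂ :=
  tridiag l 0 (fun i => n - l + 3 * i) 0

def coeffC0 (n : ℤ) (l : ℕ) : Matrix (Fin (l + 1)) (Fin (l + 1)) ℂ :=
  tridiag l 0 (fun i => (n - l + 3 * i) * (n + l - i + 1)) (fun i => -3 * ((i + 1) * (l - i)))

def coeffC1 (n : ℤ) (l : ℕ) : Matrix (Fin (l + 1)) (Fin (l + 1)) ℂ :=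
  tridiag l (fun i => -3 * (i * (l - i + 1))) (fun i => (n - l + 3 * i) * (n + l - i + 3)) 0

def coeffD0 (n : ℤ) (l : ℕ) : Matrix (Fin (l + 1)) (Fin (l + 1)) ℂ :=
  tridiag l
    (fun i => 3 * (n + l - i + 1) * (i * (l - i + 1)))
    (fun i => -((n + 2 * l - 3 * i) * ((i + 1) * (l - i)))
      - 3 * (n + l - i + 1) * (i * (l - i + 1)))
    (fun i => (n + 2 * l - 3 * i) * ((i + 1) * (l - i)))

def coeffD1 (n : ℤ) (l : ℕ) : Matrix (Fin (l + 1)) (Fin (l + 1)) ℂ :=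
  tridiag l (fun i => -((2 * n + l + 3) * (i * (l - i + 1))))
    (fun i => (2 * n + l + 3) * (i * (l - i + 1))) 0

/-- `DH = t(1-t) H'' + (A₀ - t A₁) H' + (1-t)⁻¹ (B₀ - t B₁) H`. -/
noncomputable def opD (n : ℤ) (l : ℕ) (H : ℝ → Fin (l + 1) → ℂ) (t : ℝ) : Fin (l + 1) → ℂ :=
  (t * (1 - t)) • deriv (deriv H) t
    + (coeffA0 n l - t • coeffA1 n l) *ᵥ deriv H t
    + (1 - t)⁻¹ • ((coeffB0 l - t • coeffB1 l) *ᵥ H t)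

/-- `EH = t(1-t) M H'' + (C₀ - t C₁) H' + (1-t)⁻¹ (D₀ + t D₁) H`. -/
noncomputable def opE (n : ℤ) (l : ℕ) (H : ℝ → Fin (l + 1) → ℂ) (t : ℝ) : Fin (l + 1) → ℂ :=
  (t * (1 - t)) • (coeffM n l *ᵥ deriv (deriv H) t)
    + (coeffC0 n l - t • coeffC1 n l) *ᵥ deriv H t
    + (1 - t)⁻¹ • ((coeffD0 n l + t • coeffD1 n l) *ᵥ H t)

/-! The functional equation forces `Φ(xk) = Φ(x)Φ(k)` and `Φ(kx) = Φ(k)Φ(x)` for `k` in `K`, and at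
`x = y = e` it says that `V` is isotypic of type `π`. That `π` occurs only once is Gelfand's trick.
By Burnside the values of `Φ` span `End(V)`, and `Φ(g) ↦ Φ(gᵀ)` behaves there like an
anti-automorphism. Since `gᵀ` is conjugate to `g` by an element of `K`, this operation fixes the
commutant of `K`, which is therefore commutative (`commutant_comm`) and leaves room for a single
copy of `V_π` (`exists_identification`).

The entries of `Φ` are polynomials in the matrix entries of `g` (`isPolyFun_functional`): the
functionals with polynomial coefficients have an invariant common kernel, and Stone–Weierstrass
provides a nonzero one. Calculus on `G` thereby becomes algebra with derivations of a polynomial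
ring, and directions may be taken in the complexified Lie algebra.

Write `F` for the matrix of `Φ` and `N` for the derived representation of `K`. The expressions `∑
E_{j3}E_{3j}F` and `∑ (E_{j3}E_{3i}F) N(E_{ij})` are equivariant under right translation by `K`. The
differentiated functional equation shows that each is `F` times its value at `e`, which commutes
with `K` and so is scalar by Schur's lemma (`exists_casimirOne_eq`, `exists_casimirTwo_eq`).

Up to `K`, the points in question are the rotations `a(θ)` with `t = cos² θ`. The element `diag(1,
-2, 1)` commutes with `a(θ)`, which makes `F(a(θ))` diagonal. Conjugating the Lie algebra of `K` by
`a(θ)` expresses the derivatives transversal to `K` through `θ`-derivatives and neighbouring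
diagonal entries. With `F_ii(a(θ)) = cos^m θ · h_i(cos² θ)`, `m = n + l - i`, the two scalar
equations become the equations for `D` and `E` (`radial_equations`).

Comparing characters of the torus on both sides of `a(θ)` shows that `F_ii(a(θ))` is `cos^|m| θ`
times a polynomial in `cos² θ` (`exists_polynomial_entry`). Division by `cos^m θ` leaves a
polynomial in `t` divisible by `t^max(-m, 0)`. This gives analyticity and the zero at `t = 0`, and
`h_i(1) = 1` gives nonvanishing. -/

/-! ### Polynomial functions of the matrix entries and invariant derivations -/

/-- Polynomials in the entries of a `3 × 3` matrix. -/
abbrev MatPoly : Type := MvPolynomial (Fin 3 × Fin 3) ℂ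

/-- Evaluation of a polynomial at a matrix. -/
noncomputable def evalMat (M : Matrix (Fin 3) (Fin 3) ℂ) : MatPoly →ₐ[ℂ] ℂ :=
  MvPolynomial.aeval fun q => M q.1 q.2

@[simp] theorem evalMat_X (M : Matrix (Fin 3) (Fin 3) ℂ) (q : Fin 3 × Fin 3) :
    evalMat M (MvPolynomial.X q) = M q.1 q.2 := by simp [evalMat]

@[simp] theorem evalMat_C (M : Matrix (Fin 3) (Fin 3) ℂ) (a : ℂ) :
    evalMat M (MvPolynomial.C a) = a := by simp [evalMat]

/-- The derivation `p ↦ d/ds p(g exp(s X))`. -/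
noncomputable def rightDer (X : Matrix (Fin 3) (Fin 3) ℂ) : Derivation ℂ MatPoly MatPoly :=
  MvPolynomial.mkDerivation ℂ fun q =>
    ∑ m, MvPolynomial.C (X m q.2) * MvPolynomial.X (q.1, m)

/-- The derivation `p ↦ d/ds p(exp(s X) g)`. -/
noncomputable def leftDer (X : Matrix (Fin 3) (Fin 3) ℂ) : Derivation ℂ MatPoly MatPoly :=
  MvPolynomial.mkDerivation ℂ fun q =>
    ∑ m, MvPolynomial.C (X q.1 m) * MvPolynomial.X (m, q.2)

@[simp] theorem rightDer_X (X : Matrix (Fin 3) (Fin 3) ℂ) (q : Fin 3 × Fin 3) :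
    rightDer X (MvPolynomial.X q) = ∑ m, MvPolynomial.C (X m q.2) * MvPolynomial.X (q.1, m) :=
  MvPolynomial.mkDerivation_X _ _ _

@[simp] theorem leftDer_X (X : Matrix (Fin 3) (Fin 3) ℂ) (q : Fin 3 × Fin 3) :
    leftDer X (MvPolynomial.X q) = ∑ m, MvPolynomial.C (X q.1 m) * MvPolynomial.X (m, q.2) :=
  MvPolynomial.mkDerivation_X _ _ _

theorem evalMat_rightDer_X (M X : Matrix (Fin 3) (Fin 3) ℂ) (q : Fin 3 × Fin 3) :
    evalMat M (rightDer X (MvPolynomial.X q)) = (M * X) q.1 q.2 := by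
  simp [Matrix.mul_apply, mul_comm]

theorem evalMat_leftDer_X (M X : Matrix (Fin 3) (Fin 3) ℂ) (q : Fin 3 × Fin 3) :
    evalMat M (leftDer X (MvPolynomial.X q)) = (X * M) q.1 q.2 := by
  simp [Matrix.mul_apply]

theorem rightDer_add (X Y : Matrix (Fin 3) (Fin 3) ℂ) (p : MatPoly) :
    rightDer (X + Y) p = rightDer X p + rightDer Y p := by
  have : rightDer (X + Y) = rightDer X + rightDer Y :=
    MvPolynomial.derivation_ext fun q => by
      simp [add_mul, Finset.sum_add_distrib]
  rw [this]; rfl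

theorem rightDer_smul (c : ℂ) (X : Matrix (Fin 3) (Fin 3) ℂ) (p : MatPoly) :
    rightDer (c • X) p = c • rightDer X p := by
  have : rightDer (c • X) = c • rightDer X :=
    MvPolynomial.derivation_ext fun q => by
      simp [Finset.smul_sum, MvPolynomial.smul_eq_C_mul, mul_assoc]
  rw [this]; rfl

theorem rightDer_neg (X : Matrix (Fin 3) (Fin 3) ℂ) (p : MatPoly) :
    rightDer (-X) p = -rightDer X p := by
  simpa using rightDer_smul (-1) X p

theorem rightDer_sub (X Y : Matrix (Fin 3) (Fin 3) ℂ) (p : MatPoly) :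
    rightDer (X - Y) p = rightDer X p - rightDer Y p := by
  rw [sub_eq_add_neg, rightDer_add, rightDer_neg, sub_eq_add_neg]

theorem leftDer_add (X Y : Matrix (Fin 3) (Fin 3) ℂ) (p : MatPoly) :
    leftDer (X + Y) p = leftDer X p + leftDer Y p := by
  have : leftDer (X + Y) = leftDer X + leftDer Y :=
    MvPolynomial.derivation_ext fun q => by
      simp [add_mul, Finset.sum_add_distrib]
  rw [this]; rfl

theorem leftDer_smul (c : ℂ) (X : Matrix (Fin 3) (Fin 3) ℂ) (p : MatPoly) :
    leftDer (c • X) p = c • leftDer X p := by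
  have : leftDer (c • X) = c • leftDer X :=
    MvPolynomial.derivation_ext fun q => by
      simp [Finset.smul_sum, MvPolynomial.smul_eq_C_mul, mul_assoc]
  rw [this]; rfl

/-- Both sides are derivations, so they need only be compared on the coordinates. Right derivatives
are left-invariant vector fields, hence the bracket carries no extra sign. -/
theorem rightDer_commutator (X Y : Matrix (Fin 3) (Fin 3) ℂ) (p : MatPoly) :
    rightDer X (rightDer Y p) - rightDer Y (rightDer X p) = rightDer (X * Y - Y * X) p := by
  have : ⁅rightDer X, rightDer Y⁆ = rightDer (X * Y - Y * X) :=
    MvPolynomial.derivation_ext fun q => by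
      rw [Derivation.commutator_apply]
      simp only [rightDer_X, Derivation.leibniz, MvPolynomial.derivation_C, smul_eq_mul, Matrix.sub_apply, Matrix.mul_apply, Fin.sum_univ_three, map_add,
        map_mul, map_sub]
      ring
  rw [← this, Derivation.commutator_apply]

/-- Left and right translations commute; the bracket is a derivation, so it is enough that it kills
the coordinates. -/
theorem rightDer_leftDer_comm (X Y : Matrix (Fin 3) (Fin 3) ℂ) (p : MatPoly) :
    rightDer X (leftDer Y p) = leftDer Y (rightDer X p) := by
  have : ⁅rightDer X, leftDer Y⁆ = 0 :=
    MvPolynomial.derivation_ext fun q => by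
      rw [Derivation.commutator_apply]
      simp only [rightDer_X, leftDer_X, Derivation.leibniz, MvPolynomial.derivation_C,
        smul_eq_mul, Fin.sum_univ_three, map_add,
        Derivation.coe_zero, Pi.zero_apply]
      ring
  have h := congrArg (fun D => D p) this
  simpa [Derivation.commutator_apply, sub_eq_zero] using h

/-- Two derivations that agree at a point on the coordinates agree there on all polynomials. -/
theorem evalMat_derivation_congr {M : Matrix (Fin 3) (Fin 3) ℂ}
    {D D' : Derivation ℂ MatPoly MatPoly}
    (h : ∀ q, evalMat M (D (MvPolynomial.X q)) = evalMat M (D' (MvPolynomial.X q)))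
    (p : MatPoly) : evalMat M (D p) = evalMat M (D' p) := by
  induction p using MvPolynomial.induction_on with
  | C a => simp [MvPolynomial.derivation_C]
  | add p q hp hq => simp [hp, hq]
  | mul_X p q hp => simp [Derivation.leibniz, hp, h]

/-- Infinitesimal form of `exp(sX) M = M exp(sY)`. It is applied with `X` block diagonal and `Y`
not: derivatives transversal to `K` are read off from the behaviour under left translation by `K`.
-/
theorem evalMat_leftDer_eq_rightDer {M X Y : Matrix (Fin 3) (Fin 3) ℂ} (h : X * M = M * Y)
    (p : MatPoly) : evalMat M (leftDer X p) = evalMat M (rightDer Y p) :=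
  evalMat_derivation_congr
    (fun q => by rw [evalMat_leftDer_X, evalMat_rightDer_X, h]) p

theorem hasDerivAt_evalMat {γ : ℝ → Matrix (Fin 3) (Fin 3) ℂ} {s : ℝ}
    {D : Derivation ℂ MatPoly MatPoly}
    (h : ∀ i j, HasDerivAt (fun u => γ u i j)
      (evalMat (γ s) (D (MvPolynomial.X (i, j)))) s) (p : MatPoly) :
    HasDerivAt (fun u => evalMat (γ u) p) (evalMat (γ s) (D p)) s := by
  induction p using MvPolynomial.induction_on with
  | C a => simpa [MvPolynomial.derivation_C] using hasDerivAt_const s a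
  | add p q hp hq => simpa using hp.fun_add hq
  | mul_X p q hp =>
    have := hp.mul (h q.1 q.2)
    simp only [map_mul, evalMat_X, Derivation.leibniz, smul_eq_mul, map_add]
    convert! this using 1
    simp; ring

theorem hasDerivAt_evalMat_right {γ : ℝ → Matrix (Fin 3) (Fin 3) ℂ} {s : ℝ}
    {X : Matrix (Fin 3) (Fin 3) ℂ}
    (h : ∀ i j, HasDerivAt (fun u => γ u i j) ((γ s * X) i j) s) (p : MatPoly) :
    HasDerivAt (fun u => evalMat (γ u) p) (evalMat (γ s) (rightDer X p)) s :=
  hasDerivAt_evalMat (fun i j => by simpa only [evalMat_rightDer_X] using h i j) p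

theorem hasDerivAt_evalMat_left {γ : ℝ → Matrix (Fin 3) (Fin 3) ℂ} {s : ℝ}
    {X : Matrix (Fin 3) (Fin 3) ℂ}
    (h : ∀ i j, HasDerivAt (fun u => γ u i j) ((X * γ s) i j) s) (p : MatPoly) :
    HasDerivAt (fun u => evalMat (γ u) p) (evalMat (γ s) (leftDer X p)) s :=
  hasDerivAt_evalMat (fun i j => by simpa only [evalMat_leftDer_X] using h i j) p

/-- Polynomials split under multiplication of matrices. -/
theorem exists_evalMat_mul (p : MatPoly) : ∃ (m : ℕ) (a b : Fin m → MatPoly),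
    ∀ z y : Matrix (Fin 3) (Fin 3) ℂ, evalMat (z * y) p = ∑ i, evalMat z (a i) * evalMat y (b i) := by
  suffices h : ∃ (ι : Type) (_ : Fintype ι) (a b : ι → MatPoly),
      ∀ z y : Matrix (Fin 3) (Fin 3) ℂ,
        evalMat (z * y) p = ∑ i, evalMat z (a i) * evalMat y (b i) by
    obtain ⟨ι, _, a, b, h⟩ := h
    refine ⟨Fintype.card ι, a ∘ (Fintype.equivFin ι).symm, b ∘ (Fintype.equivFin ι).symm,
      fun z y => ?_⟩
    rw [h]
    exact (Equiv.sum_comp (Fintype.equivFin ι).symm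
      fun i => evalMat z (a i) * evalMat y (b i)).symm
  induction p using MvPolynomial.induction_on with
  | C c => exact ⟨Unit, inferInstance, fun _ => MvPolynomial.C c, fun _ => 1, by simp⟩
  | add p q hp hq =>
    obtain ⟨ι, _, a, b, h⟩ := hp
    obtain ⟨ι', _, a', b', h'⟩ := hq
    exact ⟨ι ⊕ ι', inferInstance, Sum.elim a a', Sum.elim b b', by simp [h, h']⟩
  | mul_X p q hp =>
    obtain ⟨ι, _, a, b, h⟩ := hp
    refine ⟨ι × Fin 3, inferInstance, fun i => a i.1 * MvPolynomial.X (q.1, i.2),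
      fun i => b i.1 * MvPolynomial.X (i.2, q.2), fun z y => ?_⟩
    rw [map_mul, h, evalMat_X, Matrix.mul_apply, Finset.sum_mul_sum, Fintype.sum_prod_type]
    refine Finset.sum_congr rfl fun i _ => Finset.sum_congr rfl fun j _ => ?_
    simp; ring

/-- The splitting is differentiated along `y + u yX`. An affine curve suffices because the
hypothesis covers all matrices, not only unitary ones. -/
theorem evalMat_mul_rightDer {p : MatPoly} {m : ℕ} {a b : Fin m → MatPoly}
    (h : ∀ z y : Matrix (Fin 3) (Fin 3) ℂ,
      evalMat (z * y) p = ∑ i, evalMat z (a i) * evalMat y (b i))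
    (X z y : Matrix (Fin 3) (Fin 3) ℂ) :
    evalMat (z * y) (rightDer X p) = ∑ i, evalMat z (a i) * evalMat y (rightDer X (b i)) := by
  have key : ∀ w : Matrix (Fin 3) (Fin 3) ℂ, ∀ i j,
      HasDerivAt (fun u : ℝ => (w + (u : ℂ) • (w * X)) i j) ((w * X) i j) 0 := by
    intro w i j
    have h1 : HasDerivAt (fun u : ℝ => (u : ℂ)) 1 0 := Complex.ofRealCLM.hasDerivAt
    simpa using (h1.mul_const ((w * X) i j)).const_add (w i j)
  have hd : ∀ w : Matrix (Fin 3) (Fin 3) ℂ, ∀ q : MatPoly, HasDerivAt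
      (fun u : ℝ => evalMat (w + (u : ℂ) • (w * X)) q) (evalMat w (rightDer X q)) 0 := by
    intro w q
    have := hasDerivAt_evalMat_right (γ := fun u : ℝ => w + (u : ℂ) • (w * X)) (s := 0) (X := X)
      (fun i j => by simpa using key w i j) q
    simpa using this
  have h1 := hd (z * y) p
  have h2 : HasDerivAt (fun u : ℝ => ∑ i, evalMat z (a i) *
      evalMat (y + (u : ℂ) • (y * X)) (b i))
      (∑ i, evalMat z (a i) * evalMat y (rightDer X (b i))) 0 :=
    HasDerivAt.fun_sum fun i _ => (hd y (b i)).const_mul _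
  refine h1.unique (h2.congr_of_eventuallyEq (Filter.Eventually.of_forall fun u => ?_))
  simp only
  rw [← h, mul_add, mul_smul_comm, ← mul_assoc]

/-- Right translation of polynomials. -/
noncomputable def rightTrans (k : Matrix (Fin 3) (Fin 3) ℂ) : MatPoly →ₐ[ℂ] MatPoly :=
  MvPolynomial.aeval fun q => ∑ m, MvPolynomial.C (k m q.2) * MvPolynomial.X (q.1, m)

theorem evalMat_rightTrans (k M : Matrix (Fin 3) (Fin 3) ℂ) (p : MatPoly) :
    evalMat M (rightTrans k p) = evalMat (M * k) p := by
  induction p using MvPolynomial.induction_on with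
  | C a => simp [rightTrans]
  | add p q hp hq => simp [hp, hq]
  | mul_X p q hp => 
    rw [map_mul, map_mul, hp, map_mul]
    simp [rightTrans, Matrix.mul_apply, mul_comm]

/-- Infinitesimal form of `exp(sX) k = k exp(sY)`. -/
theorem rightDer_rightTrans {k X Y : Matrix (Fin 3) (Fin 3) ℂ} (h : X * k = k * Y) (p : MatPoly) :
    rightDer X (rightTrans k p) = rightTrans k (rightDer Y p) := by
  induction p using MvPolynomial.induction_on with
  | C a => simp [rightTrans, MvPolynomial.derivation_C]
  | add p q hp hq => simp [hp, hq]
  | mul_X p q hp =>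
    rw [map_mul, Derivation.leibniz, Derivation.leibniz, hp, map_add]
    have : rightDer X (rightTrans k (MvPolynomial.X q))
        = rightTrans k (rightDer Y (MvPolynomial.X q)) := by
      have hh : ∀ i, MvPolynomial.C (σ := Fin 3 × Fin 3) (∑ m, X i m * k m q.2)
          = MvPolynomial.C (∑ m, k i m * Y m q.2) := by
        intro i
        simpa [Matrix.mul_apply] using
          congrArg (MvPolynomial.C (σ := Fin 3 × Fin 3)) (congrFun (congrFun h i) q.2)
      have h0 := hh 0
      have h1 := hh 1
      have h2 := hh 2
      simp only [Fin.sum_univ_three, map_add, map_mul] at h0 h1 h2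
      simp only [rightTrans, MvPolynomial.aeval_X, Derivation.leibniz, rightDer_X,
        MvPolynomial.derivation_C, map_mul, MvPolynomial.algHom_C, smul_eq_mul,
        MvPolynomial.algebraMap_eq, Fin.sum_univ_three, map_add]
      linear_combination MvPolynomial.X (q.1, 0) * h0 + MvPolynomial.X (q.1, 1) * h1 +
        MvPolynomial.X (q.1, 2) * h2
    rw [this]
    simp [smul_eq_mul]

/-! ### Curves in `SU(3)` -/

attribute [local instance] Matrix.linftyOpNormedRing Matrix.linftyOpNormedAlgebra in
theorem hasDerivAt_exp_entry (X : Matrix (Fin 3) (Fin 3) ℂ) (i j : Fin 3) :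
    HasDerivAt (fun s : ℝ => NormedSpace.exp (s • X) i j) (X i j) 0 := by
  have h := hasDerivAt_exp_smul_const (𝕂 := ℝ) X (0 : ℝ)
  rw [zero_smul, NormedSpace.exp_zero, one_mul] at h
  have L : Matrix (Fin 3) (Fin 3) ℂ →L[ℝ] ℂ :=
    LinearMap.toContinuousLinearMap (Matrix.entryLinearMap ℝ ℂ i j)
  exact (LinearMap.toContinuousLinearMap
    (Matrix.entryLinearMap ℝ ℂ i j)).hasFDerivAt.comp_hasDerivAt (0 : ℝ) h

/-- A block diagonal matrix. -/
def IsBlock (X : Matrix (Fin 3) (Fin 3) ℂ) : Prop :=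
  X 0 2 = 0 ∧ X 1 2 = 0 ∧ X 2 0 = 0 ∧ X 2 1 = 0

theorem exp_smul_add (X : Matrix (Fin 3) (Fin 3) ℂ) (s u : ℝ) :
    NormedSpace.exp ((s + u) • X) = NormedSpace.exp (s • X) * NormedSpace.exp (u • X) := by
  rw [add_smul, Matrix.exp_add_of_commute]
  exact ((Commute.refl X).smul_left s).smul_right u

/-- The function `s ↦ det exp(sX)` is multiplicative with derivative `tr X = 0` at the origin, so
its derivative vanishes everywhere. -/
theorem det_exp_smul_of_trace_eq_zero {X : Matrix (Fin 3) (Fin 3) ℂ} (ht : X.trace = 0) (s : ℝ) :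
    (NormedSpace.exp (s • X)).det = 1 := by
  set d : ℝ → ℂ := fun s => (NormedSpace.exp (s • X)).det with hd
  have hmul : ∀ s u, d (s + u) = d s * d u := fun s u => by
    simp only [hd, exp_smul_add, Matrix.det_mul]
  have hd0 : HasDerivAt d 0 0 := by
    have hX := hasDerivAt_exp_entry X
    have h0 : ∀ i j, NormedSpace.exp ((0 : ℝ) • X) i j = (1 : Matrix (Fin 3) (Fin 3) ℂ) i j := by
      simp
    have := (((((((hX 0 0).mul (hX 1 1)).mul (hX 2 2)).sub
      (((hX 0 0).mul (hX 1 2)).mul (hX 2 1))).sub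
      (((hX 0 1).mul (hX 1 0)).mul (hX 2 2))).add
      (((hX 0 1).mul (hX 1 2)).mul (hX 2 0))).add
      (((hX 0 2).mul (hX 1 0)).mul (hX 2 1))).sub
      (((hX 0 2).mul (hX 1 1)).mul (hX 2 0))
    refine (this.congr_of_eventuallyEq
      (Filter.Eventually.of_forall fun u => ?_)).congr_deriv ?_
    · simp [hd, Matrix.det_fin_three]
    · simp only [Pi.mul_apply, h0]
      rw [← ht]
      simp [Matrix.trace, Fin.sum_univ_three]
  have hds : ∀ s, HasDerivAt d 0 s := by
    intro s
    have h1 : HasDerivAt (fun u => d (u - s)) 0 s := by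
      have := HasDerivAt.comp_sub_const (f := d) (f' := 0) s s (by simpa using hd0)
      exact this
    refine ((h1.const_mul (d s)).congr_of_eventuallyEq
      (Filter.Eventually.of_forall fun u => ?_)).congr_deriv (by simp)
    simp only [← hmul, add_sub_cancel]
  have := is_const_of_deriv_eq_zero (fun s => (hds s).differentiableAt)
    (fun s => (hds s).deriv) s 0
  change d s = 1
  rw [this]
  simp [hd]

theorem exists_curve_SU3 {X : Matrix (Fin 3) (Fin 3) ℂ} (hX : Xᴴ = -X) (ht : X.trace = 0) :
    ∃ γ : ℝ → SU3, γ 0 = 1 ∧ (∀ i j, HasDerivAt (fun s => (γ s).1 i j) (X i j) 0) ∧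
      (IsBlock X → ∀ s, γ s ∈ subK) := by
  have hmem : ∀ s : ℝ, NormedSpace.exp (s • X) ∈ Matrix.specialUnitaryGroup (Fin 3) ℂ := by
    intro s
    rw [Matrix.mem_specialUnitaryGroup_iff, Matrix.mem_unitaryGroup_iff]
    refine ⟨?_, det_exp_smul_of_trace_eq_zero ht s⟩
    have : star (NormedSpace.exp (s • X)) = NormedSpace.exp ((-s) • X) := by
      rw [Matrix.star_eq_conjTranspose, ← Matrix.exp_conjTranspose, Matrix.conjTranspose_smul, hX]
      simp
    rw [this, ← exp_smul_add]
    simp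
  refine ⟨fun s => ⟨NormedSpace.exp (s • X), hmem s⟩, ?_, ?_, ?_⟩
  · apply Subtype.ext; simp
  · intro i j; exact hasDerivAt_exp_entry X i j
  · intro hb s
    obtain ⟨h1, h2, h3, h4⟩ := hb
    -- Block diagonal matrices are those that commute with `diag(1, 1, -1)`, a property that the
    -- exponential inherits.
    set J : Matrix (Fin 3) (Fin 3) ℂ := Matrix.diagonal ![1, 1, -1] with hJ
    have hJJ : J * J = 1 := by
      rw [hJ, Matrix.diagonal_mul_diagonal, ← Matrix.diagonal_one]
      congr 1; ext i; fin_cases i <;> simp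
    have hu : IsUnit J := ⟨⟨J, J, hJJ, hJJ⟩, rfl⟩
    have hinv : J⁻¹ = J := Matrix.inv_eq_right_inv hJJ
    have hc : J * (s • X) * J⁻¹ = s • X := by
      rw [hinv]
      ext i j
      simp only [hJ, Matrix.mul_diagonal, Matrix.diagonal_mul]
      fin_cases i <;> fin_cases j <;> simp [h1, h2, h3, h4]
    have he := Matrix.exp_conj J (s • X) hu
    rw [hc, hinv] at he
    have hent : ∀ i j, NormedSpace.exp (s • X) i j =
        ![1, 1, -1] i * NormedSpace.exp (s • X) i j * ![1, 1, -1] j := by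
      intro i j
      have := congrFun (congrFun he i) j
      simpa only [hJ, Matrix.mul_diagonal, Matrix.diagonal_mul] using this
    refine ⟨?_, ?_, ?_, ?_⟩
    · have := hent 0 2; simp at this; exact self_eq_neg.mp this
    · have := hent 1 2; simp at this; exact self_eq_neg.mp this
    · have := hent 2 0; simp at this; exact self_eq_neg.mp this
    · have := hent 2 1; simp at this; exact self_eq_neg.mp this

/-- Every matrix is a complex combination of two skew-Hermitian ones, of the same shape. -/
theorem exists_skew_decomposition (X : Matrix (Fin 3) (Fin 3) ℂ) :
    ∃ Y Z : Matrix (Fin 3) (Fin 3) ℂ, Yᴴ = -Y ∧ Zᴴ = -Z ∧ X = Y + Complex.I • Z ∧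
      (X.trace = 0 → Y.trace = 0 ∧ Z.trace = 0) ∧ (IsBlock X → IsBlock Y ∧ IsBlock Z) := by
  refine ⟨(2⁻¹ : ℂ) • (X - Xᴴ), (-(Complex.I * 2⁻¹)) • (X + Xᴴ), ?_, ?_, ?_, ?_, ?_⟩
  · simp [Matrix.conjTranspose_smul, ← smul_neg]
  · simp [Matrix.conjTranspose_smul, add_comm]
  · rw [smul_smul]
    have : Complex.I * -(Complex.I * 2⁻¹) = 2⁻¹ := by
      rw [mul_neg, ← mul_assoc, Complex.I_mul_I]; ring
    rw [this, ← smul_add]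
    ext i j
    simp; ring
  · intro h
    simp [Matrix.trace_smul, Matrix.trace_conjTranspose, h]
  · rintro ⟨h1, h2, h3, h4⟩
    refine ⟨⟨?_, ?_, ?_, ?_⟩, ⟨?_, ?_, ?_, ?_⟩⟩ <;> simp [h1, h2, h3, h4]

/-- For skew-Hermitian `X` one differentiates along a curve in the group; complex linearity in `X`
reaches all traceless matrices. Identities that hold only on SU(3) can thus be differentiated in
complexified directions. -/
theorem evalMat_rightDer_eq_zero_of_vanishing {p : MatPoly} (hp : ∀ g : SU3, evalMat g.1 p = 0)
    {X : Matrix (Fin 3) (Fin 3) ℂ} (ht : X.trace = 0) (g : SU3) :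
    evalMat g.1 (rightDer X p) = 0 := by
  have key : ∀ X : Matrix (Fin 3) (Fin 3) ℂ, Xᴴ = -X → X.trace = 0 →
      evalMat g.1 (rightDer X p) = 0 := by
    intro X hX ht
    obtain ⟨γ, h0, hγ, -⟩ := exists_curve_SU3 hX ht
    have hd : ∀ i j, HasDerivAt (fun s => (g * γ s).1 i j) (((g * γ 0).1 * X) i j) 0 := by
      intro i j
      rw [h0, mul_one]
      simp only [Submonoid.coe_mul, Matrix.mul_apply]
      exact HasDerivAt.fun_sum fun m _ => (hγ m j).const_mul _
    have h1 := hasDerivAt_evalMat_right (γ := fun s => (g * γ s).1) hd p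
    simp only [hp, h0, mul_one] at h1
    exact h1.unique (hasDerivAt_const _ _)
  obtain ⟨Y, Z, hY, hZ, hXYZ, htr, -⟩ := exists_skew_decomposition X
  rw [hXYZ, rightDer_add, rightDer_smul, map_add, map_smul, key Y hY (htr ht).1,
    key Z hZ (htr ht).2]
  simp

/-! ### Elements of `SU(3)` -/

/-- The diagonal element `diag(z, w, (zw)⁻¹)`. -/
noncomputable def diagSU (z w : Circle) : SU3 :=
  ⟨Matrix.diagonal ![(z : ℂ), w, ((z * w)⁻¹ : Circle)], by
    rw [Matrix.mem_specialUnitaryGroup_iff, Matrix.mem_unitaryGroup_iff]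
    constructor
    · rw [Matrix.star_eq_conjTranspose, Matrix.diagonal_conjTranspose,
        Matrix.diagonal_mul_diagonal, ← Matrix.diagonal_one]
      congr 1
      ext i
      have hc : ∀ u : Circle, (u : ℂ) * star (u : ℂ) = 1 := fun u => by
        simp [Complex.mul_conj, Complex.normSq_eq_norm_sq, Circle.norm_coe]
      fin_cases i
      exacts [hc z, hc w, hc _]
    · rw [Matrix.det_diagonal, Fin.prod_univ_three]
      simp only [Matrix.cons_val, ← Circle.coe_mul]
      rw [mul_inv_cancel]; rfl⟩

theorem diagSU_mem (z w : Circle) : diagSU z w ∈ subK := by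
  refine ⟨?_, ?_, ?_, ?_⟩ <;> simp [diagSU]

/-- The rotation `a(θ)` in the plane of `e₁, e₃`. -/
noncomputable def rotA (θ : ℝ) : SU3 :=
  ⟨!![(Real.cos θ : ℂ), 0, (Real.sin θ : ℂ); 0, 1, 0; -(Real.sin θ : ℂ), 0, (Real.cos θ : ℂ)], by
    have h : (Real.cos θ : ℂ) ^ 2 + (Real.sin θ : ℂ) ^ 2 = 1 := by
      exact_mod_cast Real.cos_sq_add_sin_sq θ
    rw [Matrix.mem_specialUnitaryGroup_iff, Matrix.mem_unitaryGroup_iff]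
    constructor
    · ext i j
      fin_cases i <;> fin_cases j <;>
        simp [Matrix.mul_apply, Fin.sum_univ_three, -Complex.ofReal_cos, -Complex.ofReal_sin] <;>
        first | linear_combination h | ring
    · simp [Matrix.det_fin_three, -Complex.ofReal_cos, -Complex.ofReal_sin]
      linear_combination h⟩

/-- The rotation in the plane of `e₁, e₂`. -/
noncomputable def rotK (θ : ℝ) : SU3 :=
  ⟨!![(Real.cos θ : ℂ), -(Real.sin θ : ℂ), 0; (Real.sin θ : ℂ), (Real.cos θ : ℂ), 0; 0, 0, 1], by
    have h : (Real.cos θ : ℂ) ^ 2 + (Real.sin θ : ℂ) ^ 2 = 1 := by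
      exact_mod_cast Real.cos_sq_add_sin_sq θ
    rw [Matrix.mem_specialUnitaryGroup_iff, Matrix.mem_unitaryGroup_iff]
    constructor
    · ext i j
      fin_cases i <;> fin_cases j <;>
        simp [Matrix.mul_apply, Fin.sum_univ_three, -Complex.ofReal_cos, -Complex.ofReal_sin] <;>
        first | linear_combination h | ring
    · simp [Matrix.det_fin_three, -Complex.ofReal_cos, -Complex.ofReal_sin]
      linear_combination h⟩

theorem rotK_mem (θ : ℝ) : rotK θ ∈ subK := by
  refine ⟨?_, ?_, ?_, ?_⟩ <;> simp [rotK]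

theorem upperBlock_apply (g : SU3) (i j : Fin 2) :
    upperBlock g i j = g.1 i.castSucc j.castSucc := rfl

theorem upperBlock_mul_right (g : SU3) {k : SU3} (hk : k ∈ subK) :
    upperBlock (g * k) = upperBlock g * upperBlock k := by
  obtain ⟨h1, h2, h3, h4⟩ := hk
  ext i j
  simp only [upperBlock_apply, Submonoid.coe_mul, Matrix.mul_apply, Fin.sum_univ_three,
    Fin.sum_univ_two]
  fin_cases j <;> simp [h3, h4]

theorem upperBlock_mul_left {k : SU3} (hk : k ∈ subK) (g : SU3) :
    upperBlock (k * g) = upperBlock k * upperBlock g := by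
  obtain ⟨h1, h2, h3, h4⟩ := hk
  ext i j
  simp only [upperBlock_apply, Submonoid.coe_mul, Matrix.mul_apply, Fin.sum_univ_three,
    Fin.sum_univ_two]
  fin_cases i <;> simp [h1, h2]

@[simp] theorem upperBlock_one : upperBlock 1 = 1 := by
  ext i j; fin_cases i <;> fin_cases j <;> simp [upperBlock]

theorem det_upperBlock_ne_zero {k : SU3} (hk : k ∈ subK) : (upperBlock k).det ≠ 0 := by
  intro h
  have h1 : upperBlock k * upperBlock k⁻¹ = 1 := by
    rw [← upperBlock_mul_left hk, mul_inv_cancel, upperBlock_one]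
  have := congrArg Matrix.det h1
  rw [Matrix.det_mul, h] at this
  simp at this

theorem continuous_upperBlock : Continuous upperBlock :=
  continuous_subtype_val.matrix_submatrix _ _

/-! ### Symmetric powers -/

theorem symPowMap_coe (l : ℕ) (A : Matrix (Fin 2) (Fin 2) ℂ) (p : SymPow l) :
    (symPowMap l A p : MvPolynomial (Fin 2) ℂ) = MvPolynomial.aeval (R := ℂ) (fun j : Fin 2 =>
      ∑ i : Fin 2, MvPolynomial.C (A i j) * MvPolynomial.X (R := ℂ) i) p.1 := rfl

theorem symPowMap_one (l : ℕ) : symPowMap l 1 = 1 := by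
  refine LinearMap.ext fun p => Subtype.ext ?_
  rw [symPowMap_coe]
  have : (fun j : Fin 2 => ∑ i : Fin 2, MvPolynomial.C ((1 : Matrix (Fin 2) (Fin 2) ℂ) i j) *
      MvPolynomial.X (R := ℂ) i) = MvPolynomial.X := by
    funext j; fin_cases j <;> simp [Matrix.one_apply]
  rw [this]; simp

theorem symPowMap_mul (l : ℕ) (A B : Matrix (Fin 2) (Fin 2) ℂ) :
    symPowMap l (A * B) = symPowMap l A * symPowMap l B := by
  refine LinearMap.ext fun p => Subtype.ext ?_
  rw [Module.End.mul_apply, symPowMap_coe, symPowMap_coe, symPowMap_coe,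
    ← AlgHom.comp_apply, MvPolynomial.comp_aeval]
  congr 2
  funext j
  simp [Matrix.mul_apply, Fin.sum_univ_two]
  ring

theorem piRep_mul (n : ℤ) (l : ℕ) (A B : Matrix (Fin 2) (Fin 2) ℂ) :
    piRep n l (A * B) = piRep n l A * piRep n l B := by
  rw [piRep, piRep, piRep, Matrix.det_mul, mul_zpow, symPowMap_mul, smul_mul_smul_comm]

@[simp] theorem piRep_one (n : ℤ) (l : ℕ) : piRep n l 1 = 1 := by
  simp [piRep, symPowMap_one]

/-- Exponents of the weight vectors. -/
noncomputable def weightExp (l : ℕ) (i : Fin (l + 1)) : Fin 2 →₀ ℕ :=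
  Finsupp.single 0 (l - (i : ℕ)) + Finsupp.single 1 (i : ℕ)

theorem weightExp_zero (l : ℕ) (i : Fin (l + 1)) : weightExp l i 0 = l - i := by
  simp [weightExp]

theorem weightExp_one (l : ℕ) (i : Fin (l + 1)) : weightExp l i 1 = i := by
  simp [weightExp]

theorem weightExp_inj {l : ℕ} {i j : Fin (l + 1)} : weightExp l i = weightExp l j ↔ i = j := by
  refine ⟨fun h => ?_, fun h => h ▸ rfl⟩
  have := DFunLike.congr_fun h 1
  rw [weightExp_one, weightExp_one] at this
  exact Fin.ext this

theorem weightVec_coe (l : ℕ) (i : Fin (l + 1)) :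
    (weightVec l i : MvPolynomial (Fin 2) ℂ) = MvPolynomial.monomial (weightExp l i) 1 := by
  change MvPolynomial.X 0 ^ _ * MvPolynomial.X 1 ^ _ = _
  rw [weightExp, MvPolynomial.monomial_add_single, MvPolynomial.X_pow_eq_monomial]

theorem coeff_weightVec (l : ℕ) (i j : Fin (l + 1)) :
    MvPolynomial.coeff (weightExp l i) (weightVec l j : MvPolynomial (Fin 2) ℂ)
      = if j = i then 1 else 0 := by
  rw [weightVec_coe, MvPolynomial.coeff_monomial]
  simp only [weightExp_inj]

/-- Coordinates with respect to the weight vectors. -/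
noncomputable def weightEquiv (l : ℕ) : SymPow l ≃ₗ[ℂ] (Fin (l + 1) → ℂ) where
  toFun p i := MvPolynomial.coeff (weightExp l i) p.1
  map_add' p q := by ext i; simp
  map_smul' c p := by ext i; simp
  invFun c := ∑ i, c i • weightVec l i
  left_inv p := by
    apply Subtype.ext
    ext d
    rw [Submodule.coe_sum, MvPolynomial.coeff_sum]
    simp only [Submodule.coe_smul, MvPolynomial.coeff_smul, weightVec_coe,
      MvPolynomial.coeff_monomial, smul_eq_mul, mul_ite, mul_one, mul_zero]
    by_cases hd : d 0 + d 1 = l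
    · have hlt : d 1 < l + 1 := by omega
      have : weightExp l ⟨d 1, hlt⟩ = d := by
        ext i
        fin_cases i
        · simp [weightExp_zero]; omega
        · simp [weightExp_one]
      rw [Finset.sum_eq_single ⟨d 1, hlt⟩]
      · simp [this]
      · intro b _ hb
        rw [if_neg]
        rw [← this]
        exact fun h => hb (weightExp_inj.mp h)
      · simp
    · rw [Finset.sum_eq_zero, eq_comm]
      · by_contra h
        have := (MvPolynomial.mem_homogeneousSubmodule _ _).mp p.2 h
        apply hd
        rw [← this, Finsupp.weight_apply, Finsupp.sum_fintype _ _ (by simp)]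
        simp [Fin.sum_univ_two]
      · intro i _
        rw [if_neg]
        rintro rfl
        apply hd
        rw [weightExp_zero, weightExp_one]
        have := i.2
        omega
  right_inv c := by
    funext i
    simp [MvPolynomial.coeff_sum, coeff_weightVec]

/-- The basis of weight vectors. -/
noncomputable def weightBasis (l : ℕ) : Module.Basis (Fin (l + 1)) ℂ (SymPow l) :=
  Module.Basis.ofEquivFun (weightEquiv l)

theorem weightBasis_apply (l : ℕ) (i : Fin (l + 1)) : weightBasis l i = weightVec l i := by
  apply (weightEquiv l).injective
  funext j
  rw [weightBasis, Module.Basis.coe_ofEquivFun, LinearEquiv.apply_symm_apply]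
  change _ = MvPolynomial.coeff (weightExp l j) (weightVec l i).1
  rw [coeff_weightVec, Pi.single_apply]
  simp [eq_comm]

theorem weightBasis_repr (l : ℕ) (p : SymPow l) (i : Fin (l + 1)) :
    (weightBasis l).repr p i = MvPolynomial.coeff (weightExp l i) p.1 := rfl

instance instFiniteSymPow (l : ℕ) : Module.Finite ℂ (SymPow l) :=
  Module.Finite.of_basis (weightBasis l)

theorem symPowMap_diagonal_weightVec (l : ℕ) (a b : ℂ) (i : Fin (l + 1)) :
    symPowMap l (Matrix.diagonal ![a, b]) (weightVec l i)
      = (a ^ (l - (i : ℕ)) * b ^ (i : ℕ)) • weightVec l i := by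
  apply Subtype.ext
  rw [symPowMap_coe]
  simp only [weightVec, Submodule.coe_smul, map_mul, map_pow, MvPolynomial.aeval_X,
    Fin.sum_univ_two, MvPolynomial.smul_eq_C_mul]
  simp
  ring

theorem continuous_coeff_aeval (p : MvPolynomial (Fin 2) ℂ) (d : Fin 2 →₀ ℕ) :
    Continuous fun A : Matrix (Fin 2) (Fin 2) ℂ => MvPolynomial.coeff d
      (MvPolynomial.aeval (R := ℂ) (fun j : Fin 2 =>
        ∑ i : Fin 2, MvPolynomial.C (A i j) * MvPolynomial.X (R := ℂ) i) p) := by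
  induction p using MvPolynomial.induction_on generalizing d with
  | C a => simpa using continuous_const
  | add p q hp hq => simpa using (hp d).fun_add (hq d)
  | mul_X p q hp =>
    simp only [map_mul, MvPolynomial.coeff_mul]
    refine continuous_finsetSum _ fun x _ => (hp _).mul ?_
    simp only [MvPolynomial.aeval_X, MvPolynomial.coeff_sum, MvPolynomial.coeff_C_mul]
    refine continuous_finsetSum _ fun i _ => ?_
    exact (continuous_id.matrix_elem i q).mul continuous_const

/-- The matrix of `π(A(g))` in the basis of weight vectors. -/
noncomputable def piMat (n : ℤ) (l : ℕ) (g : SU3) : Matrix (Fin (l + 1)) (Fin (l + 1)) ℂ :=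
  LinearMap.toMatrix (weightBasis l) (weightBasis l) (piRep n l (upperBlock g))

theorem continuous_piMat (n : ℤ) (l : ℕ) : Continuous fun k : subK => piMat n l k.1 := by
  have hA : Continuous fun k : subK => upperBlock k.1 :=
    continuous_upperBlock.comp continuous_subtype_val
  refine continuous_matrix fun i j => ?_
  simp only [piMat, LinearMap.toMatrix_apply, piRep, LinearMap.smul_apply, map_smul,
    Finsupp.smul_apply, smul_eq_mul, weightBasis_repr, symPowMap_coe]
  refine Continuous.mul ?_ ((continuous_coeff_aeval _ _).comp hA)
  exact hA.matrix_det.zpow₀ n fun k => Or.inl (det_upperBlock_ne_zero k.2)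

theorem chiK_eq (n : ℤ) (l : ℕ) (k : subK) :
    chiK n l k = ((l : ℂ) + 1) * (piMat n l k.1).trace := by
  rw [chiK, LinearMap.trace_eq_matrix_trace ℂ (weightBasis l)]; rfl

theorem continuous_chiK (n : ℤ) (l : ℕ) : Continuous (chiK n l) := by
  simp only [funext (chiK_eq n l)]
  exact continuous_const.mul (continuous_piMat n l).matrix_trace

theorem piRep_upperBlock_mul (n : ℤ) (l : ℕ) (g : SU3) {k : SU3} (hk : k ∈ subK) :
    piRep n l (upperBlock (g * k)) = piRep n l (upperBlock g) * piRep n l (upperBlock k) := by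
  rw [upperBlock_mul_right g hk, piRep_mul]

theorem chiK_mul_comm (n : ℤ) (l : ℕ) (k k' : subK) : chiK n l (k * k') = chiK n l (k' * k) := by
  simp only [chiK, Subgroup.coe_mul]
  rw [piRep_upperBlock_mul n l _ k'.2, piRep_upperBlock_mul n l _ k.2, LinearMap.trace_mul_comm]

theorem piRep_diagSU (n : ℤ) (l : ℕ) (z w : Circle) (i : Fin (l + 1)) :
    piRep n l (upperBlock (diagSU z w)) (weightVec l i)
      = (((z : ℂ) * w) ^ n * ((z : ℂ) ^ (l - (i : ℕ)) * (w : ℂ) ^ (i : ℕ))) • weightVec l i := by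
  have : upperBlock (diagSU z w) = Matrix.diagonal ![(z : ℂ), w] := by
    ext i j
    fin_cases i <;> fin_cases j <;> simp [upperBlock_apply, diagSU]
  rw [this, piRep, LinearMap.smul_apply, symPowMap_diagonal_weightVec, smul_smul]
  simp [Matrix.det_diagonal]

/-! ### Haar measure of `K` -/

instance instIsHaarMeasureHaarK : haarK.IsHaarMeasure := by unfold haarK; infer_instance

instance instIsProbabilityMeasureHaarK : IsProbabilityMeasure haarK := by
  refine ⟨?_⟩
  have := Measure.haarMeasure_self (K₀ := (⊤ : TopologicalSpace.PositiveCompacts subK))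
  simpa [haarK] using this

section CompactGroup

variable {G : Type*} [Group G] [TopologicalSpace G] [IsTopologicalGroup G] [CompactSpace G]
  [MeasurableSpace G] [BorelSpace G] (μ : Measure G) [μ.IsHaarMeasure] [IsProbabilityMeasure μ]

/-- A right translate of `μ` is again a Haar probability measure, and there is only one. -/
theorem isMulRightInvariant_of_compactSpace : μ.IsMulRightInvariant := by
  refine ⟨fun g => ?_⟩
  have : IsProbabilityMeasure (Measure.map (· * g) μ) :=
    Measure.isProbabilityMeasure_map (measurable_mul_const g).aemeasurable
  exact Measure.isHaarMeasure_eq_of_isProbabilityMeasure _ _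

theorem isInvInvariant_of_compactSpace : μ.IsInvInvariant := by
  have := isMulRightInvariant_of_compactSpace μ
  refine ⟨?_⟩
  have h1 : IsProbabilityMeasure μ.inv :=
    Measure.isProbabilityMeasure_map measurable_inv.aemeasurable
  have h2 : μ.inv.IsHaarMeasure :=
    { lt_top_of_isCompact := fun K _ => measure_lt_top _ _
      open_pos := fun U hU hne => by
        rw [Measure.inv_apply]
        exact (hU.inv.measure_pos μ hne.inv).ne' }
  exact Measure.isHaarMeasure_eq_of_isProbabilityMeasure _ _

theorem measurePreserving_of_continuousMulEquiv (e : G ≃ₜ* G) : MeasurePreserving e μ μ := by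
  refine ⟨e.continuous.measurable, ?_⟩
  have h1 : (Measure.map e μ).IsHaarMeasure :=
    e.toMulEquiv.isHaarMeasure_map μ e.continuous e.symm.continuous
  have h2 : IsProbabilityMeasure (Measure.map e μ) :=
    Measure.isProbabilityMeasure_map e.continuous.measurable.aemeasurable
  exact Measure.isHaarMeasure_eq_of_isProbabilityMeasure _ _

end CompactGroup

instance instIsMulRightInvariantHaarK : haarK.IsMulRightInvariant :=
  isMulRightInvariant_of_compactSpace haarK

instance instIsInvInvariantHaarK : haarK.IsInvInvariant :=
  isInvInvariant_of_compactSpace haarK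

/-! ### Transposition on `SU(3)` -/

/-- The transpose of an element of `SU(3)`. -/
def transposeSU (g : SU3) : SU3 :=
  ⟨g.1ᵀ, by
    have h := Matrix.mem_specialUnitaryGroup_iff.mp g.2
    rw [Matrix.mem_specialUnitaryGroup_iff, Matrix.det_transpose]
    refine ⟨?_, h.2⟩
    have h1 := Matrix.mem_unitaryGroup_iff'.mp h.1
    rw [Matrix.mem_unitaryGroup_iff, Matrix.star_eq_conjTranspose, ← Matrix.transpose_one, ← h1,
      Matrix.transpose_mul]
    rfl⟩

theorem transposeSU_mul (g h : SU3) : transposeSU (g * h) = transposeSU h * transposeSU g :=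
  Subtype.ext (Matrix.transpose_mul _ _)

@[simp] theorem transposeSU_one : transposeSU 1 = 1 := Subtype.ext Matrix.transpose_one

@[simp] theorem transposeSU_transposeSU (g : SU3) : transposeSU (transposeSU g) = g := rfl

theorem transposeSU_inv (g : SU3) : transposeSU g⁻¹ = (transposeSU g)⁻¹ := by
  rw [eq_inv_iff_mul_eq_one, ← transposeSU_mul, mul_inv_cancel, transposeSU_one]

theorem transposeSU_mem {k : SU3} (hk : k ∈ subK) : transposeSU k ∈ subK :=
  ⟨hk.2.2.1, hk.2.2.2, hk.1, hk.2.1⟩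

theorem continuous_transposeSU : Continuous transposeSU :=
  (continuous_subtype_val.matrix_transpose).subtype_mk _

/-- A point of the unit circle off the spectrum, at which a Cayley transform can be based. -/
theorem exists_circle_det_ne_zero (g : Matrix (Fin 3) (Fin 3) ℂ) :
    ∃ z : ℂ, star z * z = 1 ∧ (z • (1 : Matrix (Fin 3) (Fin 3) ℂ) - g).det ≠ 0 := by
  have hinf : (Set.range fun θ : Set.Ioc (-Real.pi) Real.pi =>
      Complex.exp (θ.1 * Complex.I)).Infinite := by
    have : Infinite (Set.Ioc (-Real.pi) Real.pi) :=
      (Set.Ioc_infinite (by linarith [Real.pi_pos])).to_subtype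
    refine Set.infinite_range_of_injective fun a b h => Subtype.ext ?_
    have := congrArg Complex.arg h
    rwa [Complex.arg_exp_mul_I, Complex.arg_exp_mul_I,
      (toIocMod_eq_self _).mpr ⟨a.2.1, by linarith [a.2.2]⟩,
      (toIocMod_eq_self _).mpr ⟨b.2.1, by linarith [b.2.2]⟩] at this
  obtain ⟨z, ⟨θ, hθ⟩, hz⟩ := hinf.exists_notMem_finset g.charpoly.roots.toFinset
  refine ⟨z, ?_, fun h => hz ?_⟩
  · rw [← hθ]
    simp only [Complex.star_def, ← Complex.exp_conj, ← Complex.exp_add]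
    simp
  · rw [Multiset.mem_toFinset, Polynomial.mem_roots (Matrix.charpoly_monic g).ne_zero,
      Polynomial.IsRoot, Matrix.eval_charpoly, ← h, Matrix.smul_one_eq_diagonal]
    rfl

/-- Unitary matrices are unitarily diagonalizable. -/
theorem exists_unitary_diagonalization {g : Matrix (Fin 3) (Fin 3) ℂ} (hg : gᴴ * g = 1) :
    ∃ (U : Matrix (Fin 3) (Fin 3) ℂ) (d : Fin 3 → ℂ), Uᴴ * U = 1 ∧
      g = U * Matrix.diagonal d * Uᴴ := by
  obtain ⟨z, hz, hdet⟩ := exists_circle_det_ne_zero g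
  have hz' : z * star z = 1 := by rw [mul_comm]; exact hz
  set B := z • (1 : Matrix (Fin 3) (Fin 3) ℂ) - g with hB
  have hu : IsUnit B.det := isUnit_iff_ne_zero.mpr hdet
  set S := Complex.I • (star z • g - z • gᴴ) with hS
  have hSH : S.IsHermitian := by
    rw [Matrix.IsHermitian, hS]
    simp [Matrix.conjTranspose_smul, ← smul_neg]
  have hBS : Bᴴ * (Complex.I • (z • 1 + g)) = S := by
    rw [hB, hS, Matrix.conjTranspose_sub, Matrix.conjTranspose_smul, Matrix.conjTranspose_one]
    simp only [Matrix.sub_mul, Matrix.mul_smul, Matrix.mul_add, Matrix.smul_mul, Matrix.one_mul,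
      Matrix.mul_one, hg]
    simp only [smul_add, smul_sub, smul_smul, hz', mul_one]
    abel
  -- This is the Cayley transform `i (z + g)(z - g)⁻¹`, written so that it is visibly Hermitian.
  set H := (B⁻¹)ᴴ * S * B⁻¹ with hH
  have hHH : H.IsHermitian := Matrix.isHermitian_conjTranspose_mul_mul _ hSH
  have hHB : H * B = Complex.I • (z • 1 + g) := by
    rw [hH, Matrix.mul_assoc, Matrix.nonsing_inv_mul _ hu, Matrix.mul_one, ← hBS,
      ← Matrix.mul_assoc, ← Matrix.conjTranspose_mul, Matrix.mul_nonsing_inv _ hu,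
      Matrix.conjTranspose_one, Matrix.one_mul]
  set U : Matrix (Fin 3) (Fin 3) ℂ := hHH.eigenvectorUnitary.1 with hU
  have hUU : Uᴴ * U = 1 := Matrix.mem_unitaryGroup_iff'.mp hHH.eigenvectorUnitary.2
  have hUU' : U * Uᴴ = 1 := mul_eq_one_comm.mp hUU
  set e : Fin 3 → ℂ := fun i => (hHH.eigenvalues i : ℂ) with he
  have hsp : H = U * Matrix.diagonal e * Uᴴ := hHH.spectral_theorem
  set G := Uᴴ * g * U with hG
  have hgG : g = U * G * Uᴴ := by
    rw [hG]
    simp only [← Matrix.mul_assoc, hUU', Matrix.one_mul]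
    rw [Matrix.mul_assoc, hUU', Matrix.mul_one]
  have hrel : Matrix.diagonal e * (z • 1 - G) = Complex.I • (z • 1 + G) := by
    have h1 : Uᴴ * (H * B) * U = Uᴴ * (Complex.I • (z • 1 + g)) * U := by rw [hHB]
    have h2 : Uᴴ * (H * B) * U = Matrix.diagonal e * (z • 1 - G) := by
      rw [hsp, hB, hG]
      simp only [Matrix.mul_sub, Matrix.sub_mul, Matrix.mul_smul, Matrix.smul_mul, Matrix.mul_one,
        Matrix.mul_assoc, hUU]
      simp only [← Matrix.mul_assoc, hUU, Matrix.one_mul]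
    rw [← h2, h1, hG]
    simp only [Matrix.mul_smul, Matrix.smul_mul, Matrix.mul_add, Matrix.add_mul, Matrix.mul_one,
      hUU, Matrix.mul_assoc]
  refine ⟨U, fun i => G i i, hUU, ?_⟩
  have hdiag : G = Matrix.diagonal fun i => G i i := by
    ext i j
    by_cases hij : i = j
    · subst hij; simp
    · rw [Matrix.diagonal_apply_ne _ hij]
      have := congrFun (congrFun hrel i) j
      simp only [Matrix.diagonal_mul, Matrix.sub_apply, Matrix.smul_apply, Matrix.add_apply,
        Matrix.one_apply_ne hij, smul_eq_mul, mul_zero, zero_sub, zero_add] at this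
      -- The eigenvalue `e i` is real, so the first factor cannot vanish.
      have h0 : (e i + Complex.I) * G i j = 0 := by linear_combination -this
      refine (mul_eq_zero.mp h0).resolve_left fun h => ?_
      have := congrArg Complex.im h
      simp [he] at this
  rw [← hdiag]
  exact hgG

theorem exists_phase (w : ℂ) : ∃ p : ℂ, star p * p = 1 ∧ star (w * p) = w * p := by
  by_cases h : w = 0
  · exact ⟨1, by simp, by simp [h]⟩
  · have hn : (‖w‖ : ℂ) ≠ 0 := by exact_mod_cast norm_ne_zero_iff.mpr h
    have h2 : w * star w = (‖w‖ : ℂ) ^ 2 := by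
      simp [Complex.mul_conj, Complex.normSq_eq_norm_sq]
    refine ⟨star w / ‖w‖, ?_, ?_⟩
    · rw [star_div₀, star_star]
      simp only [Complex.star_def, Complex.conj_ofReal] at h2 ⊢
      field_simp
      exact h2
    · rw [← mul_div_assoc, h2, star_div₀]
      simp

/-- Each `g ∈ SU(3)` is conjugate to its transpose by an element of `K`. -/
theorem exists_conj_eq_transposeSU (g : SU3) : ∃ k ∈ subK, transposeSU g = k * g * k⁻¹ := by
  have hgu : g.1ᴴ * g.1 = 1 := Matrix.mem_unitaryGroup_iff'.mp
    (Matrix.mem_specialUnitaryGroup_iff.mp g.2).1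
  obtain ⟨U, d, hU, hg⟩ := exists_unitary_diagonalization hgu
  -- The columns of `U` are rescaled by phases that make the last row of `Q` real.
  choose p hp hpw using fun j => exists_phase (U 2 j)
  set Q := U * Matrix.diagonal p with hQdef
  have hpp : Matrix.diagonal p * (Matrix.diagonal p)ᴴ = 1 := by
    rw [Matrix.diagonal_conjTranspose, Matrix.diagonal_mul_diagonal, ← Matrix.diagonal_one]
    congr 1; funext j; rw [mul_comm]; exact hp j
  have hpp' : (Matrix.diagonal p)ᴴ * Matrix.diagonal p = 1 := mul_eq_one_comm.mp hpp
  have hQ : Qᴴ * Q = 1 := by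
    rw [hQdef, Matrix.conjTranspose_mul, Matrix.mul_assoc, ← Matrix.mul_assoc Uᴴ, hU,
      Matrix.one_mul, hpp']
  have hQ' : Q * Qᴴ = 1 := mul_eq_one_comm.mp hQ
  have hgQ : g.1 = Q * Matrix.diagonal d * Qᴴ := by
    have : Matrix.diagonal p * Matrix.diagonal d * (Matrix.diagonal p)ᴴ = Matrix.diagonal d := by
      rw [(Matrix.commute_diagonal p d).eq, Matrix.mul_assoc, hpp, Matrix.mul_one]
    rw [hg, hQdef, Matrix.conjTranspose_mul]
    conv_lhs => rw [← this]
    simp only [Matrix.mul_assoc]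
  have hreal : ∀ j, star (Q 2 j) = Q 2 j := by
    intro j
    rw [hQdef, Matrix.mul_diagonal]; exact hpw j
  set W := Q * Qᵀ with hW
  have hQt : Qᵀ * Qᵀᴴ = 1 := by
    have := congrArg Matrix.transpose hQ
    rwa [Matrix.transpose_mul, Matrix.transpose_one] at this
  have hQt' : Qᵀᴴ * Qᵀ = 1 := mul_eq_one_comm.mp hQt
  have hWW : W * Wᴴ = 1 := by
    rw [hW, Matrix.conjTranspose_mul, Matrix.mul_assoc, ← Matrix.mul_assoc Qᵀ, hQt,
      Matrix.one_mul, hQ']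
  -- As the last row of `Q` is real, the last columns of `Q Qᵀ` and `Q Qᴴ = 1` coincide.
  have hcol : ∀ i, W i 2 = (1 : Matrix (Fin 3) (Fin 3) ℂ) i 2 := by
    intro i
    rw [← hQ', hW]
    simp only [Matrix.mul_apply, Matrix.transpose_apply, Matrix.conjTranspose_apply, hreal]
  have hsymm : ∀ i j, W i j = W j i := by
    intro i j
    have : Wᵀ = W := by rw [hW, Matrix.transpose_mul, Matrix.transpose_transpose]
    rw [← Matrix.transpose_apply W, this]
  have hdetW : W.det * star W.det = 1 := by
    rw [← Matrix.det_conjTranspose, ← Matrix.det_mul, hWW, Matrix.det_one]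
  -- `Wᴴ` already conjugates `g` into its transpose; a cube root of `det W` brings the determinant
  -- to one.
  obtain ⟨c, hc⟩ := IsAlgClosed.exists_pow_nat_eq W.det (n := 3) (by norm_num)
  have hcc : c * star c = 1 := by
    have h1 : ‖c‖ = 1 := by
      have : ‖c‖ ^ 3 = 1 := by
        rw [← norm_pow, hc]
        have h2 : ‖W.det‖ * ‖W.det‖ = 1 := by
          have := congrArg norm hdetW
          simpa using this
        nlinarith [norm_nonneg W.det]
      exact (pow_eq_one_iff_of_nonneg (norm_nonneg c) (by norm_num)).mp this
    simp [Complex.mul_conj, Complex.normSq_eq_norm_sq, h1]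
  have hk : c • Wᴴ ∈ Matrix.specialUnitaryGroup (Fin 3) ℂ := by
    rw [Matrix.mem_specialUnitaryGroup_iff, Matrix.mem_unitaryGroup_iff,
      Matrix.star_eq_conjTranspose, Matrix.conjTranspose_smul, Matrix.conjTranspose_conjTranspose,
      Matrix.smul_mul, Matrix.mul_smul, smul_smul, hcc, one_smul, mul_eq_one_comm.mp hWW,
      Matrix.det_smul, Matrix.det_conjTranspose, Fintype.card_fin, hc]
    exact ⟨rfl, hdetW⟩
  refine ⟨⟨c • Wᴴ, hk⟩, ?_, ?_⟩
  · refine ⟨?_, ?_, ?_, ?_⟩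
    · simp [hsymm 2 0, hcol]
    · simp [hsymm 2 1, hcol]
    · simp [hcol]
    · simp [hcol]
  · rw [eq_mul_inv_iff_mul_eq]
    apply Subtype.ext
    change g.1ᵀ * (c • Wᴴ) = (c • Wᴴ) * g.1
    rw [Matrix.mul_smul, Matrix.smul_mul]
    congr 1
    clear_value Q
    rw [hgQ, hW, Matrix.transpose_mul, Matrix.transpose_mul, Matrix.diagonal_transpose,
      Matrix.conjTranspose_mul]
    have e1 : (Qᴴ)ᵀ = Qᵀᴴ := rfl
    rw [e1]
    simp only [Matrix.mul_assoc]
    rw [← Matrix.mul_assoc Qᵀ, hQt, Matrix.one_mul, ← Matrix.mul_assoc Qᴴ Q, hQ, Matrix.one_mul]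

/-! ### Irreducibility of `π` on `K` -/

theorem eq_sum_weightVec (l : ℕ) (x : SymPow l) :
    x = ∑ i, MvPolynomial.coeff (weightExp l i) x.1 • weightVec l i :=
  ((weightEquiv l).symm_apply_apply x).symm

theorem weightVec_ne_zero (l : ℕ) (i : Fin (l + 1)) : weightVec l i ≠ 0 := by
  rw [← weightBasis_apply]; exact (weightBasis l).ne_zero i

/-- The torus element `diag(ζ, 1, ζ⁻¹)`, with `ζ` a primitive root of unity of order `l + 1`,
already separates the weights; a Lagrange polynomial in its image projects onto a single weight
line. -/
theorem weightVec_mem_of_torus (n : ℤ) (l : ℕ) {N : Submodule ℂ (SymPow l)}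
    (hN : ∀ k ∈ subK, ∀ v ∈ N, piRep n l (upperBlock k) v ∈ N) {x : SymPow l} (hx : x ∈ N)
    {j : Fin (l + 1)} (hj : MvPolynomial.coeff (weightExp l j) x.1 ≠ 0) : weightVec l j ∈ N := by
  have hζ := Complex.isPrimitiveRoot_exp (l + 1) l.succ_ne_zero
  set ζ := Complex.exp (2 * Real.pi * Complex.I / ((l + 1 : ℕ) : ℂ)) with hζdef
  have hn : ‖ζ‖ = 1 := hζ.norm'_eq_one l.succ_ne_zero
  have h0 : ζ ≠ 0 := hζ.ne_zero l.succ_ne_zero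
  let z : Circle := ⟨ζ, mem_sphere_zero_iff_norm.mpr hn⟩
  set τ := piRep n l (upperBlock (diagSU z 1)) with hτ
  set ev : Fin (l + 1) → ℂ := fun i => ζ ^ n * ζ ^ (l - (i : ℕ)) with hev
  have hτv : ∀ i, τ (weightVec l i) = ev i • weightVec l i := by
    intro i
    rw [hτ, piRep_diagSU]
    simp [hev, z]
  have hinj : Function.Injective ev := by
    intro a b h
    have h1 := mul_left_cancel₀ (zpow_ne_zero n h0) h
    have h2 := hζ.pow_inj (by omega) (by omega) h1
    have := a.2
    have := b.2
    exact Fin.ext (by omega)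
  have hpoly : ∀ p : Polynomial ℂ, ∀ v ∈ N, Polynomial.aeval τ p v ∈ N := by
    intro p
    induction p using Polynomial.induction_on' with
    | add p q hp hq => intro v hv; simpa using N.add_mem (hp v hv) (hq v hv)
    | monomial m a =>
      intro v hv
      rw [Polynomial.aeval_monomial, Module.End.mul_apply, Module.algebraMap_end_apply]
      refine N.smul_mem _ ?_
      induction m with
      | zero => simpa using hv
      | succ m ih =>
        rw [pow_succ', Module.End.mul_apply]
        exact hN _ (diagSU_mem _ _) _ ih
  have hmem := hpoly (Lagrange.basis Finset.univ ev j) x hx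
  have hval : Polynomial.aeval τ (Lagrange.basis Finset.univ ev j) x
      = MvPolynomial.coeff (weightExp l j) x.1 • weightVec l j := by
    conv_lhs => rw [eq_sum_weightVec l x]
    rw [map_sum, Finset.sum_eq_single j]
    · rw [map_smul, Module.End.aeval_apply_of_hasEigenvector
        (Module.End.hasEigenvector_iff.mpr ⟨Module.End.mem_eigenspace_iff.mpr (hτv j),
          weightVec_ne_zero l j⟩),
        Lagrange.eval_basis_self hinj.injOn (Finset.mem_univ j), one_smul]
    · intro i _ hij
      rw [map_smul, Module.End.aeval_apply_of_hasEigenvector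
        (Module.End.hasEigenvector_iff.mpr ⟨Module.End.mem_eigenspace_iff.mpr (hτv i),
          weightVec_ne_zero l i⟩),
        Lagrange.eval_basis_of_ne (Ne.symm hij) (Finset.mem_univ i), zero_smul, smul_zero]
    · simp
  rw [hval] at hmem
  exact (N.smul_mem_iff hj).mp hmem

theorem upperBlock_rotK (θ : ℝ) :
    upperBlock (rotK θ) = !![(Real.cos θ : ℂ), -(Real.sin θ : ℂ); (Real.sin θ : ℂ), (Real.cos θ : ℂ)] := by
  ext i j
  fin_cases i <;> fin_cases j <;> simp [upperBlock_apply, rotK]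

theorem coeff_weightExp_zero (l : ℕ) (x : SymPow l) :
    MvPolynomial.coeff (weightExp l 0) x.1 = MvPolynomial.eval ![1, 0] x.1 := by
  conv_rhs => rw [eq_sum_weightVec l x]
  rw [Submodule.coe_sum, map_sum, Finset.sum_eq_single 0]
  · simp [weightVec, MvPolynomial.smul_eq_C_mul]
  · intro i _ hi
    have : (i : ℕ) ≠ 0 := fun h => hi (Fin.ext h)
    simp [weightVec, MvPolynomial.smul_eq_C_mul, this]
  · simp

/-- A nonzero invariant subspace contains some weight vector. Rotation by `π/4` has no zero entry in
its `2 × 2` block, so it maps each `v_j` to a vector with nonzero `e₁^l` coefficient, and it maps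
`e₁^l` to a binomial expansion in which every weight occurs. -/
theorem piRep_irreducible (n : ℤ) (l : ℕ) {N : Submodule ℂ (SymPow l)}
    (hN : ∀ k ∈ subK, ∀ v ∈ N, piRep n l (upperBlock k) v ∈ N) : N = ⊥ ∨ N = ⊤ := by
  refine or_iff_not_imp_left.mpr fun hbot => ?_
  obtain ⟨x, hx, hx0⟩ := N.ne_bot_iff.mp hbot
  have hex : ∃ j, MvPolynomial.coeff (weightExp l j) x.1 ≠ 0 := by
    by_contra! h
    exact hx0 (by rw [eq_sum_weightVec l x]; simp [h])
  obtain ⟨j, hj⟩ := hex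
  have hvj := weightVec_mem_of_torus n l hN hx hj
  have hc : (Real.cos (Real.pi / 4) : ℂ) ≠ 0 := by
    rw [Real.cos_pi_div_four]; norm_num
  have hs : (Real.sin (Real.pi / 4) : ℂ) ≠ 0 := by
    rw [Real.sin_pi_div_four]; norm_num
  have hrot : ∀ v ∈ N, symPowMap l (upperBlock (rotK (Real.pi / 4))) v ∈ N := by
    intro v hv
    have := hN _ (rotK_mem (Real.pi / 4)) v hv
    rw [piRep, LinearMap.smul_apply] at this
    exact (N.smul_mem_iff (zpow_ne_zero n (det_upperBlock_ne_zero (rotK_mem _)))).mp this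
  have hA := upperBlock_rotK (Real.pi / 4)
  generalize (Real.cos (Real.pi / 4) : ℂ) = c at hA hc
  generalize (Real.sin (Real.pi / 4) : ℂ) = s at hA hs
  generalize upperBlock (rotK (Real.pi / 4)) = A at hA hrot
  have hv0 : weightVec l 0 ∈ N := by
    refine weightVec_mem_of_torus n l hN (hrot _ hvj) ?_
    rw [coeff_weightExp_zero, symPowMap_coe, hA]
    simp only [weightVec, map_mul, map_pow, MvPolynomial.aeval_X, Fin.sum_univ_two]
    simp [hc, hs]
  have hvi : ∀ i, weightVec l i ∈ N := by
    intro i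
    refine weightVec_mem_of_torus n l hN (hrot _ hv0) ?_
    have hcoe : (symPowMap l A (weightVec l 0)).1
        = ∑ m ∈ Finset.range (l + 1), MvPolynomial.monomial
          (Finsupp.single 0 m + Finsupp.single 1 (l - m)) (c ^ m * s ^ (l - m) * (l.choose m)) := by
      rw [symPowMap_coe, hA]
      simp only [weightVec, map_mul, map_pow, MvPolynomial.aeval_X, Fin.sum_univ_two]
      simp only [Fin.val_zero, pow_zero, mul_one, Nat.sub_zero]
      rw [add_pow]
      refine Finset.sum_congr rfl fun m _ => ?_
      rw [MvPolynomial.monomial_eq]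
      simp [Finsupp.prod_fintype, Fin.prod_univ_two, mul_pow]
      ring
    rw [hcoe, MvPolynomial.coeff_sum, Finset.sum_eq_single (l - (i : ℕ))]
    · have h1 : l - (l - (i : ℕ)) = i := by have := i.2; omega
      rw [h1, MvPolynomial.coeff_monomial, weightExp, if_pos rfl]
      refine mul_ne_zero (mul_ne_zero (pow_ne_zero _ hc) (pow_ne_zero _ hs)) ?_
      exact_mod_cast (Nat.choose_pos (Nat.sub_le _ _)).ne'
    · intro m _ hm
      rw [MvPolynomial.coeff_monomial, if_neg]
      intro h
      have := DFunLike.congr_fun h 0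
      rw [weightExp_zero] at this
      simp at this
      exact hm this
    · intro h
      exact absurd (Finset.mem_range.mpr (by omega)) h
  rw [eq_top_iff, ← (weightBasis l).span_eq, Submodule.span_le]
  rintro _ ⟨i, rfl⟩
  rw [weightBasis_apply]
  exact hvi i

/-! ### Burnside's theorem -/

/-- Burnside's theorem: an irreducible set of operators generates the full matrix algebra. -/
theorem adjoin_eq_top_of_irreducible {V : Type*} [AddCommGroup V] [Module ℂ V]
    [FiniteDimensional ℂ V] [Nontrivial V] {S : Set (Module.End ℂ V)}
    (h : ∀ W : Submodule ℂ V, (∀ a ∈ S, ∀ v ∈ W, a v ∈ W) → W = ⊥ ∨ W = ⊤) :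
    Algebra.adjoin ℂ S = ⊤ := by
  set A := Algebra.adjoin ℂ S with hA
  have hsimple : IsSimpleModule A V := by
    refine { exists_pair_ne := ⟨⊥, ⊤, bot_ne_top⟩, eq_bot_or_eq_top := fun W => ?_ }
    have := h (W.restrictScalars ℂ) (fun a ha v hv => by
      exact W.smul_mem (⟨a, Algebra.subset_adjoin ha⟩ : A) hv)
    simpa using this
  rw [eq_top_iff]
  rintro a -
  -- By Schur's lemma over `ℂ` the commutant of `A` consists of scalars, so any linear `a` is linear
  -- over it; Jacobson density then matches `a` with an element of `A` on a finite spanning set.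
  let f : Module.End (Module.End A V) V :=
    { toFun := a
      map_add' := a.map_add
      map_smul' := fun e v => by
        obtain ⟨c, rfl⟩ := (IsSimpleModule.algebraMap_end_bijective_of_isAlgClosed (A := A)
          (V := V) ℂ).2 e
        simp }
  obtain ⟨s, hs⟩ := Module.Finite.fg_top (R := ℂ) (M := V)
  obtain ⟨r, hr⟩ := jacobson_density (R := A) f s
  have : a = r.1 := LinearMap.ext_on hs fun v hv => hr v hv
  rw [this]
  exact r.2

/-- Rank one operators suffice as test operators: the trace against `y ↦ f(y) x` is `f` of the value
at `x`. -/
theorem Module.End.eq_of_trace_mul_eq {V : Type*} [AddCommGroup V] [Module ℂ V]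
    [FiniteDimensional ℂ V] {a b : Module.End ℂ V}
    (h : ∀ c : Module.End ℂ V, LinearMap.trace ℂ V (a * c) = LinearMap.trace ℂ V (b * c)) :
    a = b := by
  refine LinearMap.ext fun x => ?_
  rw [← sub_eq_zero]
  rw [← Module.forall_dual_apply_eq_zero_iff ℂ]
  intro f
  have e : ∀ a : Module.End ℂ V, a * f.smulRight x = f.smulRight (a x) := fun a =>
    LinearMap.ext fun y => by simp
  have := h (f.smulRight x)
  rw [e, e, LinearMap.trace_smulRight, LinearMap.trace_smulRight] at this
  simp [this]

/-! ### Basic properties of spherical functions -/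

theorem integrable_of_continuous {E : Type*} [NormedAddCommGroup E] {f : subK → E}
    (hf : Continuous f) : Integrable f haarK :=
  hf.integrable_of_hasCompactSupport (HasCompactSupport.of_compactSpace f)

section

variable {n : ℤ} {l : ℕ} {V : Type*} [NormedAddCommGroup V] [NormedSpace ℂ V]
  {Φ : SU3 → (V →L[ℂ] V)}

namespace IsSphericalFunction

theorem continuous_integrand (hΦ : IsSphericalFunction n l Φ) (x y : SU3) :
    Continuous fun k : subK => chiK n l k⁻¹ • Φ (x * k.1 * y) :=
  ((continuous_chiK n l).comp continuous_inv).smul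
    (hΦ.continuous.comp ((continuous_const.mul continuous_subtype_val).mul continuous_const))

/-- The functional equation computes both `Φ(x)Φ(k)` and `Φ(xk)Φ(1)`. After a translation of the
variable the two integrals of `Φ(xk')` differ only in the weights `χ(kk'⁻¹)` and `χ(k'⁻¹k)`, which
agree because `χ` is central. -/
theorem map_mul_right (hΦ : IsSphericalFunction n l Φ) (x : SU3) {k : SU3} (hk : k ∈ subK) :
    Φ (x * k) = Φ x * Φ k := by
  set k₀ : subK := ⟨k, hk⟩
  have h1 : Φ x * Φ k = ∫ k' : subK, chiK n l (k₀ * k'⁻¹) • Φ (x * k'.1) ∂haarK := by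
    rw [hΦ.mul_eq]
    refine Eq.trans (integral_congr_ae (Filter.Eventually.of_forall fun k' => ?_))
      (integral_mul_right_eq_self (fun k' : subK => chiK n l (k₀ * k'⁻¹) • Φ (x * k'.1)) k₀)
    simp [k₀, mul_assoc]
  have h2 : Φ (x * k) = ∫ k' : subK, chiK n l (k'⁻¹ * k₀) • Φ (x * k'.1) ∂haarK := by
    rw [← mul_one (Φ (x * k)), ← hΦ.map_one, hΦ.mul_eq]
    refine Eq.trans (integral_congr_ae (Filter.Eventually.of_forall fun k' => ?_))
      (integral_mul_left_eq_self (fun k' : subK => chiK n l (k'⁻¹ * k₀) • Φ (x * k'.1)) k₀)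
    simp [k₀, mul_assoc]
  rw [h1, h2]
  simp only [chiK_mul_comm]

theorem map_mul_left (hΦ : IsSphericalFunction n l Φ) {k : SU3} (hk : k ∈ subK) (y : SU3) :
    Φ (k * y) = Φ k * Φ y := by
  set k₀ : subK := ⟨k, hk⟩
  have h1 : Φ k * Φ y = ∫ k' : subK, chiK n l (k'⁻¹ * k₀) • Φ (k'.1 * y) ∂haarK := by
    rw [hΦ.mul_eq]
    refine Eq.trans (integral_congr_ae (Filter.Eventually.of_forall fun k' => ?_))
      (integral_mul_left_eq_self (fun k' : subK => chiK n l (k'⁻¹ * k₀) • Φ (k'.1 * y)) k₀)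
    simp [k₀, mul_assoc]
  have h2 : Φ (k * y) = ∫ k' : subK, chiK n l (k₀ * k'⁻¹) • Φ (k'.1 * y) ∂haarK := by
    rw [← one_mul (Φ (k * y)), ← hΦ.map_one, hΦ.mul_eq]
    refine Eq.trans (integral_congr_ae (Filter.Eventually.of_forall fun k' => ?_))
      (integral_mul_right_eq_self (fun k' : subK => chiK n l (k₀ * k'⁻¹) • Φ (k'.1 * y)) k₀)
    simp [k₀, mul_assoc]
  rw [h1, h2]
  simp only [chiK_mul_comm]

theorem map_inv_mul (hΦ : IsSphericalFunction n l Φ) {k : SU3} (hk : k ∈ subK) :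
    Φ k⁻¹ * Φ k = 1 := by
  rw [← hΦ.map_mul_right _ hk, inv_mul_cancel, hΦ.map_one]

theorem map_mul_inv (hΦ : IsSphericalFunction n l Φ) {k : SU3} (hk : k ∈ subK) :
    Φ k * Φ k⁻¹ = 1 := by
  rw [← hΦ.map_mul_left hk, mul_inv_cancel, hΦ.map_one]

variable [FiniteDimensional ℂ V]

theorem functional_mul_eq (hΦ : IsSphericalFunction n l Φ) (f : (V →L[ℂ] V) →ₗ[ℂ] ℂ) (x y : SU3) :
    f (Φ x * Φ y) = ∫ k : subK, chiK n l k⁻¹ * f (Φ (x * k.1 * y)) ∂haarK := by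
  have := (LinearMap.toContinuousLinearMap f).integral_comp_comm
    (integrable_of_continuous (hΦ.continuous_integrand x y))
  rw [hΦ.mul_eq]
  simpa using this.symm

/-- The product is an integral of multiples of values of `Φ`, and a subspace of a finite dimensional
space is cut out by functionals, which pass under the integral. -/
theorem mul_mem_span (hΦ : IsSphericalFunction n l Φ) (x y : SU3) :
    Φ x * Φ y ∈ Submodule.span ℂ (Set.range Φ) := by
  by_contra h
  obtain ⟨f, hf, hf'⟩ := Submodule.exists_dual_map_eq_bot_of_notMem h inferInstance
  apply hf
  rw [hΦ.functional_mul_eq f]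
  have : ∀ g, f (Φ g) = 0 := fun g => by
    have : f (Φ g) ∈ (Submodule.span ℂ (Set.range Φ)).map f :=
      Submodule.mem_map_of_mem (Submodule.subset_span ⟨g, rfl⟩)
    rwa [hf', Submodule.mem_bot] at this
  simp [this]

/-- The span contains `1` and is closed under products, so it is the algebra generated by the
values, which is everything by Burnside's theorem. -/
theorem span_range_eq_top (hΦ : IsSphericalFunction n l Φ) (hirr : IsIrreducibleFamily Φ) :
    Submodule.span ℂ (Set.range Φ) = ⊤ := by
  have := hirr.1
  let e : (V →L[ℂ] V) ≃ₐ[ℂ] Module.End ℂ V := (Module.End.toContinuousLinearMap V).symm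
  have h1 : Algebra.adjoin ℂ (e '' Set.range Φ) = ⊤ := by
    refine adjoin_eq_top_of_irreducible fun W hW => hirr.2 W fun g v hv => ?_
    exact hW (e (Φ g)) ⟨_, ⟨g, rfl⟩, rfl⟩ v hv
  have h2 : Algebra.adjoin ℂ (Set.range Φ) = ⊤ := by
    rw [← AlgEquiv.coe_toAlgHom, ← AlgHom.map_adjoin] at h1
    rw [eq_top_iff]
    rintro a -
    have h3 : e a ∈ (Algebra.adjoin ℂ (Set.range Φ)).map e.toAlgHom := by rw [h1]; trivial
    obtain ⟨b, hb, hab⟩ := Subalgebra.mem_map.mp h3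
    rwa [← e.injective hab]
  rw [← Algebra.top_toSubmodule, ← h2, Algebra.adjoin_eq_span_of_subset]
  intro a ha
  induction ha using Submonoid.closure_induction with
  | mem x hx => exact Submodule.subset_span hx
  | one => exact Submodule.subset_span ⟨1, hΦ.map_one⟩
  | mul a b _ _ ha hb =>
    have h4 := Submodule.mul_mem_mul ha hb
    rw [Submodule.span_mul_span] at h4
    refine Submodule.span_le.mpr ?_ h4
    rintro _ ⟨_, ⟨x, rfl⟩, _, ⟨y, rfl⟩, rfl⟩
    exact hΦ.mul_mem_span x y

/-- The trace of a continuous endomorphism. -/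
noncomputable def trE (V : Type*) [NormedAddCommGroup V] [NormedSpace ℂ V] :
    (V →L[ℂ] V) →ₗ[ℂ] ℂ :=
  LinearMap.trace ℂ V ∘ₗ ContinuousLinearMap.coeLM ℂ

theorem trE_mul_comm (a b : V →L[ℂ] V) : trE V (a * b) = trE V (b * a) :=
  LinearMap.trace_mul_comm ℂ (a : V →ₗ[ℂ] V) b

theorem eq_of_trE_mul_eq {a b : V →L[ℂ] V} (h : ∀ c, trE V (a * c) = trE V (b * c)) : a = b := by
  have : (a : V →ₗ[ℂ] V) = b := by
    refine Module.End.eq_of_trace_mul_eq fun c => ?_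
    have := h (LinearMap.toContinuousLinearMap c)
    exact this
  exact ContinuousLinearMap.coe_injective this

theorem trE_conj (hΦ : IsSphericalFunction n l Φ) {a : V →L[ℂ] V}
    (ha : ∀ k ∈ subK, a * Φ k = Φ k * a) {k : SU3} (hk : k ∈ subK) (g : SU3) :
    trE V (a * Φ (k * g * k⁻¹)) = trE V (a * Φ g) := by
  rw [hΦ.map_mul_right _ (subK.inv_mem hk), hΦ.map_mul_left hk, ← mul_assoc, ← mul_assoc,
    trE_mul_comm, ← mul_assoc, ha k hk, ← mul_assoc, hΦ.map_inv_mul hk, one_mul]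

/-- The element conjugating `g` into `gᵀ` lies in `K`, and `a` commutes with `Φ(K)`. -/
theorem trE_transpose (hΦ : IsSphericalFunction n l Φ) {a : V →L[ℂ] V}
    (ha : ∀ k ∈ subK, a * Φ k = Φ k * a) (g : SU3) :
    trE V (a * Φ (transposeSU g)) = trE V (a * Φ g) := by
  obtain ⟨k, hk, h⟩ := exists_conj_eq_transposeSU g
  rw [h, hΦ.trE_conj ha hk]

end IsSphericalFunction

/-! ### Gelfand's trick for the commutant of `K`. -/

/-- Transposition as a map of `K`. -/
def transposeK (k : subK) : subK := ⟨transposeSU k.1, transposeSU_mem k.2⟩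

theorem measurableEmbedding_transposeK : MeasurableEmbedding transposeK :=
  Homeomorph.measurableEmbedding
    { toFun := transposeK
      invFun := transposeK
      left_inv := fun _ => rfl
      right_inv := fun _ => rfl
      continuous_toFun := (continuous_transposeSU.comp continuous_subtype_val).subtype_mk _
      continuous_invFun := (continuous_transposeSU.comp continuous_subtype_val).subtype_mk _ }

theorem transposeK_inv (k : subK) : transposeK k⁻¹ = (transposeK k)⁻¹ :=
  Subtype.ext (transposeSU_inv k.1)

/-- Transposition is an anti-automorphism; composed with inversion, which preserves Haar measure, it
becomes an automorphism of `K`. -/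
theorem measurePreserving_transposeK : MeasurePreserving transposeK haarK haarK := by
  let e : subK ≃ₜ* subK :=
    { toFun := fun k => transposeK k⁻¹
      invFun := fun k => transposeK k⁻¹
      left_inv := fun k => Subtype.ext <| by
        simp [transposeK, transposeSU_inv]
      right_inv := fun k => Subtype.ext <| by
        simp [transposeK, transposeSU_inv]
      map_mul' := fun a b => Subtype.ext <| by
        simp [transposeK, transposeSU_inv, transposeSU_mul]
      continuous_toFun := (continuous_transposeSU.comp
        (continuous_subtype_val.comp continuous_inv)).subtype_mk _
      continuous_invFun := (continuous_transposeSU.comp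
        (continuous_subtype_val.comp continuous_inv)).subtype_mk _ }
  have h1 := measurePreserving_of_continuousMulEquiv haarK e
  have h2 := h1.comp (Measure.measurePreserving_inv haarK)
  convert h2 using 1
  funext k
  change _ = transposeK k⁻¹⁻¹
  rw [inv_inv]

/-- The transpose of `k` is conjugate to `k` inside `K`, and `χ` is a class function. -/
theorem chiK_transposeK (n : ℤ) (l : ℕ) (k : subK) : chiK n l (transposeK k) = chiK n l k := by
  obtain ⟨w, hw, h⟩ := exists_conj_eq_transposeSU k.1
  have : transposeK k = ⟨w, hw⟩ * k * ⟨w, hw⟩⁻¹ := Subtype.ext h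
  rw [this, chiK_mul_comm, inv_mul_cancel_left]

namespace IsSphericalFunction

variable [FiniteDimensional ℂ V]

theorem integral_transpose (hΦ : IsSphericalFunction n l Φ) (f : (V →L[ℂ] V) →ₗ[ℂ] ℂ)
    (x y : SU3) :
    ∫ k : subK, chiK n l k⁻¹ * f (Φ (x * transposeSU k.1 * y)) ∂haarK = f (Φ x * Φ y) := by
  rw [hΦ.functional_mul_eq, ← measurePreserving_transposeK.integral_comp
    measurableEmbedding_transposeK]
  refine integral_congr_ae (Filter.Eventually.of_forall fun k => ?_)
  simp only
  rw [← transposeK_inv, chiK_transposeK]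
  rfl

/-- Pairs `(∑ cᵢ Φ(gᵢ), ∑ cᵢ Φ(gᵢᵀ))`. -/
def transposePairs (Φ : SU3 → (V →L[ℂ] V)) : Submodule ℂ ((V →L[ℂ] V) × (V →L[ℂ] V)) :=
  Submodule.span ℂ (Set.range fun g => (Φ g, Φ (transposeSU g)))

/-- The pairs need not be known to form the graph of a map. Only totality is used, and it holds
because the values of `Φ` span. -/
theorem exists_transposePair (hΦ : IsSphericalFunction n l Φ) (hirr : IsIrreducibleFamily Φ)
    (a : V →L[ℂ] V) : ∃ a', (a, a') ∈ transposePairs Φ := by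
  have ha : a ∈ Submodule.span ℂ (Set.range Φ) := by rw [hΦ.span_range_eq_top hirr]; trivial
  induction ha using Submodule.span_induction with
  | mem x hx =>
    obtain ⟨g, rfl⟩ := hx
    exact ⟨_, Submodule.subset_span ⟨g, rfl⟩⟩
  | zero => exact ⟨0, Submodule.zero_mem _⟩
  | add x y _ _ hx hy =>
    obtain ⟨x', hx⟩ := hx
    obtain ⟨y', hy⟩ := hy
    exact ⟨_, Submodule.add_mem _ hx hy⟩
  | smul c x _ hx =>
    obtain ⟨x', hx⟩ := hx
    exact ⟨_, Submodule.smul_mem _ c hx⟩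

theorem trE_transpose_mul (hΦ : IsSphericalFunction n l Φ) (g h : SU3) :
    trE V (Φ (transposeSU g) * Φ (transposeSU h)) = trE V (Φ g * Φ h) := by
  have h1 : ∀ a : SU3, trE V (Φ (transposeSU a)) = trE V (Φ a) := fun a => by
    simpa using hΦ.trE_transpose (a := 1) (by simp) a
  rw [trE_mul_comm, ← hΦ.integral_transpose (trE V), hΦ.functional_mul_eq (trE V)]
  refine integral_congr_ae (Filter.Eventually.of_forall fun k => ?_)
  simp only
  rw [← h1 (g * k.1 * h), transposeSU_mul, transposeSU_mul, mul_assoc]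

/-- Transposition reverses products under the trace, since `(xky)ᵀ = yᵀkᵀxᵀ` and the weighted
integral over `K` is invariant under `k ↦ kᵀ`. -/
theorem trE_transpose_mul_mul (hΦ : IsSphericalFunction n l Φ) (x y h : SU3) :
    trE V (Φ (transposeSU y) * Φ (transposeSU x) * Φ (transposeSU h)) = trE V (Φ x * Φ y * Φ h) := by
  have e1 := hΦ.functional_mul_eq (trE V ∘ₗ LinearMap.mulRight ℂ (Φ h)) x y
  have e2 := hΦ.integral_transpose (trE V ∘ₗ LinearMap.mulRight ℂ (Φ (transposeSU h)))
    (transposeSU y) (transposeSU x)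
  simp only [LinearMap.comp_apply, LinearMap.mulRight_apply] at e1 e2
  rw [e1, ← e2]
  refine integral_congr_ae (Filter.Eventually.of_forall fun k => ?_)
  simp only
  rw [← hΦ.trE_transpose_mul (x * k.1 * y), transposeSU_mul, transposeSU_mul, mul_assoc]

theorem trE_pair (hΦ : IsSphericalFunction n l Φ) {a : (V →L[ℂ] V) × (V →L[ℂ] V)}
    (ha : a ∈ transposePairs Φ) (h : SU3) :
    trE V (a.2 * Φ (transposeSU h)) = trE V (a.1 * Φ h) := by
  induction ha using Submodule.span_induction with
  | mem x hx => obtain ⟨g, rfl⟩ := hx; exact hΦ.trE_transpose_mul g h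
  | zero => simp
  | add x y _ _ hx hy => simp [add_mul, hx, hy]
  | smul c x _ hx => simp [hx]

/-- Bilinear extension of `trE_transpose_mul_mul`: tested by traces, the transposition relation is
anti-multiplicative. -/
theorem trE_pair_mul (hΦ : IsSphericalFunction n l Φ) {a b : (V →L[ℂ] V) × (V →L[ℂ] V)}
    (ha : a ∈ transposePairs Φ) (hb : b ∈ transposePairs Φ) (h : SU3) :
    trE V (b.2 * a.2 * Φ (transposeSU h)) = trE V (a.1 * b.1 * Φ h) := by
  induction ha, hb using Submodule.span_induction₂ with
  | mem_mem x y hx hy =>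
    obtain ⟨g, rfl⟩ := hx
    obtain ⟨g', rfl⟩ := hy
    exact hΦ.trE_transpose_mul_mul g g' h
  | zero_left y hy => simp
  | zero_right x hx => simp
  | add_left x y z _ _ _ hx hy => simp [add_mul, mul_add, hx, hy]
  | add_right x y z _ _ _ hx hy => simp [add_mul, mul_add, hx, hy]
  | smul_left c x y _ _ hx => simp [hx]
  | smul_right c x y _ _ hx => simp [hx]

theorem eq_of_trE_mul_apply_eq (hΦ : IsSphericalFunction n l Φ) (hirr : IsIrreducibleFamily Φ)
    {a b : V →L[ℂ] V} (h : ∀ g, trE V (a * Φ g) = trE V (b * Φ g)) : a = b := by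
  refine eq_of_trE_mul_eq fun c => ?_
  have hc : c ∈ Submodule.span ℂ (Set.range Φ) := by rw [hΦ.span_range_eq_top hirr]; trivial
  induction hc using Submodule.span_induction with
  | mem x hx => obtain ⟨g, rfl⟩ := hx; exact h g
  | zero => simp
  | add x y _ _ hx hy => simp [mul_add, hx, hy]
  | smul c x _ hx => simp [hx]

/-- The commutant of `K` in an irreducible spherical function is commutative. -/
theorem commutant_comm (hΦ : IsSphericalFunction n l Φ) (hirr : IsIrreducibleFamily Φ)
    {a b : V →L[ℂ] V} (ha : ∀ k ∈ subK, a * Φ k = Φ k * a) (hb : ∀ k ∈ subK, b * Φ k = Φ k * b) :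
    a * b = b * a := by
  -- Elements of the commutant are their own transposes. Hence `ab` and its transpose `ba` have
  -- equal traces against every `Φ(g)`.
  have hfix : ∀ {c c' : V →L[ℂ] V}, (∀ k ∈ subK, c * Φ k = Φ k * c) →
      (c, c') ∈ transposePairs Φ → c' = c := by
    intro c c' hc hcc
    refine hΦ.eq_of_trE_mul_apply_eq hirr fun g => ?_
    have := hΦ.trE_pair hcc (transposeSU g)
    rw [transposeSU_transposeSU] at this
    rw [this, hΦ.trE_transpose hc]
  obtain ⟨a', haa⟩ := hΦ.exists_transposePair hirr a
  obtain ⟨b', hbb⟩ := hΦ.exists_transposePair hirr b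
  refine hΦ.eq_of_trE_mul_apply_eq hirr fun g => ?_
  have := hΦ.trE_pair_mul haa hbb g
  rw [hfix ha haa, hfix hb hbb] at this
  rw [← this]
  refine hΦ.trE_transpose (fun k hk => ?_) g
  rw [mul_assoc, ha k hk, ← mul_assoc, hb k hk, mul_assoc]

end IsSphericalFunction

end

/-! ### Multiplicity one: `V` is a single copy of `V_π`. -/

section

variable {n : ℤ} {l : ℕ} {V : Type*} [NormedAddCommGroup V] [NormedSpace ℂ V]
  {Φ : SU3 → (V →L[ℂ] V)}

theorem piMat_mul (n : ℤ) (l : ℕ) {k k' : SU3} (hk' : k' ∈ subK) :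
    piMat n l (k * k') = piMat n l k * piMat n l k' := by
  rw [piMat, piRep_upperBlock_mul n l k hk', LinearMap.toMatrix_mul]; rfl

theorem piRep_weightVec (n : ℤ) (l : ℕ) (k : SU3) (m : Fin (l + 1)) :
    piRep n l (upperBlock k) (weightVec l m) = ∑ q, piMat n l k q m • weightVec l q := by
  rw [← weightBasis_apply, ← (weightBasis l).sum_repr (piRep n l (upperBlock k) (weightBasis l m))]
  simp [piMat, LinearMap.toMatrix_apply, weightBasis_apply]

namespace IsSphericalFunction

/-- The vectors `∫ π(k⁻¹)_{jm} Φ(k) v dk`. -/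
noncomputable def isotypicVec (n : ℤ) (l : ℕ) (Φ : SU3 → (V →L[ℂ] V)) (j : Fin (l + 1)) (v : V)
    (m : Fin (l + 1)) : V :=
  ∫ k : subK, piMat n l k⁻¹.1 j m • Φ k v ∂haarK

/-- The intertwining operator `V_π → V` attached to `j` and `v`. -/
noncomputable def intertwiner (n : ℤ) (l : ℕ) (Φ : SU3 → (V →L[ℂ] V)) (j : Fin (l + 1)) (v : V) :
    SymPow l →ₗ[ℂ] V :=
  (weightBasis l).constr ℂ (isotypicVec n l Φ j v)

theorem intertwiner_weightVec (j : Fin (l + 1)) (v : V) (m : Fin (l + 1)) :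
    intertwiner n l Φ j v (weightVec l m) = isotypicVec n l Φ j v m := by
  rw [← weightBasis_apply, intertwiner, Module.Basis.constr_basis]

theorem continuous_isotypic (hΦ : IsSphericalFunction n l Φ) (j m : Fin (l + 1)) (v : V) :
    Continuous fun k : subK => piMat n l k⁻¹.1 j m • Φ k v :=
  (((continuous_piMat n l).comp continuous_inv).matrix_elem j m).smul
    ((hΦ.continuous.comp continuous_subtype_val).clm_apply continuous_const)

theorem map_apply_integral [CompleteSpace V] (a : V →L[ℂ] V) {f : subK → V} (hf : Continuous f) :
    a (∫ k, f k ∂haarK) = ∫ k, a (f k) ∂haarK :=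
  (a.integral_comp_comm (integrable_of_continuous hf)).symm

variable [FiniteDimensional ℂ V]

/-- Translating the variable by `k₀` moves the action of `Φ(k₀)` into the matrix of `π`; for fixed
`j` and `v` these vectors transform like the weight vectors. -/
theorem apply_isotypicVec (hΦ : IsSphericalFunction n l Φ) (j m : Fin (l + 1)) (v : V)
    {k₀ : SU3} (hk₀ : k₀ ∈ subK) :
    Φ k₀ (isotypicVec n l Φ j v m) = ∑ q, piMat n l k₀ q m • isotypicVec n l Φ j v q := by
  have : CompleteSpace V := FiniteDimensional.complete ℂ V
  set κ : subK := ⟨k₀, hk₀⟩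
  have h1 : Φ k₀ (isotypicVec n l Φ j v m)
      = ∫ k : subK, piMat n l (k⁻¹ * κ).1 j m • Φ k v ∂haarK := by
    rw [isotypicVec, map_apply_integral _ (hΦ.continuous_isotypic j m v)]
    refine Eq.trans (integral_congr_ae (Filter.Eventually.of_forall fun k => ?_))
      (integral_mul_left_eq_self (fun k : subK => piMat n l (k⁻¹ * κ).1 j m • Φ k v) κ)
    simp only [map_smul, _root_.mul_inv_rev, inv_mul_cancel_right]
    rw [Subgroup.coe_mul, hΦ.map_mul_left hk₀]
    rfl
  rw [h1]
  simp only [isotypicVec, ← integral_smul]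
  rw [← integral_finsetSum]
  · refine integral_congr_ae (Filter.Eventually.of_forall fun k => ?_)
    simp only
    rw [Subgroup.coe_mul, piMat_mul n l hk₀, Matrix.mul_apply, Finset.sum_smul]
    refine Finset.sum_congr rfl fun q _ => ?_
    rw [smul_smul, mul_comm]
  · intro q _
    exact (integrable_of_continuous (hΦ.continuous_isotypic j q v)).smul (piMat n l k₀ q m)

theorem intertwiner_equivariant (hΦ : IsSphericalFunction n l Φ) (j : Fin (l + 1)) (v : V)
    {k : SU3} (hk : k ∈ subK) (u : SymPow l) :
    intertwiner n l Φ j v (piRep n l (upperBlock k) u) = Φ k (intertwiner n l Φ j v u) := by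
  have : intertwiner n l Φ j v ∘ₗ piRep n l (upperBlock k)
      = (Φ k : V →ₗ[ℂ] V) ∘ₗ intertwiner n l Φ j v := by
    refine (weightBasis l).ext fun m => ?_
    simp only [LinearMap.comp_apply, weightBasis_apply, piRep_weightVec, map_sum, map_smul,
      intertwiner_weightVec]
    exact (hΦ.apply_isotypicVec j m v hk).symm
  exact LinearMap.congr_fun this u

/-- The functional equation at `x = y = 1` reads `∫ χ(k⁻¹) Φ(k) dk = 1`. Writing `χ` as a sum of
diagonal entries of `π` produces the sum over `j`. -/
theorem sum_intertwiner (hΦ : IsSphericalFunction n l Φ) (v : V) :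
    ((l : ℂ) + 1) • ∑ j, intertwiner n l Φ j v (weightVec l j) = v := by
  have : CompleteSpace V := FiniteDimensional.complete ℂ V
  have h1 : Φ 1 * Φ 1 = 1 := by rw [hΦ.map_one, mul_one]
  rw [hΦ.mul_eq] at h1
  have h2 := ContinuousLinearMap.integral_apply
    (integrable_of_continuous (hΦ.continuous_integrand 1 1)) v
  rw [h1] at h2
  rw [one_apply_eq_self] at h2
  conv_rhs => rw [h2]
  simp only [intertwiner_weightVec, isotypicVec]
  rw [← integral_finsetSum, ← integral_smul]
  · refine integral_congr_ae (Filter.Eventually.of_forall fun k => ?_)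
    simp only [one_mul, mul_one, _root_.smul_apply]
    rw [← Finset.sum_smul, smul_smul, chiK_eq]
    rfl
  · intro j _
    exact integrable_of_continuous (hΦ.continuous_isotypic j j v)

theorem exists_intertwiner_ne_zero (hΦ : IsSphericalFunction n l Φ) {v : V} (hv : v ≠ 0) :
    ∃ j, intertwiner n l Φ j v ≠ 0 := by
  by_contra! h
  apply hv
  rw [← hΦ.sum_intertwiner v]
  simp [h]

/-- The average of `a` over conjugation by `K`. -/
noncomputable def averageK (Φ : SU3 → (V →L[ℂ] V)) (a : V →L[ℂ] V) : V →L[ℂ] V :=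
  ∫ k : subK, Φ k.1 * a * Φ k⁻¹.1 ∂haarK

theorem continuous_average (hΦ : IsSphericalFunction n l Φ) (a : V →L[ℂ] V) :
    Continuous fun k : subK => Φ k.1 * a * Φ k⁻¹.1 :=
  ((hΦ.continuous.comp continuous_subtype_val).mul continuous_const).mul
    (hΦ.continuous.comp (continuous_subtype_val.comp continuous_inv))

theorem averageK_comm (hΦ : IsSphericalFunction n l Φ) (a : V →L[ℂ] V) :
    ∀ k ∈ subK, averageK Φ a * Φ k = Φ k * averageK Φ a := by
  intro k₀ hk₀
  have hc := hΦ.continuous_average a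
  have : CompleteSpace V := FiniteDimensional.complete ℂ V
  have e1 := (((ContinuousLinearMap.mul ℂ (V →L[ℂ] V)).flip (Φ k₀)).integral_comp_comm
    (integrable_of_continuous hc))
  have e2 := ((ContinuousLinearMap.mul ℂ (V →L[ℂ] V) (Φ k₀)).integral_comp_comm
    (integrable_of_continuous hc))
  simp only [ContinuousLinearMap.flip_apply, ContinuousLinearMap.mul_apply'] at e1 e2
  rw [averageK, ← e1, ← e2]
  refine Eq.symm (Eq.trans (integral_congr_ae (Filter.Eventually.of_forall fun k => ?_))
    (integral_mul_left_eq_self (fun k : subK => Φ k.1 * a * Φ k⁻¹.1 * Φ k₀) ⟨k₀, hk₀⟩))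
  simp only [_root_.mul_inv_rev, Subgroup.coe_mul]
  rw [hΦ.map_mul_left hk₀, hΦ.map_mul_left (k⁻¹).2]
  simp only [mul_assoc]
  have := hΦ.map_inv_mul hk₀
  change _ = Φ k₀ * (Φ k.1 * (a * (Φ k⁻¹.1 * (Φ k₀⁻¹ * Φ k₀))))
  rw [this, mul_one]

/-- An irreducible spherical function of type `π` has `V ≅ V_π` as a representation of `K`. -/
theorem exists_identification (hΦ : IsSphericalFunction n l Φ) (hirr : IsIrreducibleFamily Φ) :
    ∃ T : V ≃ₗ[ℂ] SymPow l, IsKIdentification n Φ T := by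
  have := hirr.1
  have : CompleteSpace V := FiniteDimensional.complete ℂ V
  obtain ⟨v, hv⟩ := exists_ne (0 : V)
  obtain ⟨j, hj⟩ := hΦ.exists_intertwiner_ne_zero hv
  set B := intertwiner n l Φ j v with hB
  have hBe : ∀ k ∈ subK, ∀ u, B (piRep n l (upperBlock k) u) = Φ k (B u) := fun k hk u =>
    hΦ.intertwiner_equivariant j v hk u
  have hinj : LinearMap.ker B = ⊥ := by
    refine (piRep_irreducible n l fun k hk u hu => ?_).resolve_right fun h =>
      hj (LinearMap.ker_eq_top.mp h)
    rw [LinearMap.mem_ker] at hu ⊢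
    rw [hBe k hk, hu, map_zero]
  obtain ⟨L₀, hL₀⟩ := B.exists_leftInverse_of_injective hinj
  have hL₀B : ∀ u, L₀ (B u) = u := fun u => LinearMap.congr_fun hL₀ u
  -- A projection onto the image of `B`. Its average over `K` still fixes this image pointwise, has
  -- values in it, and commutes with `K`.
  set p₀ : V →L[ℂ] V := LinearMap.toContinuousLinearMap (B ∘ₗ L₀) with hp₀
  have hp₀a : ∀ x, p₀ x = B (L₀ x) := fun x => rfl
  set p := averageK Φ p₀ with hp
  have hpc : ∀ k ∈ subK, p * Φ k = Φ k * p := hΦ.averageK_comm p₀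
  have hpapp : ∀ x, p x = ∫ k : subK, Φ k.1 (p₀ (Φ k⁻¹.1 x)) ∂haarK := fun x =>
    ContinuousLinearMap.integral_apply (integrable_of_continuous (hΦ.continuous_average p₀)) x
  have hcont : ∀ x, Continuous fun k : subK => Φ k.1 (p₀ (Φ k⁻¹.1 x)) := fun x =>
    (hΦ.continuous_average p₀).clm_apply continuous_const
  have hpB : ∀ u, p (B u) = B u := by
    intro u
    have hone : ∀ k : subK, Φ k.1 (p₀ (Φ k⁻¹.1 (B u))) = B u := fun k => by
      rw [← hBe _ (k⁻¹).2, hp₀a, hL₀B, hBe _ (k⁻¹).2]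
      have := DFunLike.congr_fun (hΦ.map_mul_inv k.2) (B u)
      exact this
    rw [hpapp]
    simp only [hone]
    simp
  have hp₀p : ∀ x, B (L₀ (p x)) = p x := by
    intro x
    rw [← hp₀a, hpapp, map_apply_integral p₀ (hcont x)]
    refine integral_congr_ae (Filter.Eventually.of_forall fun k => ?_)
    simp only [hp₀a]
    rw [← hBe _ k.2, hL₀B]
  set L : V →ₗ[ℂ] SymPow l := L₀ ∘ₗ (p : V →ₗ[ℂ] V) with hL
  have hLB : ∀ u, L (B u) = u := fun u => by
    change L₀ (p (B u)) = u
    rw [hpB, hL₀B]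
  have hBL : ∀ x, B (L x) = p x := hp₀p
  have hLe : ∀ k ∈ subK, ∀ x, L (Φ k x) = piRep n l (upperBlock k) (L x) := by
    intro k hk x
    have h1 : p (Φ k x) = Φ k (p x) := DFunLike.congr_fun (hpc k hk) x
    change L₀ (p (Φ k x)) = _
    rw [h1, ← hBL x, ← hBe k hk, hL₀B]
  have hsurj : ∀ x, B (L x) = x := by
    -- A vector outside the image of `B` yields a second copy `B₁` of `V_π`, inside the kernel of
    -- `p`. The operator `b = B₁ L` commutes with `K`, yet `p b = 0` while `b p` agrees with `B₁` on
    -- the first copy: the commutant would not be commutative.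
    by_contra! h
    obtain ⟨x, hx⟩ := h
    set w := x - B (L x) with hw
    have hw0 : w ≠ 0 := sub_ne_zero.mpr hx.symm
    have hpw : p w = 0 := by
      rw [hw, map_sub, hpB, ← hBL, sub_self]
    obtain ⟨j', hj'⟩ := hΦ.exists_intertwiner_ne_zero hw0
    set B₁ := intertwiner n l Φ j' w with hB₁
    have hpB₁ : ∀ u, p (B₁ u) = 0 := by
      have : (p : V →ₗ[ℂ] V) ∘ₗ B₁ = 0 := by
        refine (weightBasis l).ext fun m => ?_
        rw [LinearMap.comp_apply, weightBasis_apply, hB₁, intertwiner_weightVec, isotypicVec]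
        change p _ = _
        rw [map_apply_integral p (hΦ.continuous_isotypic j' m w)]
        have : ∀ k : subK, p (piMat n l k⁻¹.1 j' m • Φ k w) = 0 := fun k => by
          have h1 : p (Φ k w) = Φ k (p w) := DFunLike.congr_fun (hpc k k.2) w
          rw [map_smul, h1, hpw, map_zero, smul_zero]
        simp only [this, integral_zero]
        rfl
      exact fun u => LinearMap.congr_fun this u
    set b : V →L[ℂ] V := LinearMap.toContinuousLinearMap (B₁ ∘ₗ L) with hb
    have hba : ∀ y, b y = B₁ (L y) := fun y => rfl
    have hbc : ∀ k ∈ subK, b * Φ k = Φ k * b := by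
      intro k hk
      ext y
      change B₁ (L (Φ k y)) = Φ k (B₁ (L y))
      rw [hLe k hk, hΦ.intertwiner_equivariant j' w hk]
    have hcomm := hΦ.commutant_comm hirr hpc hbc
    apply hj'
    refine LinearMap.ext fun u => ?_
    have h1 := DFunLike.congr_fun hcomm (B u)
    change p (b (B u)) = b (p (B u)) at h1
    rw [hpB, hba, hLB, hpB₁] at h1
    exact h1.symm
  exact ⟨LinearEquiv.ofLinearMap L B (LinearMap.ext hLB) (LinearMap.ext hsurj), hLe⟩

end IsSphericalFunction

end

/-! ### Polynomial functions on `SU(3)` -/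

/-- Functions on `SU(3)` that are polynomial in the matrix entries. -/
def IsPolyFun (f : SU3 → ℂ) : Prop := ∃ p : MatPoly, ∀ g : SU3, f g = evalMat g.1 p

namespace IsPolyFun

theorem add {f f' : SU3 → ℂ} (h : IsPolyFun f) (h' : IsPolyFun f') :
    IsPolyFun fun g => f g + f' g := by
  obtain ⟨p, hp⟩ := h
  obtain ⟨p', hp'⟩ := h'
  exact ⟨p + p', fun g => by simp [hp, hp']⟩

theorem mul {f f' : SU3 → ℂ} (h : IsPolyFun f) (h' : IsPolyFun f') :
    IsPolyFun fun g => f g * f' g := by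
  obtain ⟨p, hp⟩ := h
  obtain ⟨p', hp'⟩ := h'
  exact ⟨p * p', fun g => by simp [hp, hp']⟩

theorem const (c : ℂ) : IsPolyFun fun _ => c := ⟨MvPolynomial.C c, fun g => by simp⟩

theorem sum {ι : Type*} (s : Finset ι) {f : ι → SU3 → ℂ} (h : ∀ i ∈ s, IsPolyFun (f i)) :
    IsPolyFun fun g => ∑ i ∈ s, f i g := by
  classical
  induction s using Finset.induction_on with
  | empty => simpa using const 0
  | insert a s ha ih =>
    simp only [Finset.sum_insert ha]
    exact (h a (Finset.mem_insert_self a s)).add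
      (ih fun i hi => h i (Finset.mem_insert_of_mem hi))

end IsPolyFun

theorem continuous_evalMat (p : MatPoly) :
    Continuous fun M : Matrix (Fin 3) (Fin 3) ℂ => evalMat M p := by
  induction p using MvPolynomial.induction_on with
  | C a => simpa using continuous_const
  | add p q hp hq => simpa using hp.fun_add hq
  | mul_X p q hp =>
    simp only [map_mul, evalMat_X]
    exact hp.mul (continuous_id.matrix_elem q.1 q.2)

theorem star_eq_adjugate (g : SU3) : star g.1 = g.1.adjugate := by
  have h := Matrix.mem_specialUnitaryGroup_iff.mp g.2
  have h1 : star g.1 * g.1 = 1 := Matrix.mem_unitaryGroup_iff'.mp h.1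
  have h2 : g.1 * g.1.adjugate = 1 := by rw [Matrix.mul_adjugate, h.2, one_smul]
  calc star g.1 = star g.1 * (g.1 * g.1.adjugate) := by rw [h2, mul_one]
    _ = g.1.adjugate := by rw [← mul_assoc, h1, one_mul]

/-- On SU(3) the adjoint is the adjugate, so complex conjugates of entries are again polynomials in
the entries. -/
theorem exists_star_evalMat (p : MatPoly) : IsPolyFun fun g => star (evalMat g.1 p) := by
  induction p using MvPolynomial.induction_on with
  | C a => simpa using IsPolyFun.const (star a)
  | add p q hp hq => simpa using hp.add hq
  | mul_X p q hp =>
    simp only [map_mul, star_mul', evalMat_X]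
    refine hp.mul ⟨(Matrix.mvPolynomialX (Fin 3) (Fin 3) ℂ).adjugate q.2 q.1, fun g => ?_⟩
    change (star g.1) q.2 q.1 = _
    rw [star_eq_adjugate]
    have h2 := (evalMat g.1).toRingHom.map_adjugate (Matrix.mvPolynomialX (Fin 3) (Fin 3) ℂ)
    have h3 : (evalMat g.1).toRingHom.mapMatrix (Matrix.mvPolynomialX (Fin 3) (Fin 3) ℂ) = g.1 := by
      ext i j
      simp [Matrix.mvPolynomialX_apply]
    rw [h3] at h2
    rw [← h2]
    rfl

/-- The algebra of polynomial functions in `C(SU(3), ℂ)`. -/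
noncomputable def polyStarSubalgebra : StarSubalgebra ℂ C(SU3, ℂ) where
  carrier := {f | IsPolyFun f}
  mul_mem' h h' := h.mul h'
  add_mem' h h' := h.add h'
  algebraMap_mem' c := IsPolyFun.const c
  star_mem' := by
    rintro f ⟨p, hp⟩
    obtain ⟨q, hq⟩ := exists_star_evalMat p
    exact ⟨q, fun g => (congrArg star (hp g)).trans (hq g)⟩

/-- Stone–Weierstrass: the matrix entries separate points. -/
theorem exists_polyFun_near (f : C(SU3, ℂ)) {ε : ℝ} (hε : 0 < ε) :
    ∃ p : MatPoly, ∀ g : SU3, ‖f g - evalMat g.1 p‖ < ε := by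
  have hsep : polyStarSubalgebra.toSubalgebra.SeparatesPoints := by
    intro x y hxy
    have : ∃ i j, x.1 i j ≠ y.1 i j := by
      by_contra! h
      exact hxy (Subtype.ext (Matrix.ext h))
    obtain ⟨i, j, hij⟩ := this
    refine ⟨fun g => g.1 i j, ⟨⟨fun g => g.1 i j, continuous_subtype_val.matrix_elem i j⟩,
      ⟨MvPolynomial.X (i, j), fun g => by simp⟩, rfl⟩, hij⟩
  have htop := ContinuousMap.starSubalgebra_topologicalClosure_eq_top_of_separatesPoints
    polyStarSubalgebra hsep
  have hf : f ∈ polyStarSubalgebra.topologicalClosure := by rw [htop]; trivial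
  obtain ⟨h, ⟨p, hp⟩, hd⟩ := Metric.mem_closure_iff.mp hf ε hε
  refine ⟨p, fun g => ?_⟩
  rw [← hp, ← dist_eq_norm]
  exact (ContinuousMap.dist_apply_le_dist g).trans_lt hd

/-! ### Polynomiality of the matrix entries of a spherical function. -/

section

variable {n : ℤ} {l : ℕ} {V : Type*} [NormedAddCommGroup V] [NormedSpace ℂ V]
  {Φ : SU3 → (V →L[ℂ] V)}

namespace IsSphericalFunction

variable [FiniteDimensional ℂ V]

/-- The functionals `f` such that all `f(Φ(g) w)` are polynomial. -/
def polyFunctionals (Φ : SU3 → (V →L[ℂ] V)) : Submodule ℂ (Module.Dual ℂ V) where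
  carrier := {f | ∀ w, IsPolyFun fun g => f (Φ g w)}
  add_mem' h h' w := (h w).add (h' w)
  zero_mem' _ := IsPolyFun.const 0
  smul_mem' c _ h w := (IsPolyFun.const c).mul (h w)

theorem functional_apply (hΦ : IsSphericalFunction n l Φ) (f : Module.Dual ℂ V) (w : V)
    (x y : SU3) : f (Φ x (Φ y w)) = ∫ k : subK, chiK n l k⁻¹ * f (Φ (x * k.1 * y) w) ∂haarK :=
  hΦ.functional_mul_eq
    (f ∘ₗ LinearMap.applyₗ w ∘ₗ ContinuousLinearMap.coeLM ℂ) x y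

theorem continuous_functional (hΦ : IsSphericalFunction n l Φ) (f : Module.Dual ℂ V) (w : V) :
    Continuous fun g => f (Φ g w) :=
  f.continuous_of_finiteDimensional.comp (hΦ.continuous.clm_apply continuous_const)

theorem integrable_chi_evalMat (n : ℤ) (l : ℕ) (x y : SU3) (p : MatPoly) :
    Integrable (fun k : subK => chiK n l k⁻¹ * evalMat (x * k.1 * y).1 p) haarK :=
  integrable_of_continuous (((continuous_chiK n l).comp continuous_inv).mul
    ((continuous_evalMat p).comp (continuous_subtype_val.comp
      ((continuous_const.mul continuous_subtype_val).mul continuous_const))))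

/-- Splitting the polynomial along `(xk) · y` takes the variable `y` out of the integral. -/
theorem isPolyFun_integral (n : ℤ) (l : ℕ) (x : SU3) (p : MatPoly) :
    IsPolyFun fun y => ∫ k : subK, chiK n l k⁻¹ * evalMat (x * k.1 * y).1 p ∂haarK := by
  obtain ⟨m, a, b, h⟩ := exists_evalMat_mul p
  have : (fun y : SU3 => ∫ k : subK, chiK n l k⁻¹ * evalMat (x * k.1 * y).1 p ∂haarK)
      = fun y => ∑ i, (∫ k : subK, chiK n l k⁻¹ * evalMat (x * k.1 * 1).1 (a i) ∂haarK) *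
        evalMat y.1 (b i) := by
    funext y
    simp only [← integral_mul_const]
    rw [← integral_finsetSum]
    · refine integral_congr_ae (Filter.Eventually.of_forall fun k => ?_)
      simp only
      rw [Submonoid.coe_mul, h, Finset.mul_sum]
      simp [mul_assoc]
    · intro i _
      exact (integrable_chi_evalMat n l x 1 (a i)).mul_const _
  rw [this]
  exact IsPolyFun.sum _ fun i _ => (IsPolyFun.const _).mul ⟨b i, fun _ => rfl⟩

theorem polyFunctionals_invariant (hΦ : IsSphericalFunction n l Φ) {f : Module.Dual ℂ V}
    (hf : f ∈ polyFunctionals Φ) (x : SU3) : f ∘ₗ (Φ x : V →ₗ[ℂ] V) ∈ polyFunctionals Φ := by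
  intro w
  obtain ⟨p, hp⟩ := hf w
  have h := isPolyFun_integral n l x p
  have : (fun y => (f ∘ₗ (Φ x : V →ₗ[ℂ] V)) (Φ y w))
      = fun y => ∫ k : subK, chiK n l k⁻¹ * evalMat (x * k.1 * y).1 p ∂haarK := by
    funext y
    have := hΦ.functional_apply f w x y
    simp only [hp] at this
    exact this
  rw [this]
  exact h

/-- The common kernel of these functionals is invariant under all `Φ(g)`, so it is `0` or `V`;
dually, the functionals are all or none. -/
theorem polyFunctionals_eq_top (hΦ : IsSphericalFunction n l Φ) (hirr : IsIrreducibleFamily Φ)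
    (hne : polyFunctionals Φ ≠ ⊥) : polyFunctionals Φ = ⊤ := by
  have h1 := hirr.2 (polyFunctionals Φ).dualCoannihilator (fun g v hv => by
    rw [Submodule.mem_dualCoannihilator] at hv ⊢
    exact fun f hf => hv _ (hΦ.polyFunctionals_invariant hf g))
  have h2 := Subspace.dualCoannihilator_dualAnnihilator_eq (W := polyFunctionals Φ)
  rcases h1 with h1 | h1
  · rw [← h2, h1, Submodule.dualAnnihilator_bot]
  · exfalso
    apply hne
    rw [← h2, h1, Submodule.dualAnnihilator_top]

/-- A functional `f` is smoothed to `w ↦ ∫ q(g⁻¹) f(Φ(g)w) dg` with `q` polynomial. At `Φ(y)w`, a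
substitution leaves `y` only in `q(k y g⁻¹)`, so the smoothed functional has polynomial
coefficients. If all of these were zero, `u(g) = f(Φ(g)v)` would be annihilated by every polynomial
in `g⁻¹`, against Stone–Weierstrass. -/
theorem polyFunctionals_ne_bot (hΦ : IsSphericalFunction n l Φ) (hirr : IsIrreducibleFamily Φ) :
    polyFunctionals Φ ≠ ⊥ := by
  have := hirr.1
  let _ : MeasurableSpace SU3 := borel SU3
  have : BorelSpace SU3 := ⟨rfl⟩
  let μ : Measure SU3 := Measure.haarMeasure ⊤
  have hμp : IsProbabilityMeasure μ := ⟨by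
    simpa using Measure.haarMeasure_self (K₀ := (⊤ : TopologicalSpace.PositiveCompacts SU3))⟩
  have hμr : μ.IsMulRightInvariant := isMulRightInvariant_of_compactSpace μ
  have hint : ∀ {f : SU3 → ℂ}, Continuous f → Integrable f μ := fun hf =>
    hf.integrable_of_hasCompactSupport (HasCompactSupport.of_compactSpace _)
  obtain ⟨v, hv⟩ := exists_ne (0 : V)
  obtain ⟨f, hf⟩ : ∃ f : Module.Dual ℂ V, f v ≠ 0 := by
    by_contra! h
    exact hv ((Module.forall_dual_apply_eq_zero_iff ℂ v).mp h)
  have hcf := fun w => hΦ.continuous_functional f w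
  have hcq : ∀ q : MatPoly, Continuous fun g : SU3 => evalMat g⁻¹.1 q := fun q =>
    (continuous_evalMat q).comp (continuous_subtype_val.comp continuous_inv)
  -- the functionals obtained by smoothing `f` with a polynomial
  let F : MatPoly → Module.Dual ℂ V := fun q =>
    { toFun := fun w => ∫ g, evalMat g⁻¹.1 q * f (Φ g w) ∂μ
      map_add' := fun w w' => by
        refine Eq.trans ?_
          (integral_add (hint ((hcq q).mul (hcf w))) (hint ((hcq q).mul (hcf w'))))
        simp [mul_add]
      map_smul' := fun c w => by
        rw [RingHom.id_apply, smul_eq_mul, ← integral_const_mul]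
        simp [mul_left_comm] }
  have hF : ∀ q w, F q w = ∫ g, evalMat g⁻¹.1 q * f (Φ g w) ∂μ := fun _ _ => rfl
  have hmem : ∀ q, F q ∈ polyFunctionals Φ := by
    intro q w
    obtain ⟨m, a, b, h⟩ := exists_evalMat_mul q
    have key : (fun y => F q (Φ y w)) = fun y => ∑ i,
        (∫ k : subK, chiK n l k⁻¹ * evalMat (1 * k.1 * y).1 (a i) ∂haarK) * F (b i) w := by
      funext y
      rw [hF]
      simp only [hΦ.functional_apply f w, ← integral_const_mul]
      rw [integral_integral_swap_of_hasCompactSupport]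
      · have inner : ∀ k : subK, ∫ g : SU3, evalMat g⁻¹.1 q *
            (chiK n l k⁻¹ * f (Φ (g * k.1 * y) w)) ∂μ
            = ∑ i, chiK n l k⁻¹ * evalMat (1 * k.1 * y).1 (a i) * F (b i) w := by
          intro k
          have e1 := integral_mul_right_eq_self (μ := μ)
            (fun g : SU3 => evalMat (k.1 * y * g⁻¹).1 q * (chiK n l k⁻¹ * f (Φ g w))) (k.1 * y)
          refine Eq.trans (integral_congr_ae (Filter.Eventually.of_forall fun g => ?_)) (e1.trans ?_)
          · simp only [_root_.mul_inv_rev, mul_assoc, mul_inv_cancel_left]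
          · simp only [hF, ← integral_const_mul]
            rw [← integral_finsetSum]
            · refine integral_congr_ae (Filter.Eventually.of_forall fun g => ?_)
              simp only
              rw [one_mul, show (k.1 * y * g⁻¹).1 = (k.1 * y).1 * g⁻¹.1 from rfl, h, Finset.sum_mul]
              exact Finset.sum_congr rfl fun i _ => by ring
            · intro i _
              exact (hint ((hcq (b i)).mul (hcf w))).const_mul _
        simp only [inner]
        rw [integral_finsetSum]
        · simp only [integral_mul_const]
        · intro i _
          exact (integrable_chi_evalMat n l 1 y (a i)).mul_const _
      · refine ((hcq q).comp continuous_fst).mul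
          (((continuous_chiK n l).comp (continuous_inv.comp continuous_snd)).mul ?_)
        exact (hcf w).comp ((continuous_fst.mul
          (continuous_subtype_val.comp continuous_snd)).mul continuous_const)
      · exact HasCompactSupport.of_compactSpace _
    rw [key]
    exact IsPolyFun.sum _ fun i _ => (isPolyFun_integral n l 1 (a i)).mul (IsPolyFun.const _)
  intro hbot
  have hzero : ∀ q, ∫ g, evalMat g⁻¹.1 q * f (Φ g v) ∂μ = 0 := by
    intro q
    have := hmem q
    rw [hbot, Submodule.mem_bot] at this
    rw [← hF, this]; rfl
  set u : SU3 → ℂ := fun g => f (Φ g v) with hu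
  have huc : Continuous u := hcf v
  have hpos : 0 < ∫ g, ‖u g‖ ^ 2 ∂μ := by
    refine Continuous.integral_pos_of_hasCompactSupport_nonneg_nonzero (x := 1)
      (huc.norm.pow 2) (HasCompactSupport.of_compactSpace _) (fun g => by positivity) ?_
    have : u 1 = f v := by simp [hu, hΦ.map_one]
    rw [this]
    exact pow_ne_zero 2 (norm_ne_zero_iff.mpr hf)
  obtain ⟨M, hM⟩ := isCompact_univ.exists_bound_of_continuousOn (huc.continuousOn (s := Set.univ))
  have hM0 : 0 ≤ M := (norm_nonneg _).trans (hM 1 trivial)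
  let h : C(SU3, ℂ) := ⟨fun g => star (u g⁻¹), continuous_star.comp (huc.comp continuous_inv)⟩
  -- With `|u| ≤ M` this error keeps the integral of `(h - q) u` below `∫ |u|²`, to which it would
  -- be equal if `q` annihilated `u`.
  obtain ⟨q, hq⟩ := exists_polyFun_near h
    (ε := (∫ g, ‖u g‖ ^ 2 ∂μ) / (M + 1)) (by positivity)
  have h1 : ∫ g, (h g⁻¹ - evalMat g⁻¹.1 q) * u g ∂μ = ((∫ g, ‖u g‖ ^ 2 ∂μ : ℝ) : ℂ) := by
    have e1 : ∀ g, (h g⁻¹ - evalMat g⁻¹.1 q) * u g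
        = ((‖u g‖ ^ 2 : ℝ) : ℂ) - evalMat g⁻¹.1 q * u g := by
      intro g
      have : h g⁻¹ * u g = ((‖u g‖ ^ 2 : ℝ) : ℂ) := by
        change star (u g⁻¹⁻¹) * u g = _
        rw [inv_inv, ← Complex.normSq_eq_norm_sq, mul_comm]
        exact Complex.mul_conj _
      rw [sub_mul, this]
    simp only [e1]
    rw [integral_sub, hzero q, sub_zero]
    · exact integral_ofReal
    · exact hint (Complex.continuous_ofReal.comp (huc.norm.pow 2))
    · exact hint ((hcq q).mul huc)
  have h2 := norm_integral_le_of_norm_le_const (μ := μ)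
    (f := fun g => (h g⁻¹ - evalMat g⁻¹.1 q) * u g)
    (C := (∫ g, ‖u g‖ ^ 2 ∂μ) / (M + 1) * M) (Filter.Eventually.of_forall fun g => by
      rw [norm_mul]
      exact mul_le_mul (hq g⁻¹).le (hM g trivial) (norm_nonneg _) (by positivity))
  rw [h1, Complex.norm_real, Real.norm_of_nonneg hpos.le] at h2
  simp only [probReal_univ, mul_one] at h2
  rw [div_mul_eq_mul_div, le_div_iff₀ (by linarith)] at h2
  nlinarith

/-- The matrix entries of an irreducible spherical function are polynomial. -/
theorem isPolyFun_functional (hΦ : IsSphericalFunction n l Φ) (hirr : IsIrreducibleFamily Φ)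
    (f : Module.Dual ℂ V) (w : V) : IsPolyFun fun g => f (Φ g w) := by
  have : f ∈ polyFunctionals Φ := by
    rw [hΦ.polyFunctionals_eq_top hirr (hΦ.polyFunctionals_ne_bot hirr)]; trivial
  exact this w

end IsSphericalFunction

end

/-! ### Polynomial matrix functions and their derivatives -/

section MatrixPolynomials

variable {ι : Type*}

/-- Evaluation of a matrix of polynomials. -/
noncomputable def matEval (M : Matrix (Fin 3) (Fin 3) ℂ) (P : Matrix ι ι MatPoly) : Matrix ι ι ℂ :=
  P.map (evalMat M)

/-- Entrywise right derivative. -/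
noncomputable def matRight (X : Matrix (Fin 3) (Fin 3) ℂ) (P : Matrix ι ι MatPoly) :
    Matrix ι ι MatPoly :=
  P.map (rightDer X)

/-- Entrywise left derivative. -/
noncomputable def matLeft (X : Matrix (Fin 3) (Fin 3) ℂ) (P : Matrix ι ι MatPoly) :
    Matrix ι ι MatPoly :=
  P.map (leftDer X)

theorem matRight_add (X Y : Matrix (Fin 3) (Fin 3) ℂ) (P : Matrix ι ι MatPoly) :
    matRight (X + Y) P = matRight X P + matRight Y P := by
  ext1 i j; exact rightDer_add X Y _

theorem matRight_smul (c : ℂ) (X : Matrix (Fin 3) (Fin 3) ℂ) (P : Matrix ι ι MatPoly) :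
    matRight (c • X) P = c • matRight X P := by
  ext1 i j; exact rightDer_smul c X _

theorem matRight_add_right (X : Matrix (Fin 3) (Fin 3) ℂ) (P Q : Matrix ι ι MatPoly) :
    matRight X (P + Q) = matRight X P + matRight X Q := by
  ext1 i j; exact map_add (rightDer X) _ _

theorem matRight_smul_right (c : ℂ) (X : Matrix (Fin 3) (Fin 3) ℂ) (P : Matrix ι ι MatPoly) :
    matRight X (c • P) = c • matRight X P := by
  ext1 i j; exact (rightDer X).map_smul c (P i j)

theorem matEval_add (M : Matrix (Fin 3) (Fin 3) ℂ) (P Q : Matrix ι ι MatPoly) :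
    matEval M (P + Q) = matEval M P + matEval M Q := by
  ext1 i j; exact map_add (evalMat M) _ _

theorem matEval_smul (M : Matrix (Fin 3) (Fin 3) ℂ) (c : ℂ) (P : Matrix ι ι MatPoly) :
    matEval M (c • P) = c • matEval M P := by
  ext1 i j; exact map_smul (evalMat M) _ _

theorem matEval_commutator (M X Y : Matrix (Fin 3) (Fin 3) ℂ) (P : Matrix ι ι MatPoly) :
    matEval M (matRight X (matRight Y P)) - matEval M (matRight Y (matRight X P))
      = matEval M (matRight (X * Y - Y * X) P) := by
  ext1 i j
  change evalMat M (rightDer X (rightDer Y (P i j))) - evalMat M (rightDer Y (rightDer X (P i j)))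
    = evalMat M (rightDer (X * Y - Y * X) (P i j))
  rw [← map_sub, rightDer_commutator]

theorem matEval_matLeft {M X Y : Matrix (Fin 3) (Fin 3) ℂ} (h : X * M = M * Y)
    (P : Matrix ι ι MatPoly) : matEval M (matLeft X P) = matEval M (matRight Y P) := by
  ext1 i j; exact evalMat_leftDer_eq_rightDer h _

end MatrixPolynomials

/-- Linear relations on `SU(3)` can be differentiated. -/
theorem evalMat_rightDer_eq_sum {κ : Type*} [Fintype κ] {p : MatPoly} {c : κ → ℂ} {q : κ → MatPoly}
    (h : ∀ g : SU3, evalMat g.1 p = ∑ m, c m * evalMat g.1 (q m))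
    {X : Matrix (Fin 3) (Fin 3) ℂ} (ht : X.trace = 0) (g : SU3) :
    evalMat g.1 (rightDer X p) = ∑ m, c m * evalMat g.1 (rightDer X (q m)) := by
  have := evalMat_rightDer_eq_zero_of_vanishing (p := p - ∑ m, c m • q m)
    (fun g => by simp [h]) ht g
  simpa [sub_eq_zero] using this

/-! ### Matrix spherical functions and the action of the Lie algebra. -/

/-- An irreducible spherical function in matrix form, with polynomial entries `F`. -/
structure IsMatSpherical (n : ℤ) (l : ℕ) (F : Matrix (Fin (l + 1)) (Fin (l + 1)) MatPoly) :
    Prop where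
  map_K : ∀ k ∈ subK, matEval k.1 F = piMat n l k
  map_mul_right : ∀ g : SU3, ∀ k ∈ subK, matEval (g * k).1 F = matEval g.1 F * matEval k.1 F
  map_mul_left : ∀ k ∈ subK, ∀ g : SU3, matEval (k * g).1 F = matEval k.1 F * matEval g.1 F
  mul_eq : ∀ x y : SU3, ∀ i j, (matEval x.1 F * matEval y.1 F) i j
    = ∫ k : subK, chiK n l k⁻¹ * matEval (x * k.1 * y).1 F i j ∂haarK

namespace IsMatSpherical

variable {n : ℤ} {l : ℕ} {F : Matrix (Fin (l + 1)) (Fin (l + 1)) MatPoly}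

/-- The derived representation `Z ↦ dF(1) Z`. -/
noncomputable def infRep (F : Matrix (Fin (l + 1)) (Fin (l + 1)) MatPoly)
    (Z : Matrix (Fin 3) (Fin 3) ℂ) : Matrix (Fin (l + 1)) (Fin (l + 1)) ℂ :=
  matEval 1 (matRight Z F)

theorem infRep_add (Y Z : Matrix (Fin 3) (Fin 3) ℂ) :
    infRep F (Y + Z) = infRep F Y + infRep F Z := by
  rw [infRep, matRight_add, matEval_add]; rfl

theorem infRep_smul (c : ℂ) (Z : Matrix (Fin 3) (Fin 3) ℂ) :
    infRep F (c • Z) = c • infRep F Z := by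
  rw [infRep, matRight_smul, matEval_smul]; rfl

theorem matEval_one (hF : IsMatSpherical n l F) : matEval 1 F = 1 := by
  have := hF.map_K 1 subK.one_mem
  rw [piMat, upperBlock_one, piRep_one] at this
  exact this.trans (LinearMap.toMatrix_one _)

theorem hasDerivAt_mul_curve (g : SU3) {γ : ℝ → SU3} {X : Matrix (Fin 3) (Fin 3) ℂ} (h0 : γ 0 = 1)
    (hγ : ∀ i j, HasDerivAt (fun s => (γ s).1 i j) (X i j) 0) (p : MatPoly) :
    HasDerivAt (fun s => evalMat (g * γ s).1 p) (evalMat g.1 (rightDer X p)) 0 := by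
  have := hasDerivAt_evalMat_right (γ := fun s => (g * γ s).1) (s := 0) (X := X) (fun i j => by
    simp only [h0, mul_one]
    simp only [Submonoid.coe_mul, Matrix.mul_apply]
    exact HasDerivAt.fun_sum fun m _ => (hγ m j).const_mul _) p
  simpa only [h0, mul_one] using this

theorem hasDerivAt_curve_mul (g : SU3) {γ : ℝ → SU3} {X : Matrix (Fin 3) (Fin 3) ℂ} (h0 : γ 0 = 1)
    (hγ : ∀ i j, HasDerivAt (fun s => (γ s).1 i j) (X i j) 0) (p : MatPoly) :
    HasDerivAt (fun s => evalMat (γ s * g).1 p) (evalMat g.1 (leftDer X p)) 0 := by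
  have := hasDerivAt_evalMat_left (γ := fun s => (γ s * g).1) (s := 0) (X := X) (fun i j => by
    simp only [h0, one_mul]
    simp only [Submonoid.coe_mul, Matrix.mul_apply]
    exact HasDerivAt.fun_sum fun m _ => (hγ i m).mul_const _) p
  simpa only [h0, one_mul] using this

/-- Differentiate `F(g γ(s)) = F(g) F(γ(s))` along curves in `K`; complex linearity extends the
result to the complexified Lie algebra of `K`. -/
theorem right_block (hF : IsMatSpherical n l F) {Z : Matrix (Fin 3) (Fin 3) ℂ} (hZ : IsBlock Z)
    (ht : Z.trace = 0) (g : SU3) :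
    matEval g.1 (matRight Z F) = matEval g.1 F * infRep F Z := by
  have key : ∀ Z : Matrix (Fin 3) (Fin 3) ℂ, IsBlock Z → Z.trace = 0 → Zᴴ = -Z →
      matEval g.1 (matRight Z F) = matEval g.1 F * infRep F Z := by
    intro Z hZ ht hs
    obtain ⟨γ, h0, hγ, hK⟩ := exists_curve_SU3 hs ht
    ext i j
    have h1 := hasDerivAt_mul_curve g h0 hγ (F i j)
    have h2 : HasDerivAt (fun s => ∑ q, matEval g.1 F i q * evalMat (γ s).1 (F q j))
        (∑ q, matEval g.1 F i q * evalMat 1 (rightDer Z (F q j))) 0 :=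
      HasDerivAt.fun_sum fun q _ => HasDerivAt.const_mul _ (by
        simpa using hasDerivAt_mul_curve 1 h0 hγ (F q j))
    refine h1.unique (h2.congr_of_eventuallyEq (Filter.Eventually.of_forall fun s => ?_))
    have := congrFun (congrFun (hF.map_mul_right g (γ s) (hK hZ s)) i) j
    rw [Matrix.mul_apply] at this
    exact this
  obtain ⟨Y, W, hY, hW, hZYW, htr, hb⟩ := exists_skew_decomposition Z
  rw [hZYW, matRight_add, matRight_smul, matEval_add, matEval_smul, infRep_add, infRep_smul,
    key Y (hb hZ).1 (htr ht).1 hY, key W (hb hZ).2 (htr ht).2 hW, mul_add, mul_smul_comm]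

theorem left_block (hF : IsMatSpherical n l F) {Z : Matrix (Fin 3) (Fin 3) ℂ} (hZ : IsBlock Z)
    (ht : Z.trace = 0) (g : SU3) :
    matEval g.1 (matLeft Z F) = infRep F Z * matEval g.1 F := by
  have key : ∀ Z : Matrix (Fin 3) (Fin 3) ℂ, IsBlock Z → Z.trace = 0 → Zᴴ = -Z →
      matEval g.1 (matLeft Z F) = infRep F Z * matEval g.1 F := by
    intro Z hZ ht hs
    obtain ⟨γ, h0, hγ, hK⟩ := exists_curve_SU3 hs ht
    ext i j
    have h1 := hasDerivAt_curve_mul g h0 hγ (F i j)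
    have h2 : HasDerivAt (fun s => ∑ q, evalMat (γ s).1 (F i q) * matEval g.1 F q j)
        (∑ q, evalMat 1 (rightDer Z (F i q)) * matEval g.1 F q j) 0 :=
      HasDerivAt.fun_sum fun q _ => HasDerivAt.mul_const (by
        simpa using hasDerivAt_mul_curve 1 h0 hγ (F i q)) _
    refine h1.unique (h2.congr_of_eventuallyEq (Filter.Eventually.of_forall fun s => ?_))
    have := congrFun (congrFun (hF.map_mul_left (γ s) (hK hZ s) g) i) j
    rw [Matrix.mul_apply] at this
    exact this
  obtain ⟨Y, W, hY, hW, hZYW, htr, hb⟩ := exists_skew_decomposition Z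
  have hadd : ∀ A B : Matrix (Fin 3) (Fin 3) ℂ, matLeft (A + B) F = matLeft A F + matLeft B F :=
    fun A B => by ext1 i j; exact leftDer_add A B _
  have hsm : ∀ (c : ℂ) (A : Matrix (Fin 3) (Fin 3) ℂ), matLeft (c • A) F = c • matLeft A F :=
    fun c A => by ext1 i j; exact leftDer_smul c A _
  rw [hZYW, hadd, hsm, matEval_add, matEval_smul, infRep_add, infRep_smul,
    key Y (hb hZ).1 (htr ht).1 hY, key W (hb hZ).2 (htr ht).2 hW, add_mul, smul_mul_assoc]

/-- `F(g Z) = N(Z') F(g)` if `Z' g = g Z`. -/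
theorem right_conj (hF : IsMatSpherical n l F) {Z W : Matrix (Fin 3) (Fin 3) ℂ} (hZ : IsBlock Z)
    (ht : Z.trace = 0) {g : SU3} (h : Z * g.1 = g.1 * W) :
    matEval g.1 (matRight W F) = infRep F Z * matEval g.1 F := by
  rw [← matEval_matLeft h, hF.left_block hZ ht]

/-- The identity of `right_block` holds on the whole group, so it can be differentiated once more.
-/
theorem right_right_block (hF : IsMatSpherical n l F) {X Z : Matrix (Fin 3) (Fin 3) ℂ}
    (hX : X.trace = 0) (hZ : IsBlock Z) (ht : Z.trace = 0) (g : SU3) :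
    matEval g.1 (matRight X (matRight Z F)) = matEval g.1 (matRight X F) * infRep F Z := by
  ext i j
  have := evalMat_rightDer_eq_sum (p := rightDer Z (F i j)) (c := fun q => infRep F Z q j)
    (q := fun q => F i q) (fun g => by
      have := congrFun (congrFun (hF.right_block hZ ht g) i) j
      rw [Matrix.mul_apply] at this
      refine this.trans (Finset.sum_congr rfl fun q _ => mul_comm _ _)) hX g
  rw [Matrix.mul_apply]
  exact this.trans (Finset.sum_congr rfl fun q _ => mul_comm _ _)

/-- The left derivative along `Z` commutes with the right derivative along `Y`, so `left_block`
persists after the latter; `Z g = g W` converts the left derivative into a right one. -/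
theorem right_right_conj (hF : IsMatSpherical n l F) {Y Z W : Matrix (Fin 3) (Fin 3) ℂ}
    (hY : Y.trace = 0) (hZ : IsBlock Z) (ht : Z.trace = 0) {g : SU3} (h : Z * g.1 = g.1 * W) :
    matEval g.1 (matRight W (matRight Y F)) = infRep F Z * matEval g.1 (matRight Y F) := by
  rw [← matEval_matLeft h]
  ext i j
  have := evalMat_rightDer_eq_sum (p := leftDer Z (F i j)) (c := fun q => infRep F Z i q)
    (q := fun q => F q j) (fun g => by
      have := congrFun (congrFun (hF.left_block hZ ht g) i) j
      rw [Matrix.mul_apply] at this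
      exact this) hY g
  rw [rightDer_leftDer_comm] at this
  rw [Matrix.mul_apply]
  exact this

theorem infRep_commutator (hF : IsMatSpherical n l F) {Y Z : Matrix (Fin 3) (Fin 3) ℂ}
    (hY : IsBlock Y) (hty : Y.trace = 0) (hZ : IsBlock Z) (ht : Z.trace = 0) :
    infRep F Y * infRep F Z - infRep F Z * infRep F Y = infRep F (Y * Z - Z * Y) := by
  have h1 := hF.right_right_block hty hZ ht 1
  have h2 := hF.right_right_block ht hY hty 1
  have h3 := matEval_commutator (1 : SU3).1 Y Z F
  rw [h1, h2] at h3
  exact h3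

theorem infRep_conj (hF : IsMatSpherical n l F) {Y Z : Matrix (Fin 3) (Fin 3) ℂ}
    (hY : IsBlock Y) (hty : Y.trace = 0) (hZ : IsBlock Z) (ht : Z.trace = 0) {k : SU3}
    (h : Y * k.1 = k.1 * Z) :
    infRep F Y * matEval k.1 F = matEval k.1 F * infRep F Z := by
  rw [← hF.right_block hZ ht, hF.right_conj hY hty h]

/-- Right translation by `k` turns the derivative along `X` into the one along `k X k⁻¹`, and `F(gk)
= F(g)F(k)` is differentiated in `g`. -/
theorem right_translate (hF : IsMatSpherical n l F) {X Y X' Y' : Matrix (Fin 3) (Fin 3) ℂ}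
    {k : SU3} (hk : k ∈ subK) (hX : X' * k.1 = k.1 * X) (hY : Y' * k.1 = k.1 * Y)
    (htX : X'.trace = 0) (htY : Y'.trace = 0) (g : SU3) :
    matEval (g * k).1 (matRight X (matRight Y F))
      = matEval g.1 (matRight X' (matRight Y' F)) * matEval k.1 F := by
  ext i j
  have h0 : ∀ g : SU3, evalMat g.1 (rightTrans k.1 (F i j))
      = ∑ q, matEval k.1 F q j * evalMat g.1 (F i q) := fun g => by
    rw [evalMat_rightTrans]
    have := congrFun (congrFun (hF.map_mul_right g k hk) i) j
    rw [Matrix.mul_apply] at this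
    exact this.trans (Finset.sum_congr rfl fun q _ => mul_comm _ _)
  have h2 := evalMat_rightDer_eq_sum (evalMat_rightDer_eq_sum h0 htY) htX g
  rw [rightDer_rightTrans hY, rightDer_rightTrans hX, evalMat_rightTrans] at h2
  rw [Matrix.mul_apply]
  exact h2.trans (Finset.sum_congr rfl fun q _ => mul_comm _ _)

/-- The functions `θ` for which `θ(1)` reproduces `θ` through the spherical functional equation. -/
def Reproduces (n : ℤ) (F : Matrix (Fin (l + 1)) (Fin (l + 1)) MatPoly)
    (θ : SU3 → Matrix (Fin (l + 1)) (Fin (l + 1)) ℂ) : Prop :=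
  Continuous θ ∧ ∀ x i j, (matEval x.1 F * θ 1) i j
    = ∫ k : subK, chiK n l k⁻¹ * θ (x * k.1) i j ∂haarK

theorem Reproduces.integrable {θ : SU3 → Matrix (Fin (l + 1)) (Fin (l + 1)) ℂ}
    (h : Reproduces n F θ) (x : SU3) (i j : Fin (l + 1)) :
    Integrable (fun k : subK => chiK n l k⁻¹ * θ (x * k.1) i j) haarK :=
  integrable_of_continuous (((continuous_chiK n l).comp continuous_inv).mul
    ((h.1.comp (continuous_const.mul continuous_subtype_val)).matrix_elem i j))

theorem Reproduces.add {θ θ' : SU3 → Matrix (Fin (l + 1)) (Fin (l + 1)) ℂ}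
    (h : Reproduces n F θ) (h' : Reproduces n F θ') : Reproduces n F fun g => θ g + θ' g := by
  refine ⟨h.1.add h'.1, fun x i j => ?_⟩
  rw [mul_add, Matrix.add_apply, h.2, h'.2, ← integral_add (h.integrable x i j)
    (h'.integrable x i j)]
  simp [mul_add]

theorem Reproduces.mul_const {θ : SU3 → Matrix (Fin (l + 1)) (Fin (l + 1)) ℂ}
    (h : Reproduces n F θ) (A : Matrix (Fin (l + 1)) (Fin (l + 1)) ℂ) :
    Reproduces n F fun g => θ g * A := by
  refine ⟨h.1.mul continuous_const, fun x i j => ?_⟩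
  rw [← mul_assoc, Matrix.mul_apply]
  simp only [h.2, ← integral_mul_const, Matrix.mul_apply, Finset.mul_sum]
  rw [← integral_finsetSum]
  · simp only [mul_assoc]
  · intro q _
    exact (h.integrable x i q).mul_const _

/-- The functional equation is differentiated in `y` at `y = 1`. Splitting the entries of `F(zy)` as
`∑ a(z) b(y)` makes the integral a finite sum in `y`, so no interchange of limits is involved. -/
theorem reproduces_right_right (hF : IsMatSpherical n l F) {X Y : Matrix (Fin 3) (Fin 3) ℂ}
    (hX : X.trace = 0) (hY : Y.trace = 0) :
    Reproduces n F fun g => matEval g.1 (matRight X (matRight Y F)) := by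
  refine ⟨continuous_matrix fun i j => (continuous_evalMat _).comp continuous_subtype_val,
    fun x i j => ?_⟩
  obtain ⟨m, a, b, h⟩ := exists_evalMat_mul (F i j)
  have hint : ∀ q, Integrable (fun k : subK => chiK n l k⁻¹ * evalMat (x * k.1).1 (a q)) haarK :=
    fun q => integrable_of_continuous (((continuous_chiK n l).comp continuous_inv).mul
      ((continuous_evalMat _).comp (continuous_subtype_val.comp
        (continuous_const.mul continuous_subtype_val))))
  have hsum : ∀ w : Fin m → ℂ,
      ∑ q, (∫ k : subK, chiK n l k⁻¹ * evalMat (x * k.1).1 (a q) ∂haarK) * w q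
        = ∫ k : subK, chiK n l k⁻¹ * ∑ q, evalMat (x * k.1).1 (a q) * w q ∂haarK := by
    intro w
    simp only [← integral_mul_const, Finset.mul_sum]
    rw [← integral_finsetSum]
    · simp only [mul_assoc]
    · intro q _
      exact (hint q).mul_const _
  have hrel : ∀ y : SU3, evalMat y.1 (∑ q, matEval x.1 F i q • F q j)
      = ∑ q, (∫ k : subK, chiK n l k⁻¹ * evalMat (x * k.1).1 (a q) ∂haarK) *
        evalMat y.1 (b q) := by
    intro y
    rw [hsum]
    have := hF.mul_eq x y i j
    rw [Matrix.mul_apply] at this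
    simp only [← h, map_sum, map_smul, smul_eq_mul]
    exact this
  have h2 := evalMat_rightDer_eq_sum (evalMat_rightDer_eq_sum hrel hY) hX 1
  rw [hsum] at h2
  have h3 : ∀ z : Matrix (Fin 3) (Fin 3) ℂ,
      ∑ q, evalMat z (a q) * evalMat (1 : SU3).1 (rightDer X (rightDer Y (b q)))
        = evalMat z (rightDer X (rightDer Y (F i j))) := by
    intro z
    have := evalMat_mul_rightDer (evalMat_mul_rightDer h Y) X z 1
    rw [mul_one] at this
    exact this.symm
  simp only [h3, map_sum, Derivation.map_smul, map_smul, smul_eq_mul] at h2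
  rw [Matrix.mul_apply]
  exact h2

/-- Schur's lemma: an eigenspace is invariant under `K`, hence everything. -/
theorem exists_scalar_of_commute (hF : IsMatSpherical n l F)
    {A : Matrix (Fin (l + 1)) (Fin (l + 1)) ℂ}
    (h : ∀ k ∈ subK, matEval k.1 F * A = A * matEval k.1 F) : ∃ c : ℂ, A = c • 1 := by
  set a : Module.End ℂ (SymPow l) := Matrix.toLin (weightBasis l) (weightBasis l) A with ha
  have hne : Nontrivial (SymPow l) := ⟨weightVec l 0, 0, weightVec_ne_zero l 0⟩
  obtain ⟨c, hc⟩ := Module.End.exists_eigenvalue a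
  have hcomm : ∀ k ∈ subK, piRep n l (upperBlock k) * a = a * piRep n l (upperBlock k) := by
    intro k hk
    have h1 := h k hk
    rw [hF.map_K k hk, piMat] at h1
    have h2 := congrArg (Matrix.toLin (weightBasis l) (weightBasis l)) h1
    rw [Matrix.toLin_mul _ (weightBasis l), Matrix.toLin_mul _ (weightBasis l),
      Matrix.toLin_toMatrix] at h2
    exact h2
  have htop : Module.End.eigenspace a c = ⊤ := by
    refine (piRep_irreducible n l fun k hk v hv => ?_).resolve_left hc
    rw [Module.End.mem_eigenspace_iff] at hv ⊢
    have := LinearMap.congr_fun (hcomm k hk) v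
    rw [Module.End.mul_apply, Module.End.mul_apply] at this
    rw [← this, hv, map_smul]
  refine ⟨c, ?_⟩
  have hac : a = c • 1 := LinearMap.ext fun v => by
    have : v ∈ Module.End.eigenspace a c := by rw [htop]; trivial
    exact Module.End.mem_eigenspace_iff.mp this
  have h4 := congrArg (LinearMap.toMatrix (weightBasis l) (weightBasis l)) hac
  rw [ha, LinearMap.toMatrix_toLin, map_smul] at h4
  rw [h4]
  congr 1
  exact LinearMap.toMatrix_one _

/-- Since `∫ χ(k⁻¹) F(k) dk = 1`, the reproducing formula collapses to `F(x) θ(1) = θ(x)`. For `x`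
in `K` this shows that `θ(1)` commutes with `F(x)`, so `θ(1)` is scalar. -/
theorem exists_scalar (hF : IsMatSpherical n l F)
    {θ : SU3 → Matrix (Fin (l + 1)) (Fin (l + 1)) ℂ} (h : Reproduces n F θ)
    (hK : ∀ g : SU3, ∀ k ∈ subK, θ (g * k) = θ g * matEval k.1 F) :
    ∃ c : ℂ, ∀ g : SU3, θ g = c • matEval g.1 F := by
  have h1 : ∀ x : SU3, matEval x.1 F * θ 1 = θ x := by
    intro x
    ext i j
    rw [h.2]
    have hint : ∀ q, Integrable (fun k : subK => chiK n l k⁻¹ * matEval k.1.1 F q j) haarK :=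
      fun q => integrable_of_continuous (((continuous_chiK n l).comp continuous_inv).mul
        ((continuous_evalMat _).comp (continuous_subtype_val.comp continuous_subtype_val)))
    have h2 : ∀ q, ∫ k : subK, chiK n l k⁻¹ * matEval k.1.1 F q j ∂haarK
        = (1 : Matrix (Fin (l + 1)) (Fin (l + 1)) ℂ) q j := by
      intro q
      have := hF.mul_eq 1 1 q j
      simp only [one_mul, mul_one] at this
      rw [← this]
      change (matEval 1 F * matEval 1 F) q j = _
      rw [hF.matEval_one, mul_one]
    have h3 : ∀ k : subK, chiK n l k⁻¹ * θ (x * k.1) i j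
        = ∑ q, θ x i q * (chiK n l k⁻¹ * matEval k.1.1 F q j) := by
      intro k
      rw [hK x k.1 k.2, Matrix.mul_apply, Finset.mul_sum]
      exact Finset.sum_congr rfl fun q _ => by ring
    simp only [h3]
    rw [integral_finsetSum _ fun q _ => (hint q).const_mul _]
    simp only [integral_const_mul, h2]
    rw [← Matrix.mul_apply, mul_one]
  obtain ⟨c, hc⟩ := hF.exists_scalar_of_commute (A := θ 1) (fun k hk => by
    rw [h1, ← hK 1 k hk, one_mul])
  exact ⟨c, fun g => by rw [← h1, hc, mul_smul_comm, mul_one]⟩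

end IsMatSpherical

namespace IsMatSpherical

variable {n : ℤ} {l : ℕ} {F : Matrix (Fin (l + 1)) (Fin (l + 1)) MatPoly}

/-! ### The derived representation of `K` -/

/-- The embedding of `2 × 2` matrices as traceless block diagonal matrices. -/
def blockEmb (B : Matrix (Fin 2) (Fin 2) ℂ) : Matrix (Fin 3) (Fin 3) ℂ :=
  !![B 0 0, B 0 1, 0; B 1 0, B 1 1, 0; 0, 0, -(B 0 0 + B 1 1)]

theorem isBlock_blockEmb (B : Matrix (Fin 2) (Fin 2) ℂ) : IsBlock (blockEmb B) := by
  simp [IsBlock, blockEmb]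

theorem trace_blockEmb (B : Matrix (Fin 2) (Fin 2) ℂ) : (blockEmb B).trace = 0 := by
  simp [blockEmb, Matrix.trace, Fin.sum_univ_three]

theorem blockEmb_add (B C : Matrix (Fin 2) (Fin 2) ℂ) :
    blockEmb (B + C) = blockEmb B + blockEmb C := by
  ext i j; fin_cases i <;> fin_cases j <;> simp [blockEmb]; ring

theorem blockEmb_smul (c : ℂ) (B : Matrix (Fin 2) (Fin 2) ℂ) :
    blockEmb (c • B) = c • blockEmb B := by
  ext i j; fin_cases i <;> fin_cases j <;> simp [blockEmb]; ring

theorem blockEmb_commutator (B C : Matrix (Fin 2) (Fin 2) ℂ) :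
    blockEmb B * blockEmb C - blockEmb C * blockEmb B = blockEmb (B * C - C * B) := by
  ext i j
  fin_cases i <;> fin_cases j <;>
    simp [blockEmb, Matrix.mul_apply, Fin.sum_univ_two]
  ring

/-- The derived representation on the `2 × 2` matrices. -/
noncomputable def infBlock (F : Matrix (Fin (l + 1)) (Fin (l + 1)) MatPoly)
    (B : Matrix (Fin 2) (Fin 2) ℂ) : Matrix (Fin (l + 1)) (Fin (l + 1)) ℂ :=
  infRep F (blockEmb B)

theorem infBlock_add (B C : Matrix (Fin 2) (Fin 2) ℂ) :
    infBlock F (B + C) = infBlock F B + infBlock F C := by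
  rw [infBlock, blockEmb_add, infRep_add]; rfl

theorem infBlock_smul (c : ℂ) (B : Matrix (Fin 2) (Fin 2) ℂ) :
    infBlock F (c • B) = c • infBlock F B := by
  rw [infBlock, blockEmb_smul, infRep_smul]; rfl

theorem infBlock_commutator (hF : IsMatSpherical n l F) (B C : Matrix (Fin 2) (Fin 2) ℂ) :
    infBlock F B * infBlock F C - infBlock F C * infBlock F B = infBlock F (B * C - C * B) := by
  rw [infBlock, infBlock, infBlock, ← blockEmb_commutator]
  exact hF.infRep_commutator (isBlock_blockEmb _) (trace_blockEmb _) (isBlock_blockEmb _)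
    (trace_blockEmb _)

theorem piMat_diagSU (n : ℤ) (l : ℕ) (z w : Circle) :
    piMat n l (diagSU z w) = Matrix.diagonal fun i : Fin (l + 1) =>
      ((z : ℂ) * w) ^ n * ((z : ℂ) ^ (l - (i : ℕ)) * (w : ℂ) ^ (i : ℕ)) := by
  ext i j
  rw [piMat, LinearMap.toMatrix_apply, weightBasis_apply, piRep_diagSU, map_smul,
    ← weightBasis_apply, Module.Basis.repr_self, Finsupp.smul_apply, Finsupp.single_apply,
    Matrix.diagonal_apply]
  by_cases h : i = j
  · subst h; simp
  · simp [h, Ne.symm h]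

theorem infBlock_diagonal_I (hF : IsMatSpherical n l F) (x y : ℝ) :
    infBlock F (Matrix.diagonal ![x * Complex.I, y * Complex.I])
      = Matrix.diagonal fun i : Fin (l + 1) =>
        ((x + y) * n + (x * (l - i) + y * i)) * Complex.I := by
  have hc : ∀ x : ℝ, HasDerivAt (fun s : ℝ => ((Circle.exp (x * s) : Circle) : ℂ))
      (x * Complex.I) 0 := by
    intro x
    have h1 : HasDerivAt (fun s : ℝ => ((x * s : ℝ) : ℂ) * Complex.I) (x * Complex.I) 0 := by
      have := ((hasDerivAt_id (0 : ℝ)).const_mul x).ofReal_comp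
      simpa using this.mul_const Complex.I
    have := h1.cexp
    simpa [Circle.coe_exp] using this
  have hγ0 : diagSU (Circle.exp (x * 0)) (Circle.exp (y * 0)) = 1 := by
    apply Subtype.ext
    ext i j
    fin_cases i <;> fin_cases j <;> simp [diagSU]
  have hinv : ∀ s : ℝ, ((Circle.exp (x * s) * Circle.exp (y * s))⁻¹ : Circle)
      = Circle.exp (-(x + y) * s) := by
    intro s
    rw [← Circle.exp_add, ← Circle.exp_neg]
    congr 1; ring
  have hγ : ∀ i j, HasDerivAt (fun s : ℝ => (diagSU (Circle.exp (x * s)) (Circle.exp (y * s))).1 i j)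
      (blockEmb (Matrix.diagonal ![x * Complex.I, y * Complex.I]) i j) 0 := by
    intro i j
    have h3 : HasDerivAt (fun s : ℝ => ((Circle.exp (-(x + y) * s) : Circle) : ℂ))
        (-(x * Complex.I + y * Complex.I)) 0 := by
      convert hc (-(x + y)) using 1
      push_cast
      ring
    fin_cases i <;> fin_cases j <;>
      simp only [diagSU, blockEmb, hinv]
    all_goals first
      | (simpa [-Circle.coe_exp] using hc x)
      | (simpa [-Circle.coe_exp] using hc y)
      | (simpa using hasDerivAt_const (0 : ℝ) (0 : ℂ))
      | exact h3
  ext i j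
  have h1 := hasDerivAt_mul_curve 1 hγ0 hγ (F i j)
  have h2 : ∀ s : ℝ, evalMat (1 * diagSU (Circle.exp (x * s)) (Circle.exp (y * s))).1 (F i j)
      = (if i = j then Complex.exp (((((x + y) * n + (x * (l - i) + y * i) : ℝ) * s : ℝ) : ℂ)
        * Complex.I) else 0) := by
    intro s
    have := congrFun (congrFun (hF.map_K _ (diagSU_mem (Circle.exp (x * s)) (Circle.exp (y * s)))) i) j
    rw [piMat_diagSU, Matrix.diagonal_apply] at this
    rw [one_mul]
    refine this.trans ?_
    split_ifs with hij
    · rw [Circle.coe_exp, Circle.coe_exp, ← Complex.exp_add, ← Complex.exp_int_mul,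
        ← Complex.exp_nat_mul, ← Complex.exp_nat_mul, ← Complex.exp_add, ← Complex.exp_add]
      congr 1
      rw [Nat.cast_sub (Nat.lt_succ_iff.mp i.2)]
      push_cast
      ring
    · rfl
  have h3 : HasDerivAt (fun s : ℝ => (if i = j then
      Complex.exp (((((x + y) * n + (x * (l - i) + y * i) : ℝ) * s : ℝ) : ℂ)
        * Complex.I) else 0)) (if i = j then ((x + y) * n + (x * (l - i) + y * i)) * Complex.I else 0)
      0 := by
    split_ifs
    · have := hc ((x + y) * n + (x * (l - i) + y * i))
      simp only [Circle.coe_exp] at this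
      convert this using 1
      push_cast
      ring
    · exact hasDerivAt_const _ _
  rw [Matrix.diagonal_apply]
  exact h1.unique (h3.congr_of_eventuallyEq (Filter.Eventually.of_forall h2))

theorem infBlock_diagonal (hF : IsMatSpherical n l F) (x y : ℝ) :
    infBlock F (Matrix.diagonal ![(x : ℂ), (y : ℂ)]) = Matrix.diagonal fun i : Fin (l + 1) =>
      ((x + y) * n + (x * (l - i) + y * i) : ℂ) := by
  have : Matrix.diagonal ![(x : ℂ), (y : ℂ)]
      = (-Complex.I) • Matrix.diagonal ![x * Complex.I, y * Complex.I] := by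
    ext i j
    fin_cases i <;> fin_cases j <;> simp [mul_comm, ← mul_assoc Complex.I]
  rw [this, infBlock_smul, hF.infBlock_diagonal_I]
  ext i j
  rw [Matrix.smul_apply, Matrix.diagonal_apply, Matrix.diagonal_apply]
  split_ifs
  · rw [smul_eq_mul]
    linear_combination (-((x + y) * n + (x * (l - i) + y * i)) : ℂ) * Complex.I_mul_I
  · simp

/-- The matrix units of size two. -/
abbrev unit2 (i j : Fin 2) : Matrix (Fin 2) (Fin 2) ℂ := Matrix.single i j 1

theorem infBlock_unit_zero_zero (hF : IsMatSpherical n l F) :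
    infBlock F (unit2 0 0) = Matrix.diagonal fun i : Fin (l + 1) => (n + l - i : ℂ) := by
  have := hF.infBlock_diagonal 1 0
  have h : unit2 0 0 = Matrix.diagonal ![((1 : ℝ) : ℂ), ((0 : ℝ) : ℂ)] := by
    ext i j; fin_cases i <;> fin_cases j <;> simp [unit2, Matrix.single]
  rw [h, this]
  congr 1
  ext i
  push_cast
  ring

theorem infBlock_unit_one_one (hF : IsMatSpherical n l F) :
    infBlock F (unit2 1 1) = Matrix.diagonal fun i : Fin (l + 1) => (n + i : ℂ) := by
  have := hF.infBlock_diagonal 0 1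
  have h : unit2 1 1 = Matrix.diagonal ![((0 : ℝ) : ℂ), ((1 : ℝ) : ℂ)] := by
    ext i j; fin_cases i <;> fin_cases j <;> simp [unit2, Matrix.single]
  rw [h, this]
  congr 1
  ext i
  push_cast
  ring

/-- The image of `unit2 0 0` is diagonal with entries `n + l - i`, so an eigenvector of the bracket
with it can only join weights that differ by `c`. -/
theorem infBlock_weight (hF : IsMatSpherical n l F) {B : Matrix (Fin 2) (Fin 2) ℂ} {c : ℂ}
    (h : unit2 0 0 * B - B * unit2 0 0 = c • B) (i j : Fin (l + 1)) :
    ((j : ℂ) - i - c) * infBlock F B i j = 0 := by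
  have h1 := hF.infBlock_commutator (unit2 0 0) B
  rw [h, infBlock_smul, hF.infBlock_unit_zero_zero] at h1
  have h2 := congrFun (congrFun h1 i) j
  rw [Matrix.sub_apply, Matrix.diagonal_mul, Matrix.mul_diagonal, Matrix.smul_apply,
    smul_eq_mul] at h2
  linear_combination h2

theorem infBlock_unit_zero_one_apply (hF : IsMatSpherical n l F) {i j : Fin (l + 1)}
    (hij : (j : ℕ) ≠ i + 1) : infBlock F (unit2 0 1) i j = 0 := by
  have h : unit2 0 0 * unit2 0 1 - unit2 0 1 * unit2 0 0 = (1 : ℂ) • unit2 0 1 := by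
    ext i j; fin_cases i <;> fin_cases j <;> simp [unit2, Matrix.single, Matrix.mul_apply]
  refine (mul_eq_zero.mp (hF.infBlock_weight h i j)).resolve_left fun h0 => hij ?_
  have : (j : ℂ) = i + 1 := by linear_combination h0
  exact_mod_cast this

theorem infBlock_unit_one_zero_apply (hF : IsMatSpherical n l F) {i j : Fin (l + 1)}
    (hij : (j : ℕ) + 1 ≠ i) : infBlock F (unit2 1 0) i j = 0 := by
  have h : unit2 0 0 * unit2 1 0 - unit2 1 0 * unit2 0 0 = (-1 : ℂ) • unit2 1 0 := by
    ext i j; fin_cases i <;> fin_cases j <;> simp [unit2, Matrix.single, Matrix.mul_apply]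
  refine (mul_eq_zero.mp (hF.infBlock_weight h i j)).resolve_left fun h0 => hij ?_
  have : (j : ℂ) + 1 = i := by linear_combination h0
  exact_mod_cast this

theorem commutator_diag (hF : IsMatSpherical n l F) (i : Fin (l + 1)) :
    ∑ j, infBlock F (unit2 0 1) i j * infBlock F (unit2 1 0) j i
      - ∑ j, infBlock F (unit2 1 0) i j * infBlock F (unit2 0 1) j i = (l : ℂ) - 2 * i := by
  have h1 := hF.infBlock_commutator (unit2 0 1) (unit2 1 0)
  have h : unit2 0 1 * unit2 1 0 - unit2 1 0 * unit2 0 1 = unit2 0 0 + (-1 : ℂ) • unit2 1 1 := by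
    ext i j; fin_cases i <;> fin_cases j <;> simp [unit2, Matrix.single, Matrix.mul_apply]
  rw [h, infBlock_add, infBlock_smul, hF.infBlock_unit_zero_zero, hF.infBlock_unit_one_one] at h1
  have h2 := congrFun (congrFun h1 i) i
  rw [Matrix.sub_apply, Matrix.mul_apply, Matrix.mul_apply, Matrix.add_apply, Matrix.smul_apply,
    Matrix.diagonal_apply_eq, Matrix.diagonal_apply_eq, smul_eq_mul] at h2
  rw [h2]
  ring

/-- The entries of the raising and lowering matrices are never needed separately. The `sl₂` relation
fixes their products `a_i` through `a_{i+1} - a_i = l - 2i` and `a_0 = 0`. -/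
theorem lower_mul_raise (hF : IsMatSpherical n l F) (i j : Fin (l + 1)) :
    infBlock F (unit2 1 0) i j * infBlock F (unit2 0 1) j i
      = if (j : ℕ) + 1 = i then (i : ℂ) * (l - i + 1) else 0 := by
  split_ifs with hij
  swap
  · rw [hF.infBlock_unit_one_zero_apply hij, zero_mul]
  obtain ⟨N, hN⟩ : ∃ N, (j : ℕ) = N := ⟨_, rfl⟩
  induction N using Nat.strong_induction_on generalizing i j with
  | _ N ih =>
    have h1 := hF.commutator_diag j
    rw [Finset.sum_eq_single i] at h1
    rotate_left
    · intro b _ hb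
      rw [hF.infBlock_unit_zero_one_apply, zero_mul]
      intro hb'
      exact hb (Fin.ext (by omega))
    · simp
    have h2 : ∑ b, infBlock F (unit2 1 0) j b * infBlock F (unit2 0 1) b j
        = (j : ℂ) * (l - j + 1) := by
      rcases Nat.eq_zero_or_pos (j : ℕ) with h0 | h0
      · rw [h0, Finset.sum_eq_zero]
        · simp
        · intro b _
          rw [hF.infBlock_unit_one_zero_apply (by omega), zero_mul]
      · have hlt : (j : ℕ) - 1 < l + 1 := by omega
        rw [Finset.sum_eq_single ⟨(j : ℕ) - 1, hlt⟩]
        · exact ih ((j : ℕ) - 1) (by omega) j ⟨(j : ℕ) - 1, hlt⟩ (by simp; omega) rfl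
        · intro b _ hb
          rw [hF.infBlock_unit_one_zero_apply, zero_mul]
          intro hb'
          exact hb (Fin.ext (by simp; omega))
        · simp
    have hi : (i : ℂ) = j + 1 := by exact_mod_cast hij.symm
    rw [h2] at h1
    rw [hi]
    linear_combination h1

theorem raise_mul_lower (hF : IsMatSpherical n l F) (i j : Fin (l + 1)) :
    infBlock F (unit2 0 1) i j * infBlock F (unit2 1 0) j i
      = if (j : ℕ) = i + 1 then ((i : ℂ) + 1) * (l - i) else 0 := by
  rw [mul_comm, hF.lower_mul_raise j i]
  by_cases h : (j : ℕ) = i + 1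
  · rw [if_pos h, if_pos h.symm, h]
    push_cast
    ring
  · rw [if_neg h, if_neg (Ne.symm h)]

/-! ### Two operators that act by scalars -/

/-- The matrix whose third column is `(v, 0)`. -/
def colEmb (v : Fin 2 → ℂ) : Matrix (Fin 3) (Fin 3) ℂ := !![0, 0, v 0; 0, 0, v 1; 0, 0, 0]

/-- The matrix whose third row is `(w, 0)`. -/
def rowEmb (w : Fin 2 → ℂ) : Matrix (Fin 3) (Fin 3) ℂ := !![0, 0, 0; 0, 0, 0; w 0, w 1, 0]

theorem trace_colEmb (v : Fin 2 → ℂ) : (colEmb v).trace = 0 := by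
  simp [colEmb, Matrix.trace, Fin.sum_univ_three]

theorem trace_rowEmb (w : Fin 2 → ℂ) : (rowEmb w).trace = 0 := by
  simp [rowEmb, Matrix.trace, Fin.sum_univ_three]

theorem colEmb_eq (v : Fin 2 → ℂ) :
    colEmb v = v 0 • colEmb (Pi.single 0 1) + v 1 • colEmb (Pi.single 1 1) := by
  ext i j; fin_cases i <;> fin_cases j <;> simp [colEmb]

theorem rowEmb_eq (w : Fin 2 → ℂ) :
    rowEmb w = w 0 • rowEmb (Pi.single 0 1) + w 1 • rowEmb (Pi.single 1 1) := by
  ext i j; fin_cases i <;> fin_cases j <;> simp [rowEmb]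

theorem colEmb_smul (c : ℂ) (v : Fin 2 → ℂ) : colEmb (c • v) = c • colEmb v := by
  ext i j; fin_cases i <;> fin_cases j <;> simp [colEmb]

theorem rowEmb_smul (c : ℂ) (v : Fin 2 → ℂ) : rowEmb (c • v) = c • rowEmb v := by
  ext i j; fin_cases i <;> fin_cases j <;> simp [rowEmb]

/-- The mixed second derivatives of `F`. -/
noncomputable def mixedDer (F : Matrix (Fin (l + 1)) (Fin (l + 1)) MatPoly) (v w : Fin 2 → ℂ)
    (g : SU3) : Matrix (Fin (l + 1)) (Fin (l + 1)) ℂ :=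
  matEval g.1 (matRight (colEmb v) (matRight (rowEmb w) F))

theorem mixedDer_expand (v w : Fin 2 → ℂ) (g : SU3) :
    mixedDer F v w g = ∑ m, ∑ q, (v m * w q) • mixedDer F (Pi.single m 1) (Pi.single q 1) g := by
  simp only [mixedDer, Fin.sum_univ_two]
  rw [colEmb_eq v, rowEmb_eq w]
  simp only [matRight_add, matRight_smul, matRight_add_right, matRight_smul_right, matEval_add,
    matEval_smul]
  module

theorem mixedDer_smul (c d : ℂ) (v w : Fin 2 → ℂ) (g : SU3) :
    mixedDer F (c • v) (d • w) g = (c * d) • mixedDer F v w g := by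
  simp only [mixedDer, colEmb_smul, rowEmb_smul, matRight_smul, matRight_smul_right, matEval_smul,
    smul_smul]
  rw [mul_comm]

theorem apply_two_two_mul_inv {k : SU3} (hk : k ∈ subK) : k.1 2 2 * (k⁻¹).1 2 2 = 1 := by
  have h : k.1 * (k⁻¹).1 = 1 := congrArg Subtype.val (mul_inv_cancel k)
  have h2 := congrFun (congrFun h 2) 2
  obtain ⟨h02, h12, h20, h21⟩ := hk
  simpa [Matrix.mul_apply, Fin.sum_univ_three, h20, h21] using h2

/-- Conjugation by `k` multiplies the column direction by an extra `k₃₃⁻¹` and the row direction by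
`k₃₃`; in the mixed derivative these scalars cancel. -/
theorem mixedDer_translate (hF : IsMatSpherical n l F) {k : SU3} (hk : k ∈ subK) (v w : Fin 2 → ℂ)
    (g : SU3) : mixedDer F v w (g * k)
      = mixedDer F (upperBlock k *ᵥ v) (w ᵥ* upperBlock k⁻¹) g * matEval k.1 F := by
  have hinv : (k⁻¹).1 * k.1 = 1 := congrArg Subtype.val (inv_mul_cancel k)
  have h22 := apply_two_two_mul_inv hk
  have hk' := subK.inv_mem hk
  have e := fun i j => congrFun (congrFun hinv i) j
  have e00 := e 0 0
  have e01 := e 0 1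
  have e10 := e 1 0
  have e11 := e 1 1
  obtain ⟨h02, h12, h20, h21⟩ := hk
  obtain ⟨k02, k12, k20, k21⟩ := hk'
  simp [Matrix.mul_apply, Fin.sum_univ_three, h20, h21] at e00 e01 e10 e11
  have hX : colEmb ((k⁻¹).1 2 2 • (upperBlock k *ᵥ v)) * k.1 = k.1 * colEmb v := by
    ext i j
    fin_cases i <;> fin_cases j <;>
      simp [colEmb, Matrix.mul_apply, Fin.sum_univ_three, upperBlock_apply, h02, h12,
        h20, h21]
    · linear_combination (k.1 0 0 * v 0 + k.1 0 1 * v 1) * h22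
    · linear_combination (k.1 1 0 * v 0 + k.1 1 1 * v 1) * h22
  have hY : rowEmb (k.1 2 2 • (w ᵥ* upperBlock k⁻¹)) * k.1 = k.1 * rowEmb w := by
    ext i j
    fin_cases i <;> fin_cases j <;>
      simp [rowEmb, Matrix.mul_apply, Fin.sum_univ_three, upperBlock_apply, Matrix.vecMul,
        dotProduct, h02, h12, h20, h21, Fin.sum_univ_two]
    · linear_combination (k.1 2 2) * (w 0 * e00 + w 1 * e10)
    · linear_combination (k.1 2 2) * (w 0 * e01 + w 1 * e11)
  have := hF.right_translate ⟨h02, h12, h20, h21⟩ hX hY (trace_colEmb _) (trace_rowEmb _) g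
  change mixedDer F v w (g * k) = mixedDer F _ _ g * _ at this
  rw [this, mixedDer_smul, mul_comm ((k⁻¹).1 2 2), h22, one_smul]

theorem infBlock_conj (hF : IsMatSpherical n l F) {k : SU3} (hk : k ∈ subK)
    (B : Matrix (Fin 2) (Fin 2) ℂ) : matEval k.1 F * infBlock F B
      = infBlock F (upperBlock k * B * upperBlock k⁻¹) * matEval k.1 F := by
  have hinv : upperBlock k⁻¹ * upperBlock k = 1 := by
    rw [← upperBlock_mul_right _ hk, inv_mul_cancel, upperBlock_one]
  refine (hF.infRep_conj (isBlock_blockEmb _) (trace_blockEmb _) (isBlock_blockEmb _)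
    (trace_blockEmb _) ?_).symm
  have h1 : ∀ B : Matrix (Fin 2) (Fin 2) ℂ, blockEmb (upperBlock k * B * upperBlock k⁻¹) * k.1
      = k.1 * blockEmb B := by
    intro B
    have h2 : upperBlock k * B * upperBlock k⁻¹ * upperBlock k = upperBlock k * B := by
      rw [mul_assoc, hinv, mul_one]
    have htr : (upperBlock k * B * upperBlock k⁻¹).trace = B.trace := by
      rw [Matrix.trace_mul_comm, ← mul_assoc, hinv, one_mul]
    set C := upperBlock k * B * upperBlock k⁻¹
    have e := fun i j => congrFun (congrFun h2 i) j
    have e00 := e 0 0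
    have e01 := e 0 1
    have e10 := e 1 0
    have e11 := e 1 1
    obtain ⟨h02, h12, h20, h21⟩ := hk
    simp [Matrix.mul_apply, Fin.sum_univ_two, upperBlock_apply] at e00 e01 e10 e11
    simp [Matrix.trace, Fin.sum_univ_two] at htr
    ext i j
    fin_cases i <;> fin_cases j <;>
      simp [blockEmb, Matrix.mul_apply, Fin.sum_univ_three, h02, h12, h20, h21] <;>
      first | assumption | skip
    linear_combination (-k.1 2 2) * htr
  exact h1 B

/-- The first operator. -/
noncomputable def casimirOne (F : Matrix (Fin (l + 1)) (Fin (l + 1)) MatPoly) (g : SU3) :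
    Matrix (Fin (l + 1)) (Fin (l + 1)) ℂ :=
  ∑ j, mixedDer F (Pi.single j 1) (Pi.single j 1) g

/-- The second operator. -/
noncomputable def casimirTwo (F : Matrix (Fin (l + 1)) (Fin (l + 1)) MatPoly) (g : SU3) :
    Matrix (Fin (l + 1)) (Fin (l + 1)) ℂ :=
  ∑ i, ∑ j, mixedDer F (Pi.single j 1) (Pi.single i 1) g * infBlock F (unit2 i j)

/-- Each pair of factors of `A` and `B` sharing a summed index contracts to a Kronecker delta. -/
theorem contraction {A B : Matrix (Fin 2) (Fin 2) ℂ} (h : A * B = 1)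
    (M : Fin 2 → Fin 2 → Fin 2 → Fin 2 → ℂ) :
    ∑ i, ∑ j, ∑ m, ∑ q, ∑ p, ∑ r, A m j * B i q * (A p i * B j r) * M m q p r
      = ∑ p, ∑ m, M m p p m := by
  have e := fun i j => congrFun (congrFun h i) j
  have e1 : ∀ m r, ∑ j, A m j * B j r = if m = r then 1 else 0 := fun m r => by
    rw [← Matrix.mul_apply, h, Matrix.one_apply]
  have e2 : ∀ p q, ∑ i, A p i * B i q = if p = q then 1 else 0 := fun p q => e1 p q
  have h1 : ∀ m q p r, ∑ i, ∑ j, A m j * B i q * (A p i * B j r) * M m q p r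
      = (if m = r then 1 else 0) * (if p = q then 1 else 0) * M m q p r := by
    intro m q p r
    rw [← e1, ← e2, Finset.sum_mul_sum, Finset.sum_mul, Finset.sum_comm]
    refine Finset.sum_congr rfl fun i _ => ?_
    rw [Finset.sum_mul]
    refine Finset.sum_congr rfl fun j _ => by ring
  calc _ = ∑ m, ∑ q, ∑ p, ∑ r, ∑ i, ∑ j, A m j * B i q * (A p i * B j r) * M m q p r := by
        simp only [Fin.sum_univ_two]; ring
    _ = _ := by
        simp only [h1]
        simp [Fin.sum_univ_two]
        ring

theorem casimirOne_translate (hF : IsMatSpherical n l F) (g : SU3) {k : SU3} (hk : k ∈ subK) :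
    casimirOne F (g * k) = casimirOne F g * matEval k.1 F := by
  have hinv : upperBlock k * upperBlock k⁻¹ = 1 := by
    rw [← upperBlock_mul_left hk, mul_inv_cancel, upperBlock_one]
  have e1 : ∀ m r, ∑ j, upperBlock k m j * upperBlock k⁻¹ j r = if m = r then 1 else 0 :=
    fun m r => by rw [← Matrix.mul_apply, hinv, Matrix.one_apply]
  have h2 : ∀ j, mixedDer F (Pi.single j 1) (Pi.single j 1) (g * k)
      = (∑ m, ∑ q, (upperBlock k m j * upperBlock k⁻¹ j q) •
        mixedDer F (Pi.single m 1) (Pi.single q 1) g) * matEval k.1 F := by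
    intro j
    rw [hF.mixedDer_translate hk, mixedDer_expand]
    simp only [Matrix.mulVec_single_one, Matrix.single_one_vecMul, Matrix.col_apply,
      Matrix.row_apply]
  have h1 : ∀ m q, ∑ j, (upperBlock k m j * upperBlock k⁻¹ j q)
      • mixedDer F (Pi.single m 1) (Pi.single q 1) g
      = if m = q then mixedDer F (Pi.single m 1) (Pi.single q 1) g else 0 := by
    intro m q
    rw [← Finset.sum_smul, e1, ite_smul, one_smul, zero_smul]
  rw [casimirOne, casimirOne, Finset.sum_congr rfl fun j _ => h2 j, ← Finset.sum_mul,
    Finset.sum_comm]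
  congr 1
  refine Finset.sum_congr rfl fun m _ => ?_
  rw [Finset.sum_comm, Finset.sum_congr rfl fun q _ => h1 m q, Finset.sum_ite_eq,
    if_pos (Finset.mem_univ m)]

/-- The indices of the two derivatives and those of `unit2 i j` transform by `A(k)` and its inverse,
so the sum over repeated indices is invariant. -/
theorem casimirTwo_translate (hF : IsMatSpherical n l F) (g : SU3) {k : SU3} (hk : k ∈ subK) :
    casimirTwo F (g * k) = casimirTwo F g * matEval k.1 F := by
  have hinv : upperBlock k * upperBlock k⁻¹ = 1 := by
    rw [← upperBlock_mul_left hk, mul_inv_cancel, upperBlock_one]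
  have hN : ∀ i j, infBlock F (upperBlock k * unit2 i j * upperBlock k⁻¹)
      = ∑ p, ∑ r, (upperBlock k p i * upperBlock k⁻¹ j r) • infBlock F (unit2 p r) := by
    intro i j
    have : upperBlock k * unit2 i j * upperBlock k⁻¹
        = ∑ p, ∑ r, (upperBlock k p i * upperBlock k⁻¹ j r) • unit2 p r := by
      ext a b
      fin_cases i <;> fin_cases j <;> fin_cases a <;> fin_cases b <;>
        simp [unit2, Matrix.single, Matrix.mul_apply, Fin.sum_univ_two]
    rw [this]
    simp only [Fin.sum_univ_two, infBlock_add, infBlock_smul]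
  have h1 : ∀ i j, mixedDer F (Pi.single j 1) (Pi.single i 1) (g * k) * infBlock F (unit2 i j)
      = (∑ m, ∑ q, ∑ p, ∑ r, (upperBlock k m j * upperBlock k⁻¹ i q *
        (upperBlock k p i * upperBlock k⁻¹ j r)) •
        (mixedDer F (Pi.single m 1) (Pi.single q 1) g * infBlock F (unit2 p r)))
        * matEval k.1 F := by
    intro i j
    rw [hF.mixedDer_translate hk, mul_assoc, hF.infBlock_conj hk, ← mul_assoc, hN, mixedDer_expand]
    congr 1
    simp only [Finset.sum_mul, Finset.mul_sum, Matrix.mulVec_single_one,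
      Matrix.single_one_vecMul, Matrix.col_apply, Matrix.row_apply, smul_mul_assoc, mul_smul_comm]
    simp only [Fin.sum_univ_two]
    module
  rw [casimirTwo, casimirTwo]
  simp only [h1, ← Finset.sum_mul]
  congr 1
  ext a b
  have := contraction hinv fun m q p r =>
    (mixedDer F (Pi.single m 1) (Pi.single q 1) g * infBlock F (unit2 p r)) a b
  simp only [Matrix.sum_apply, Matrix.smul_apply, smul_eq_mul]
  exact this

theorem exists_casimirOne_eq (hF : IsMatSpherical n l F) :
    ∃ c : ℂ, ∀ g : SU3, casimirOne F g = c • matEval g.1 F := by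
  refine hF.exists_scalar ?_ fun g k hk => hF.casimirOne_translate g hk
  have : casimirOne F = fun g => mixedDer F (Pi.single 0 1) (Pi.single 0 1) g
      + mixedDer F (Pi.single 1 1) (Pi.single 1 1) g :=
    funext fun g => by rw [casimirOne, Fin.sum_univ_two]
  rw [this]
  exact (hF.reproduces_right_right (trace_colEmb _) (trace_rowEmb _)).add
    (hF.reproduces_right_right (trace_colEmb _) (trace_rowEmb _))

theorem exists_casimirTwo_eq (hF : IsMatSpherical n l F) :
    ∃ c : ℂ, ∀ g : SU3, casimirTwo F g = c • matEval g.1 F := by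
  refine hF.exists_scalar ?_ fun g k hk => hF.casimirTwo_translate g hk
  have h : ∀ i j, Reproduces n F fun g => mixedDer F (Pi.single j 1) (Pi.single i 1) g
      * infBlock F (unit2 i j) := fun i j =>
    (hF.reproduces_right_right (trace_colEmb _) (trace_rowEmb _)).mul_const _
  have : casimirTwo F = fun g =>
      (mixedDer F (Pi.single 0 1) (Pi.single 0 1) g * infBlock F (unit2 0 0)
        + mixedDer F (Pi.single 1 1) (Pi.single 0 1) g * infBlock F (unit2 0 1))
      + (mixedDer F (Pi.single 0 1) (Pi.single 1 1) g * infBlock F (unit2 1 0)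
        + mixedDer F (Pi.single 1 1) (Pi.single 1 1) g * infBlock F (unit2 1 1)) :=
    funext fun g => by simp only [casimirTwo, Fin.sum_univ_two]
  rw [this]
  exact ((h 0 0).add (h 0 1)).add ((h 1 0).add (h 1 1))

end IsMatSpherical

/-! ### Tridiagonal matrices -/

section Tridiagonal

variable {l : ℕ}

/-- The predecessor of an index (the index `0` is its own predecessor). -/
def prevIdx (i : Fin (l + 1)) : Fin (l + 1) := ⟨i - 1, by omega⟩

/-- The successor of an index (the index `l` is its own successor). -/
def nextIdx (i : Fin (l + 1)) : Fin (l + 1) := ⟨min (i + 1) l, by omega⟩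

/-- The clamped predecessor of `0` is harmless, as its coefficient vanishes. -/
theorem sum_prevIdx (i : Fin (l + 1)) {a : ℂ} (ha : (i : ℕ) = 0 → a = 0) (x : Fin (l + 1) → ℂ) :
    ∑ j : Fin (l + 1), (if (j : ℕ) + 1 = i then a else 0) * x j = a * x (prevIdx i) := by
  rcases Nat.eq_zero_or_pos (i : ℕ) with h | h
  · simp [ha h]
  · rw [Finset.sum_eq_single (prevIdx i)]
    · rw [if_pos]
      simp only [prevIdx]; omega
    · intro j _ hj
      rw [if_neg, zero_mul]
      exact fun hji => hj (Fin.ext (by simp only [prevIdx]; omega))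
    · simp

theorem sum_nextIdx (i : Fin (l + 1)) {a : ℂ} (ha : (i : ℕ) = l → a = 0) (x : Fin (l + 1) → ℂ) :
    ∑ j : Fin (l + 1), (if (j : ℕ) = i + 1 then a else 0) * x j = a * x (nextIdx i) := by
  have hi := i.2
  by_cases h : (i : ℕ) = l
  · simp [ha h]
  · rw [Finset.sum_eq_single (nextIdx i)]
    · rw [if_pos]
      simp only [nextIdx]; omega
    · intro j _ hj
      rw [if_neg, zero_mul]
      exact fun hji => hj (Fin.ext (by simp only [nextIdx]; omega))
    · simp

theorem tridiag_mulVec_apply (lo di up : ℕ → ℂ) (hlo : lo 0 = 0) (hup : up l = 0)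
    (x : Fin (l + 1) → ℂ) (i : Fin (l + 1)) :
    (tridiag l lo di up *ᵥ x) i = lo i * x (prevIdx i) + di i * x i + up i * x (nextIdx i) := by
  have h : ∀ j, tridiag l lo di up i j * x j = (if (j : ℕ) + 1 = i then lo i else 0) * x j
      + (if j = i then di i * x i else 0) + (if (j : ℕ) = i + 1 then up i else 0) * x j := by
    intro j
    simp only [tridiag, Matrix.of_apply, Fin.ext_iff]
    by_cases h1 : (j : ℕ) + 1 = i
    · rw [if_pos h1, if_pos h1, if_neg (by omega), if_neg (by omega)]; ring
    · by_cases h2 : (j : ℕ) = i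
      · rw [if_neg h1, if_pos h2, if_neg h1, if_pos h2, if_neg (by omega), Fin.ext h2]; ring
      · rw [if_neg h1, if_neg h2, if_neg h1, if_neg h2]; ring
  rw [Matrix.mulVec, dotProduct, Finset.sum_congr rfl fun j _ => h j, Finset.sum_add_distrib,
    Finset.sum_add_distrib, sum_prevIdx i (fun h => by rw [h, hlo]),
    sum_nextIdx i (fun h => by rw [h, hup]), Finset.sum_ite_eq', if_pos (Finset.mem_univ i)]

end Tridiagonal

namespace IsMatSpherical

variable {n : ℤ} {l : ℕ} {F : Matrix (Fin (l + 1)) (Fin (l + 1)) MatPoly}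

/-! ### Restriction to the one-parameter group `rotA` -/

theorem hasDerivAt_rotA (θ : ℝ) (p : MatPoly) :
    HasDerivAt (fun θ => evalMat (rotA θ).1 p)
      (evalMat (rotA θ).1 (rightDer (colEmb (Pi.single 0 1) - rowEmb (Pi.single 0 1)) p)) θ := by
  refine hasDerivAt_evalMat_right (γ := fun θ => (rotA θ).1) (fun i j => ?_) p
  have hc := (Real.hasDerivAt_cos θ).ofReal_comp
  have hs := (Real.hasDerivAt_sin θ).ofReal_comp
  have hs' := hs.neg
  fin_cases i <;> fin_cases j <;>
    simp [rotA, colEmb, rowEmb, Matrix.mul_apply, Fin.sum_univ_three, -Complex.ofReal_cos,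
      -Complex.ofReal_sin]
  all_goals first
    | exact hasDerivAt_const _ _
    | exact hs
    | exact hs'
    | simpa [-Complex.ofReal_cos, -Complex.ofReal_sin] using hc

theorem block_right (hF : IsMatSpherical n l F) (B : Matrix (Fin 2) (Fin 2) ℂ)
    {Y : Matrix (Fin 3) (Fin 3) ℂ} (hY : Y.trace = 0) (g : SU3) :
    matEval g.1 (matRight (blockEmb B) (matRight Y F))
      = matEval g.1 (matRight Y F) * infBlock F B
        + matEval g.1 (matRight (blockEmb B * Y - Y * blockEmb B) F) := by
  rw [← matEval_commutator, hF.right_right_block hY (isBlock_blockEmb _) (trace_blockEmb _)]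
  exact (add_sub_cancel _ _).symm

/-- As a traceless block matrix this is `diag(1, -2, 1)`, the torus direction that commutes with
`rotA`. It acts on `v_i` by `l - n - 3i`, and these numbers are distinct. -/
theorem diagonal_of_commute (hF : IsMatSpherical n l F)
    {M : Matrix (Fin (l + 1)) (Fin (l + 1)) ℂ}
    (h : infBlock F (Matrix.diagonal ![((1 : ℝ) : ℂ), ((-2 : ℝ) : ℂ)]) * M
      = M * infBlock F (Matrix.diagonal ![((1 : ℝ) : ℂ), ((-2 : ℝ) : ℂ)])) {i j : Fin (l + 1)}
    (hij : i ≠ j) : M i j = 0 := by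
  have h2 := congrFun (congrFun h i) j
  rw [hF.infBlock_diagonal, Matrix.diagonal_mul, Matrix.mul_diagonal] at h2
  have h3 : ((j : ℂ) - i) * M i j = 0 := by
    push_cast at h2
    linear_combination (1 / 3 : ℂ) * h2
  refine (mul_eq_zero.mp h3).resolve_left fun h4 => hij (Fin.ext ?_)
  exact_mod_cast (sub_eq_zero.mp h4).symm

theorem blockEmb_mul_rotA (θ : ℝ) :
    blockEmb (Matrix.diagonal ![((1 : ℝ) : ℂ), ((-2 : ℝ) : ℂ)]) * (rotA θ).1
      = (rotA θ).1 * blockEmb (Matrix.diagonal ![((1 : ℝ) : ℂ), ((-2 : ℝ) : ℂ)]) := by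
  ext i j
  fin_cases i <;> fin_cases j <;>
    simp [rotA, blockEmb, Matrix.mul_apply, Fin.sum_univ_three] <;> ring

theorem rotA_apply_of_ne (hF : IsMatSpherical n l F) (θ : ℝ) {i j : Fin (l + 1)} (hij : i ≠ j) :
    matEval (rotA θ).1 F i j = 0 :=
  hF.diagonal_of_commute (hF.infRep_conj (isBlock_blockEmb _) (trace_blockEmb _)
    (isBlock_blockEmb _) (trace_blockEmb _) (blockEmb_mul_rotA θ)) hij

theorem rotA_right_apply_of_ne (hF : IsMatSpherical n l F) (θ : ℝ)
    {Y : Matrix (Fin 3) (Fin 3) ℂ} (hY : Y.trace = 0)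
    (hcomm : blockEmb (Matrix.diagonal ![((1 : ℝ) : ℂ), ((-2 : ℝ) : ℂ)]) * Y
      = Y * blockEmb (Matrix.diagonal ![((1 : ℝ) : ℂ), ((-2 : ℝ) : ℂ)])) {i j : Fin (l + 1)}
    (hij : i ≠ j) : matEval (rotA θ).1 (matRight Y F) i j = 0 := by
  refine hF.diagonal_of_commute ?_ hij
  have h1 := hF.right_right_conj hY (isBlock_blockEmb _) (trace_blockEmb _) (blockEmb_mul_rotA θ)
  have h0 : matEval (rotA θ).1 (matRight 0 F) = 0 := by
    have := matRight_smul 0 0 F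
    rw [zero_smul, zero_smul] at this
    rw [this]
    ext i j
    exact map_zero (evalMat (rotA θ).1)
  rw [hF.block_right _ hY, hcomm, sub_self, h0, add_zero] at h1
  exact h1.symm

/-- The derivative of `F` in the direction `E₁₃` at `rotA θ`. -/
noncomputable def upDer (F : Matrix (Fin (l + 1)) (Fin (l + 1)) MatPoly) (θ : ℝ) :
    Matrix (Fin (l + 1)) (Fin (l + 1)) ℂ :=
  matEval (rotA θ).1 (matRight (colEmb (Pi.single 0 1)) F)

/-- The derivative of `F` in the direction `E₃₁` at `rotA θ`. -/
noncomputable def downDer (F : Matrix (Fin (l + 1)) (Fin (l + 1)) MatPoly) (θ : ℝ) :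
    Matrix (Fin (l + 1)) (Fin (l + 1)) ℂ :=
  matEval (rotA θ).1 (matRight (rowEmb (Pi.single 0 1)) F)

theorem upDer_apply_of_ne (hF : IsMatSpherical n l F) (θ : ℝ) {i j : Fin (l + 1)} (hij : i ≠ j) :
    upDer F θ i j = 0 := by
  refine hF.rotA_right_apply_of_ne θ (trace_colEmb _) ?_ hij
  ext i j
  fin_cases i <;> fin_cases j <;>
    simp [colEmb, blockEmb, Matrix.mul_apply, Fin.sum_univ_three]
  ring

theorem downDer_apply_of_ne (hF : IsMatSpherical n l F) (θ : ℝ) {i j : Fin (l + 1)} (hij : i ≠ j) :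
    downDer F θ i j = 0 := by
  refine hF.rotA_right_apply_of_ne θ (trace_rowEmb _) ?_ hij
  ext i j
  fin_cases i <;> fin_cases j <;>
    simp [rowEmb, blockEmb, Matrix.mul_apply, Fin.sum_univ_three]
  ring

theorem matRight_sub (X Y : Matrix (Fin 3) (Fin 3) ℂ)
    (P : Matrix (Fin (l + 1)) (Fin (l + 1)) MatPoly) :
    matRight (X - Y) P = matRight X P - matRight Y P := by
  ext1 i j; exact rightDer_sub X Y _

theorem matEval_sub (M : Matrix (Fin 3) (Fin 3) ℂ)
    (P Q : Matrix (Fin (l + 1)) (Fin (l + 1)) MatPoly) :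
    matEval M (P - Q) = matEval M P - matEval M Q := by
  ext1 i j; exact map_sub (evalMat M) _ _

theorem matRight_sub_right (X : Matrix (Fin 3) (Fin 3) ℂ)
    (P Q : Matrix (Fin (l + 1)) (Fin (l + 1)) MatPoly) :
    matRight X (P - Q) = matRight X P - matRight X Q := by
  ext1 i j; exact map_sub (rightDer X) _ _

section Relations

variable (θ : ℝ)

local notation "cs" => ((Real.cos θ : ℝ) : ℂ)
local notation "sn" => ((Real.sin θ : ℝ) : ℂ)

/-- This relation and the next two compute `a⁻¹Za` for `a = rotA θ` and `Z` in the complexified Lie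
algebra of `K`. Each contains a direction transversal to `K` with a coefficient that is nonzero for
`0 < θ < π/2`, so the transversal derivatives can be solved for. -/
theorem raise_mul_rotA : blockEmb (unit2 0 1) * (rotA θ).1
    = (rotA θ).1 * (cs • blockEmb (unit2 0 1) + sn • rowEmb (Pi.single 1 1)) := by
  have h : cs ^ 2 + sn ^ 2 = 1 := by exact_mod_cast Real.cos_sq_add_sin_sq θ
  ext i j
  fin_cases i <;> fin_cases j <;>
    simp [rotA, blockEmb, rowEmb, Matrix.mul_apply, Fin.sum_univ_three,
      -Complex.ofReal_cos, -Complex.ofReal_sin]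
  · linear_combination -h
  · ring

theorem lower_mul_rotA : blockEmb (unit2 1 0) * (rotA θ).1
    = (rotA θ).1 * (cs • blockEmb (unit2 1 0) + sn • colEmb (Pi.single 1 1)) := by
  ext i j
  fin_cases i <;> fin_cases j <;>
    simp [rotA, blockEmb, colEmb, Matrix.mul_apply, Fin.sum_univ_three,
      -Complex.ofReal_cos, -Complex.ofReal_sin]

theorem torus_mul_rotA : blockEmb (unit2 0 0) * (rotA θ).1
    = (rotA θ).1 * ((cs ^ 2 - sn ^ 2) • blockEmb (unit2 0 0)
      + (2 * cs * sn) • (colEmb (Pi.single 0 1) + rowEmb (Pi.single 0 1))) := by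
  have h : cs ^ 2 + sn ^ 2 = 1 := by exact_mod_cast Real.cos_sq_add_sin_sq θ
  ext i j
  fin_cases i <;> fin_cases j <;>
    simp [rotA, blockEmb, rowEmb, colEmb, Matrix.mul_apply, Fin.sum_univ_three,
      -Complex.ofReal_cos, -Complex.ofReal_sin]
  · linear_combination -cs * h
  · linear_combination -sn * h
  · linear_combination -sn * h
  · linear_combination cs * h

theorem smul_row_one_der (hF : IsMatSpherical n l F) :
    sn • matEval (rotA θ).1 (matRight (rowEmb (Pi.single 1 1)) F)
      = infBlock F (unit2 0 1) * matEval (rotA θ).1 F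
        - cs • (matEval (rotA θ).1 F * infBlock F (unit2 0 1)) := by
  have h := hF.right_conj (isBlock_blockEmb _) (trace_blockEmb _) (raise_mul_rotA θ)
  rw [matRight_add, matRight_smul, matRight_smul, matEval_add, matEval_smul, matEval_smul,
    hF.right_block (isBlock_blockEmb _) (trace_blockEmb _)] at h
  rw [infBlock, ← h, add_sub_cancel_left]

theorem smul_up_add_down (hF : IsMatSpherical n l F) :
    (2 * cs * sn) • (upDer F θ + downDer F θ)
      = infBlock F (unit2 0 0) * matEval (rotA θ).1 F
        - (cs ^ 2 - sn ^ 2) • (matEval (rotA θ).1 F * infBlock F (unit2 0 0)) := by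
  have h := hF.right_conj (isBlock_blockEmb _) (trace_blockEmb _) (torus_mul_rotA θ)
  rw [matRight_add, matRight_smul, matRight_smul, matEval_add, matEval_smul, matEval_smul,
    hF.right_block (isBlock_blockEmb _) (trace_blockEmb _), matRight_add, matEval_add] at h
  rw [infBlock, ← h, add_sub_cancel_left]
  rfl

/-- The outer derivative along `E₂₃` comes from `lower_mul_rotA`; the bracket `[E₂₁, E₃₂] = -E₃₁` is
the source of `downDer`. -/
theorem smul_mixedDer_one_one (hF : IsMatSpherical n l F) :
    sn • mixedDer F (Pi.single 1 1) (Pi.single 1 1) (rotA θ)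
      = infBlock F (unit2 1 0) * matEval (rotA θ).1 (matRight (rowEmb (Pi.single 1 1)) F)
        - cs • (matEval (rotA θ).1 (matRight (rowEmb (Pi.single 1 1)) F) * infBlock F (unit2 1 0)
          - downDer F θ) := by
  have h := hF.right_right_conj (trace_rowEmb (Pi.single 1 1)) (isBlock_blockEmb _)
    (trace_blockEmb _) (lower_mul_rotA θ)
  have hc : blockEmb (unit2 1 0) * rowEmb (Pi.single 1 1) - rowEmb (Pi.single 1 1)
      * blockEmb (unit2 1 0) = (-1 : ℂ) • rowEmb (Pi.single 0 1) := by
    ext i j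
    fin_cases i <;> fin_cases j <;>
      simp [blockEmb, rowEmb, Matrix.mul_apply, Fin.sum_univ_three, Matrix.single]
  rw [matRight_add, matRight_smul, matRight_smul, matEval_add, matEval_smul, matEval_smul,
    hF.block_right _ (trace_rowEmb _), hc, matRight_smul, matEval_smul] at h
  change _ = infBlock F (unit2 1 0) * _ at h
  rw [← h, mixedDer, downDer]
  module

theorem smul_mixedDer_one_zero (hF : IsMatSpherical n l F) :
    sn • mixedDer F (Pi.single 1 1) (Pi.single 0 1) (rotA θ)
      = infBlock F (unit2 1 0) * downDer F θ - cs • (downDer F θ * infBlock F (unit2 1 0)) := by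
  have h := hF.right_right_conj (trace_rowEmb (Pi.single 0 1)) (isBlock_blockEmb _)
    (trace_blockEmb _) (lower_mul_rotA θ)
  have hc : blockEmb (unit2 1 0) * rowEmb (Pi.single 0 1) - rowEmb (Pi.single 0 1)
      * blockEmb (unit2 1 0) = (0 : ℂ) • rowEmb (Pi.single 0 1) := by
    ext i j
    fin_cases i <;> fin_cases j <;>
      simp [blockEmb, rowEmb, Matrix.mul_apply, Fin.sum_univ_three, Matrix.single]
  rw [matRight_add, matRight_smul, matRight_smul, matEval_add, matEval_smul, matEval_smul,
    hF.block_right _ (trace_rowEmb _), hc, matRight_smul, matEval_smul, zero_smul, add_zero] at h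
  change _ = infBlock F (unit2 1 0) * _ at h
  rw [mixedDer, downDer, ← h]
  module

/-- Conjugation yields the two derivatives in the opposite order; exchanging them costs `[E₁₃, E₃₂]
= E₁₂`, the last term. -/
theorem smul_mixedDer_zero_one (hF : IsMatSpherical n l F) :
    sn • mixedDer F (Pi.single 0 1) (Pi.single 1 1) (rotA θ)
      = infBlock F (unit2 0 1) * upDer F θ - cs • (upDer F θ * infBlock F (unit2 0 1))
        + sn • (matEval (rotA θ).1 F * infBlock F (unit2 0 1)) := by
  have h := hF.right_right_conj (trace_colEmb (Pi.single 0 1)) (isBlock_blockEmb _)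
    (trace_blockEmb _) (raise_mul_rotA θ)
  have hc : blockEmb (unit2 0 1) * colEmb (Pi.single 0 1) - colEmb (Pi.single 0 1)
      * blockEmb (unit2 0 1) = (0 : ℂ) • colEmb (Pi.single 0 1) := by
    ext i j
    fin_cases i <;> fin_cases j <;>
      simp [blockEmb, colEmb, Matrix.mul_apply, Fin.sum_univ_three, Matrix.single]
  have hd : colEmb (Pi.single 0 1) * rowEmb (Pi.single 1 1)
      - rowEmb (Pi.single 1 1) * colEmb (Pi.single 0 1) = blockEmb (unit2 0 1) := by
    ext i j
    fin_cases i <;> fin_cases j <;>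
      simp [blockEmb, colEmb, rowEmb, Matrix.mul_apply, Fin.sum_univ_three, Matrix.single]
  have h2 := matEval_commutator (rotA θ).1 (colEmb (Pi.single 0 1)) (rowEmb (Pi.single 1 1)) F
  rw [hd, hF.right_block (isBlock_blockEmb _) (trace_blockEmb _)] at h2
  rw [matRight_add, matRight_smul, matRight_smul, matEval_add, matEval_smul, matEval_smul,
    hF.block_right _ (trace_colEmb _), hc, matRight_smul, matEval_smul, zero_smul, add_zero] at h
  change _ = infBlock F (unit2 0 1) * _ at h
  change _ = _ * infBlock F (unit2 0 1) at h2
  rw [mixedDer, upDer, ← h, ← h2]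
  module

/-- For `X = E₁₃`, `Y = E₃₁` one has `4XY = (X + Y)² - (X - Y)² + 2[X, Y]`. The first square comes
from `torus_mul_rotA`, the second is the second `θ`-derivative, and the bracket is block diagonal.
-/
theorem smul_mixedDer_zero_zero (hF : IsMatSpherical n l F) :
    (8 * cs * sn) • mixedDer F (Pi.single 0 1) (Pi.single 0 1) (rotA θ)
      = infBlock F (unit2 0 0) * (upDer F θ + downDer F θ)
        - (cs ^ 2 - sn ^ 2) • ((upDer F θ + downDer F θ) * infBlock F (unit2 0 0)
          + (2 : ℂ) • (upDer F θ - downDer F θ))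
        - (2 * cs * sn) • matEval (rotA θ).1
          (matRight (colEmb (Pi.single 0 1) - rowEmb (Pi.single 0 1))
            (matRight (colEmb (Pi.single 0 1) - rowEmb (Pi.single 0 1)) F))
        + (4 * cs * sn) • (matEval (rotA θ).1 F * infBlock F (unit2 0 0)) := by
  have ht : (colEmb (Pi.single 0 1) + rowEmb (Pi.single 0 1)).trace = 0 := by
    rw [Matrix.trace_add, trace_colEmb, trace_rowEmb, add_zero]
  have h := hF.right_right_conj ht (isBlock_blockEmb _) (trace_blockEmb _) (torus_mul_rotA θ)
  have hc : blockEmb (unit2 0 0) * (colEmb (Pi.single 0 1) + rowEmb (Pi.single 0 1))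
      - (colEmb (Pi.single 0 1) + rowEmb (Pi.single 0 1)) * blockEmb (unit2 0 0)
      = (2 : ℂ) • (colEmb (Pi.single 0 1) - rowEmb (Pi.single 0 1)) := by
    ext i j
    fin_cases i <;> fin_cases j <;>
      simp [blockEmb, colEmb, rowEmb, Matrix.mul_apply, Fin.sum_univ_three, Matrix.single] <;>
      norm_num
  have hd : colEmb (Pi.single 0 1) * rowEmb (Pi.single 0 1)
      - rowEmb (Pi.single 0 1) * colEmb (Pi.single 0 1) = blockEmb (unit2 0 0) := by
    ext i j
    fin_cases i <;> fin_cases j <;>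
      simp [blockEmb, colEmb, rowEmb, Matrix.mul_apply, Fin.sum_univ_three, Matrix.single]
  have h2 := matEval_commutator (rotA θ).1 (colEmb (Pi.single 0 1)) (rowEmb (Pi.single 0 1)) F
  rw [hd, hF.right_block (isBlock_blockEmb _) (trace_blockEmb _)] at h2
  rw [matRight_add, matRight_smul, matRight_smul, matEval_add, matEval_smul, matEval_smul,
    hF.block_right _ ht, hc, matRight_smul, matEval_smul] at h
  change _ = infBlock F (unit2 0 0) * _ at h
  change _ = _ * infBlock F (unit2 0 0) at h2
  simp only [matRight_add, matRight_sub, matRight_add_right, matRight_sub_right, matEval_add,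
    matEval_sub] at h ⊢
  rw [mixedDer, upDer, downDer, ← h, ← h2]
  module

end Relations

end IsMatSpherical

namespace IsMatSpherical

variable {n : ℤ} {l : ℕ} {F : Matrix (Fin (l + 1)) (Fin (l + 1)) MatPoly}

/-! ### The diagonal entries on the group `rotA` -/

theorem lower_diagonal_raise (hF : IsMatSpherical n l F) (d : Fin (l + 1) → ℂ) (i : Fin (l + 1)) :
    (infBlock F (unit2 1 0) * Matrix.diagonal d * infBlock F (unit2 0 1)) i i
      = (i : ℂ) * (l - i + 1) * d (prevIdx i) := by
  rw [Matrix.mul_apply, ← sum_prevIdx i (a := (i : ℂ) * (l - i + 1)) (fun h => by simp [h]) d]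
  refine Finset.sum_congr rfl fun j _ => ?_
  rw [Matrix.mul_diagonal, ← hF.lower_mul_raise i j]
  ring

theorem raise_diagonal_lower (hF : IsMatSpherical n l F) (d : Fin (l + 1) → ℂ) (i : Fin (l + 1)) :
    (infBlock F (unit2 0 1) * Matrix.diagonal d * infBlock F (unit2 1 0)) i i
      = ((i : ℂ) + 1) * (l - i) * d (nextIdx i) := by
  rw [Matrix.mul_apply, ← sum_nextIdx i (a := ((i : ℂ) + 1) * (l - i)) (fun h => by simp [h]) d]
  refine Finset.sum_congr rfl fun j _ => ?_
  rw [Matrix.mul_diagonal, ← hF.raise_mul_lower i j]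
  ring

theorem lower_raise_apply (hF : IsMatSpherical n l F) (i : Fin (l + 1)) :
    (infBlock F (unit2 1 0) * infBlock F (unit2 0 1)) i i = (i : ℂ) * (l - i + 1) := by
  have := hF.lower_diagonal_raise (fun _ => 1) i
  rwa [Matrix.diagonal_one, mul_one, mul_one] at this

theorem raise_lower_apply (hF : IsMatSpherical n l F) (i : Fin (l + 1)) :
    (infBlock F (unit2 0 1) * infBlock F (unit2 1 0)) i i = ((i : ℂ) + 1) * (l - i) := by
  have := hF.raise_diagonal_lower (fun _ => 1) i
  rwa [Matrix.diagonal_one, mul_one, mul_one] at this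

theorem eq_diagonal_of_apply_ne {M : Matrix (Fin (l + 1)) (Fin (l + 1)) ℂ}
    (h : ∀ {i j}, i ≠ j → M i j = 0) : M = Matrix.diagonal fun i => M i i := by
  ext i j
  rw [Matrix.diagonal_apply]
  split_ifs with hij
  · rw [hij]
  · exact h hij

section Entries

variable (θ : ℝ)

local notation "cs" => ((Real.cos θ : ℝ) : ℂ)
local notation "sn" => ((Real.sin θ : ℝ) : ℂ)

theorem up_add_down_entry (hF : IsMatSpherical n l F) (i : Fin (l + 1)) :
    2 * cs * sn * (upDer F θ i i + downDer F θ i i)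
      = 2 * sn ^ 2 * ((n + l - i) * matEval (rotA θ).1 F i i) := by
  have h : cs ^ 2 + sn ^ 2 = 1 := by exact_mod_cast Real.cos_sq_add_sin_sq θ
  have h1 := congrFun (congrFun (hF.smul_up_add_down θ) i) i
  rw [hF.infBlock_unit_zero_zero, Matrix.smul_apply, Matrix.add_apply, Matrix.sub_apply,
    Matrix.smul_apply, Matrix.diagonal_mul, Matrix.mul_diagonal, smul_eq_mul, smul_eq_mul] at h1
  linear_combination h1 - (n + l - i) * matEval (rotA θ).1 F i i * h

/-- A second factor `sin θ` lets `smul_row_one_der` eliminate the remaining first derivative; this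
brings in the neighbouring diagonal entries. -/
theorem mixedDer_one_one_entry (hF : IsMatSpherical n l F) (i : Fin (l + 1)) :
    sn ^ 2 * mixedDer F (Pi.single 1 1) (Pi.single 1 1) (rotA θ) i i
      = (i : ℂ) * (l - i + 1) * (matEval (rotA θ).1 F i i
          - cs * matEval (rotA θ).1 F (prevIdx i) (prevIdx i))
        - cs * (((i : ℂ) + 1) * (l - i)) * (matEval (rotA θ).1 F (nextIdx i) (nextIdx i)
          - cs * matEval (rotA θ).1 F i i) + cs * sn * downDer F θ i i := by
  have h := congrArg (fun M => sn • M) (hF.smul_mixedDer_one_one θ)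
  rw [smul_sub, ← mul_smul_comm, smul_comm sn cs, smul_sub, ← smul_mul_assoc,
    hF.smul_row_one_der θ, eq_diagonal_of_apply_ne (hF.rotA_apply_of_ne θ)] at h
  have h1 := Matrix.ext_iff.mpr h i i
  simp only [mul_sub, sub_mul, mul_smul_comm, smul_mul_assoc, ← mul_assoc, Matrix.sub_apply,
    Matrix.smul_apply, smul_eq_mul, Matrix.mul_diagonal, hF.lower_raise_apply,
    hF.lower_diagonal_raise, hF.raise_diagonal_lower] at h1
  rw [mul_assoc (Matrix.diagonal _), Matrix.diagonal_mul, hF.raise_lower_apply] at h1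
  linear_combination h1

theorem mixedDer_one_zero_entry (hF : IsMatSpherical n l F) (i : Fin (l + 1)) :
    sn * (mixedDer F (Pi.single 1 1) (Pi.single 0 1) (rotA θ) * infBlock F (unit2 0 1)) i i
      = (i : ℂ) * (l - i + 1) * (downDer F θ (prevIdx i) (prevIdx i)
          - cs * downDer F θ i i) := by
  have h := congrArg (fun M => M * infBlock F (unit2 0 1)) (hF.smul_mixedDer_one_zero θ)
  rw [eq_diagonal_of_apply_ne (hF.downDer_apply_of_ne θ)] at h
  have h1 := Matrix.ext_iff.mpr h i i
  simp only [sub_mul, smul_mul_assoc, Matrix.sub_apply, Matrix.smul_apply, smul_eq_mul,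
    hF.lower_diagonal_raise] at h1
  rw [mul_assoc (Matrix.diagonal _), Matrix.diagonal_mul, hF.lower_raise_apply] at h1
  linear_combination h1

theorem mixedDer_zero_one_entry (hF : IsMatSpherical n l F) (i : Fin (l + 1)) :
    sn * (mixedDer F (Pi.single 0 1) (Pi.single 1 1) (rotA θ) * infBlock F (unit2 1 0)) i i
      = ((i : ℂ) + 1) * (l - i) * (upDer F θ (nextIdx i) (nextIdx i)
          - cs * upDer F θ i i + sn * matEval (rotA θ).1 F i i) := by
  have h := congrArg (fun M => M * infBlock F (unit2 1 0)) (hF.smul_mixedDer_zero_one θ)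
  rw [eq_diagonal_of_apply_ne (hF.upDer_apply_of_ne θ),
    eq_diagonal_of_apply_ne (hF.rotA_apply_of_ne θ)] at h
  have h1 := Matrix.ext_iff.mpr h i i
  simp only [sub_mul, add_mul, smul_mul_assoc, Matrix.sub_apply, Matrix.add_apply,
    Matrix.smul_apply, smul_eq_mul, hF.raise_diagonal_lower] at h1
  rw [mul_assoc (Matrix.diagonal _), mul_assoc (Matrix.diagonal _), Matrix.diagonal_mul,
    Matrix.diagonal_mul, hF.raise_lower_apply] at h1
  linear_combination h1

theorem mixedDer_zero_zero_entry (hF : IsMatSpherical n l F) (i : Fin (l + 1)) :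
    8 * cs * sn * mixedDer F (Pi.single 0 1) (Pi.single 0 1) (rotA θ) i i
      = 2 * sn ^ 2 * ((n + l - i) * (upDer F θ i i + downDer F θ i i))
        - 2 * (cs ^ 2 - sn ^ 2) * (upDer F θ i i - downDer F θ i i)
        - 2 * cs * sn * matEval (rotA θ).1
          (matRight (colEmb (Pi.single 0 1) - rowEmb (Pi.single 0 1))
            (matRight (colEmb (Pi.single 0 1) - rowEmb (Pi.single 0 1)) F)) i i
        + 4 * cs * sn * ((n + l - i) * matEval (rotA θ).1 F i i) := by
  have h : cs ^ 2 + sn ^ 2 = 1 := by exact_mod_cast Real.cos_sq_add_sin_sq θ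
  have h1 := congrFun (congrFun (hF.smul_mixedDer_zero_zero θ) i) i
  simp only [hF.infBlock_unit_zero_zero, Matrix.sub_apply, Matrix.add_apply, Matrix.smul_apply,
    smul_eq_mul, Matrix.diagonal_mul, Matrix.mul_diagonal] at h1
  linear_combination h1 - (n + l - i) * (upDer F θ i i + downDer F θ i i) * h

theorem casimirOne_entry {c : ℂ} (hc : ∀ g : SU3, casimirOne F g = c • matEval g.1 F)
    (i : Fin (l + 1)) :
    mixedDer F (Pi.single 0 1) (Pi.single 0 1) (rotA θ) i i
      + mixedDer F (Pi.single 1 1) (Pi.single 1 1) (rotA θ) i i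
      = c * matEval (rotA θ).1 F i i := by
  have := congrFun (congrFun (hc (rotA θ)) i) i
  rwa [casimirOne, Fin.sum_univ_two] at this

theorem casimirTwo_entry (hF : IsMatSpherical n l F) {c : ℂ}
    (hc : ∀ g : SU3, casimirTwo F g = c • matEval g.1 F) (i : Fin (l + 1)) :
    mixedDer F (Pi.single 0 1) (Pi.single 0 1) (rotA θ) i i * (n + l - i)
      + (mixedDer F (Pi.single 1 1) (Pi.single 0 1) (rotA θ) * infBlock F (unit2 0 1)) i i
      + (mixedDer F (Pi.single 0 1) (Pi.single 1 1) (rotA θ) * infBlock F (unit2 1 0)) i i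
      + mixedDer F (Pi.single 1 1) (Pi.single 1 1) (rotA θ) i i * (n + i)
      = c * matEval (rotA θ).1 F i i := by
  have := congrFun (congrFun (hc (rotA θ)) i) i
  simp only [casimirTwo, Fin.sum_univ_two, Matrix.add_apply, hF.infBlock_unit_zero_zero,
    hF.infBlock_unit_one_one, Matrix.mul_diagonal, Matrix.smul_apply, smul_eq_mul] at this
  linear_combination this

theorem hasDerivAt_rotA_entry (i : Fin (l + 1)) :
    HasDerivAt (fun θ => matEval (rotA θ).1 F i i) (upDer F θ i i - downDer F θ i i) θ := by
  have h := hasDerivAt_rotA θ (F i i)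
  rw [rightDer_sub, map_sub] at h
  exact h

theorem hasDerivAt_up_sub_down (i : Fin (l + 1)) :
    HasDerivAt (fun θ => upDer F θ i i - downDer F θ i i)
      (matEval (rotA θ).1 (matRight (colEmb (Pi.single 0 1) - rowEmb (Pi.single 0 1))
        (matRight (colEmb (Pi.single 0 1) - rowEmb (Pi.single 0 1)) F)) i i) θ := by
  have h := hasDerivAt_rotA θ (rightDer (colEmb (Pi.single 0 1) - rowEmb (Pi.single 0 1)) (F i i))
  refine h.congr_of_eventuallyEq (Filter.Eventually.of_forall fun θ => ?_)
  change _ = evalMat (rotA θ).1 (rightDer _ (F i i))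
  rw [rightDer_sub, map_sub]
  rfl

end Entries

/-! ### The change of variable `t = cos² θ` -/

theorem hasDerivAt_cos_zpow_mul_eval (m : ℤ) (p : Polynomial ℂ) {θ : ℝ} (hθ : Real.cos θ ≠ 0) :
    HasDerivAt (fun θ : ℝ => ((Real.cos θ : ℝ) : ℂ) ^ m * p.eval (((Real.cos θ : ℝ) : ℂ) ^ 2))
      (-((Real.sin θ : ℝ) : ℂ) * ((Real.cos θ : ℝ) : ℂ) ^ m *
        (m / ((Real.cos θ : ℝ) : ℂ) * p.eval (((Real.cos θ : ℝ) : ℂ) ^ 2)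
          + 2 * ((Real.cos θ : ℝ) : ℂ) * p.derivative.eval (((Real.cos θ : ℝ) : ℂ) ^ 2))) θ := by
  have hc := (Real.hasDerivAt_cos θ).ofReal_comp
  have h0 : ((Real.cos θ : ℝ) : ℂ) ≠ 0 := by exact_mod_cast hθ
  have h1 := (hasDerivAt_zpow m ((Real.cos θ : ℝ) : ℂ) (Or.inl h0)).comp θ hc
  have h2 := (p.hasDerivAt (((Real.cos θ : ℝ) : ℂ) ^ 2)).comp θ (hc.fun_pow 2)
  refine (h1.mul h2).congr_deriv ?_
  simp only [Function.comp_apply]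
  rw [zpow_sub_one₀ h0]
  push_cast
  field_simp
  ring

/-- An identity of rational functions with `c = cos θ`, `w = sin² θ`, `C = cos^m θ`, `m = n + l -
i`; the letters `h`, `hm`, `hp` stand for the entries `i`, `i - 1`, `i + 1`, and a digit counts
derivatives in `t`. Up to constants, `D` is minus the first operator, and `E` is three times the
second minus `4n + 2l` times the first. -/
theorem radial_algebra {c w C n l i h h1 h2 hm hm1 hp hp1 c1 c2 : ℂ}
    {M00 M11 T1 T2 : ℂ} (hc : c ≠ 0) (hw : w ≠ 0) (hC : C ≠ 0) (hcw : w = 1 - c ^ 2)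
    (e00 : 8 * c * M00 = 2 * w * ((n + l - i) * (C * (n + l - i) / c * h))
      - 2 * (c ^ 2 - w) * (-C * ((n + l - i) / c * h + 2 * c * h1))
      - 2 * c * (C * ((n + l - i) * (n + l - i - 1) * w / c ^ 2 * h - (n + l - i) * h
        + 2 * (n + l - i) * w * h1 - 2 * c ^ 2 * h1 + 2 * (n + l - i + 1) * w * h1
        + 4 * w * c ^ 2 * h2)) + 4 * c * ((n + l - i) * (C * h)))
    (e11 : w * M11 = i * (l - i + 1) * (C * h - c * (C * c * hm))
      - c * ((i + 1) * (l - i)) * (C / c * hp - c * (C * h))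
      + c * w * (C * ((n + l - i) / c * h + c * h1)))
    (e1 : T1 = i * (l - i + 1) * (C * ((n + l - i + 1) * hm + c ^ 2 * hm1)
      - c * (C * ((n + l - i) / c * h + c * h1))))
    (e2 : T2 = (i + 1) * (l - i) * (-C * hp1 + c * (C * c * h1) + C * h))
    (s1 : M00 + M11 = c1 * (C * h))
    (s2 : M00 * (n + l - i) + T1 + T2 + M11 * (n + i) = c2 * (C * h)) :
    c ^ 2 * w * h2 + ((n + l - i + 1) - c ^ 2 * (n + l - i + 3)) * h1
      + w⁻¹ * ((i + 1) * (l - i) * (hp - h) - c ^ 2 * (i * (l - i + 1) * (h - hm)))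
      = (-c1 + 2 * n + l) * h ∧
    c ^ 2 * w * ((n - l + 3 * i) * h2)
      + ((n - l + 3 * i) * (n + l - i + 1) * h1 - 3 * ((i + 1) * (l - i)) * hp1
        - c ^ 2 * ((n - l + 3 * i) * (n + l - i + 3) * h1 - 3 * (i * (l - i + 1)) * hm1))
      + w⁻¹ * ((n + 2 * l - 3 * i) * ((i + 1) * (l - i)) * (hp - h)
        - 3 * (n + l - i + 1) * (i * (l - i + 1)) * (h - hm)
        + c ^ 2 * ((2 * n + l + 3) * (i * (l - i + 1)) * (h - hm)))
      = (3 * c2 - (4 * n + 2 * l) * c1 + (2 * n ^ 2 + 2 * n * l - l ^ 2 - 3 * l)) * h := by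
  have f00 := (eq_div_iff (mul_ne_zero (by norm_num : (8 : ℂ) ≠ 0) hc)).mpr
    ((mul_comm _ _).trans e00)
  have f11 := (eq_div_iff hw).mpr ((mul_comm _ _).trans e11)
  subst hcw
  constructor
  · apply mul_left_cancel₀ hC
    have : C * ((-c1 + 2 * n + l) * h) = -(M00 + M11) + C * (2 * n + l) * h := by rw [s1]; ring
    rw [this, f00, f11]
    field_simp
    ring
  · apply mul_left_cancel₀ hC
    have : C * ((3 * c2 - (4 * n + 2 * l) * c1 + (2 * n ^ 2 + 2 * n * l - l ^ 2 - 3 * l)) * h)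
        = 3 * (M00 * (n + l - i) + T1 + T2 + M11 * (n + i)) - (4 * n + 2 * l) * (M00 + M11)
          + C * (2 * n ^ 2 + 2 * n * l - l ^ 2 - 3 * l) * h := by rw [s1, s2]; ring
    rw [this, f00, f11, e1, e2]
    field_simp
    ring

end IsMatSpherical

namespace IsMatSpherical

variable {n : ℤ} {l : ℕ} {F : Matrix (Fin (l + 1)) (Fin (l + 1)) MatPoly}

/-! ### The radial form and the equations it satisfies. -/

/-- On the group `rotA` the diagonal entries are `cos^m(θ) p_i(cos² θ)`, `m = n + l - i`. -/
def HasRadialForm (n : ℤ) {l : ℕ} (F : Matrix (Fin (l + 1)) (Fin (l + 1)) MatPoly)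
    (p : Fin (l + 1) → Polynomial ℂ) : Prop :=
  ∀ θ ∈ Set.Ioo (0 : ℝ) (Real.pi / 2), ∀ i, matEval (rotA θ).1 F i i
    = ((Real.cos θ : ℝ) : ℂ) ^ (n + l - (i : ℕ) : ℤ) * (p i).eval (((Real.cos θ : ℝ) : ℂ) ^ 2)

theorem cos_ne_zero_of_mem_Ioo {θ : ℝ} (hθ : θ ∈ Set.Ioo (0 : ℝ) (Real.pi / 2)) :
    Real.cos θ ≠ 0 :=
  (Real.cos_pos_of_mem_Ioo ⟨by linarith [hθ.1, Real.pi_pos], hθ.2⟩).ne'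

theorem sin_ne_zero_of_mem_Ioo {θ : ℝ} (hθ : θ ∈ Set.Ioo (0 : ℝ) (Real.pi / 2)) :
    Real.sin θ ≠ 0 :=
  (Real.sin_pos_of_mem_Ioo ⟨hθ.1, by linarith [hθ.2, Real.pi_pos]⟩).ne'

section

variable {p : Fin (l + 1) → Polynomial ℂ} {θ : ℝ}

local notation "cs" => ((Real.cos θ : ℝ) : ℂ)
local notation "sn" => ((Real.sin θ : ℝ) : ℂ)

theorem HasRadialForm.up_sub_down (hp : HasRadialForm n F p)
    (hθ : θ ∈ Set.Ioo (0 : ℝ) (Real.pi / 2)) (i : Fin (l + 1)) :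
    upDer F θ i i - downDer F θ i i = -sn * cs ^ (n + l - (i : ℕ) : ℤ) *
      ((n + l - i) / cs * (p i).eval (cs ^ 2) + 2 * cs * (p i).derivative.eval (cs ^ 2)) := by
  have h1 := hasDerivAt_cos_zpow_mul_eval (n + l - (i : ℕ) : ℤ) (p i) (cos_ne_zero_of_mem_Ioo hθ)
  have h2 := (hasDerivAt_rotA_entry (F := F) θ i).unique (h1.congr_of_eventuallyEq
    (by filter_upwards [isOpen_Ioo.mem_nhds hθ] with x hx using hp x hx i))
  rw [h2]
  push_cast
  ring

theorem HasRadialForm.second_der (hp : HasRadialForm n F p)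
    (hθ : θ ∈ Set.Ioo (0 : ℝ) (Real.pi / 2)) (i : Fin (l + 1)) :
    matEval (rotA θ).1 (matRight (colEmb (Pi.single 0 1) - rowEmb (Pi.single 0 1))
        (matRight (colEmb (Pi.single 0 1) - rowEmb (Pi.single 0 1)) F)) i i
      = cs ^ (n + l - (i : ℕ) : ℤ) * ((n + l - i) * (n + l - i - 1) * sn ^ 2 / cs ^ 2
          * (p i).eval (cs ^ 2) - (n + l - i) * (p i).eval (cs ^ 2)
        + 2 * (n + l - i) * sn ^ 2 * (p i).derivative.eval (cs ^ 2)
        - 2 * cs ^ 2 * (p i).derivative.eval (cs ^ 2)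
        + 2 * (n + l - i + 1) * sn ^ 2 * (p i).derivative.eval (cs ^ 2)
        + 4 * sn ^ 2 * cs ^ 2 * (p i).derivative.derivative.eval (cs ^ 2)) := by
  have hc := cos_ne_zero_of_mem_Ioo hθ
  have h0 : cs ≠ 0 := by exact_mod_cast hc
  have h1 := hasDerivAt_cos_zpow_mul_eval (n + l - (i : ℕ) - 1 : ℤ) (p i) hc
  have h2 := hasDerivAt_cos_zpow_mul_eval (n + l - (i : ℕ) + 1 : ℤ) (p i).derivative hc
  have hs := (Real.hasDerivAt_sin θ).ofReal_comp.fun_neg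
  have h3 := hs.fun_mul ((h1.const_mul (n + l - i : ℂ)).fun_add (h2.const_mul 2))
  have h4 := (hasDerivAt_up_sub_down (F := F) θ i).unique (h3.congr_of_eventuallyEq (by
    filter_upwards [isOpen_Ioo.mem_nhds hθ] with x hx
    have hx0 : ((Real.cos x : ℝ) : ℂ) ≠ 0 := by exact_mod_cast cos_ne_zero_of_mem_Ioo hx
    rw [hp.up_sub_down hx, zpow_sub_one₀ hx0, zpow_add_one₀ hx0]
    field_simp))
  rw [h4, zpow_sub_one₀ h0, zpow_add_one₀ h0]
  simp only [Int.cast_add, Int.cast_sub, Int.cast_one, Int.cast_natCast]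
  field_simp
  ring

/-- The torus relation gives the sum of the two derivatives, and the `θ`-derivative gives their
difference. -/
theorem HasRadialForm.down (hF : IsMatSpherical n l F) (hp : HasRadialForm n F p)
    (hθ : θ ∈ Set.Ioo (0 : ℝ) (Real.pi / 2)) (i : Fin (l + 1)) :
    downDer F θ i i = sn * (cs ^ (n + l - (i : ℕ) : ℤ) *
      ((n + l - i) / cs * (p i).eval (cs ^ 2) + cs * (p i).derivative.eval (cs ^ 2))) := by
  have h0 : cs ≠ 0 := by exact_mod_cast cos_ne_zero_of_mem_Ioo hθ
  have hs : sn ≠ 0 := by exact_mod_cast sin_ne_zero_of_mem_Ioo hθ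
  have h1 := hF.up_add_down_entry θ i
  have h2 := hp.up_sub_down hθ i
  rw [hp θ hθ] at h1
  have h3 : upDer F θ i i + downDer F θ i i = sn * (n + l - i) / cs *
      (cs ^ (n + l - (i : ℕ) : ℤ) * (p i).eval (cs ^ 2)) := by
    apply mul_left_cancel₀ (mul_ne_zero (mul_ne_zero two_ne_zero h0) hs)
    rw [h1]
    field_simp
  linear_combination (h3 - h2) / 2

theorem HasRadialForm.up (hF : IsMatSpherical n l F) (hp : HasRadialForm n F p)
    (hθ : θ ∈ Set.Ioo (0 : ℝ) (Real.pi / 2)) (i : Fin (l + 1)) :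
    upDer F θ i i
      = -sn * (cs ^ (n + l - (i : ℕ) : ℤ) * cs * (p i).derivative.eval (cs ^ 2)) := by
  linear_combination hp.up_sub_down hθ i + hp.down hF hθ i

/-- Lowering the index by one raises the power of `cos θ` by one; at `i = 0` the coefficient is zero
and the clamped index does not matter. -/
theorem prevIdx_weight (hc : cs ≠ 0) (i : Fin (l + 1)) :
    ((i : ℂ) * (l - i + 1)) * cs ^ (n + l - (prevIdx i : ℕ) : ℤ)
      = ((i : ℂ) * (l - i + 1)) * (cs ^ (n + l - (i : ℕ) : ℤ) * cs) := by
  rcases Nat.eq_zero_or_pos (i : ℕ) with h | h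
  · simp [h]
  · rw [← zpow_add_one₀ hc]
    congr 2
    simp only [prevIdx]
    omega

theorem nextIdx_weight (hc : cs ≠ 0) (i : Fin (l + 1)) :
    (((i : ℂ) + 1) * (l - i)) * cs ^ (n + l - (nextIdx i : ℕ) : ℤ)
      = (((i : ℂ) + 1) * (l - i)) * (cs ^ (n + l - (i : ℕ) : ℤ) / cs) := by
  by_cases h : (i : ℕ) = l
  · simp [h]
  · rw [div_eq_mul_inv, ← zpow_sub_one₀ hc]
    congr 2
    have := i.2
    simp only [nextIdx]
    omega

theorem prevIdx_coe (i : Fin (l + 1)) :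
    ((i : ℂ) * (l - i + 1)) * ((prevIdx i : ℕ) : ℂ) = ((i : ℂ) * (l - i + 1)) * (i - 1) := by
  rcases Nat.eq_zero_or_pos (i : ℕ) with h | h
  · simp [h]
  · simp only [prevIdx]
    rw [Nat.cast_sub h, Nat.cast_one]

/-- The radial parts of the two operators, as identities between the values and the derivatives of
the polynomials `p_i` at `cos² θ`. -/
theorem radial_equations (hF : IsMatSpherical n l F) (hp : HasRadialForm n F p) {c1 c2 : ℂ}
    (hc1 : ∀ g : SU3, casimirOne F g = c1 • matEval g.1 F)
    (hc2 : ∀ g : SU3, casimirTwo F g = c2 • matEval g.1 F)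
    (hθ : θ ∈ Set.Ioo (0 : ℝ) (Real.pi / 2)) (i : Fin (l + 1)) :
      cs ^ 2 * sn ^ 2 * (p i).derivative.derivative.eval (cs ^ 2)
        + ((n + l - i + 1) - cs ^ 2 * (n + l - i + 3)) * (p i).derivative.eval (cs ^ 2)
        + (sn ^ 2)⁻¹ * ((i + 1) * (l - i) * ((p (nextIdx i)).eval (cs ^ 2) - (p i).eval (cs ^ 2))
          - cs ^ 2 * (i * (l - i + 1) * ((p i).eval (cs ^ 2) - (p (prevIdx i)).eval (cs ^ 2))))
        = (-c1 + 2 * n + l) * (p i).eval (cs ^ 2) ∧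
      cs ^ 2 * sn ^ 2 * ((n - l + 3 * i) * (p i).derivative.derivative.eval (cs ^ 2))
        + ((n - l + 3 * i) * (n + l - i + 1) * (p i).derivative.eval (cs ^ 2)
          - 3 * ((i + 1) * (l - i)) * (p (nextIdx i)).derivative.eval (cs ^ 2)
          - cs ^ 2 * ((n - l + 3 * i) * (n + l - i + 3) * (p i).derivative.eval (cs ^ 2)
            - 3 * (i * (l - i + 1)) * (p (prevIdx i)).derivative.eval (cs ^ 2)))
        + (sn ^ 2)⁻¹ * ((n + 2 * l - 3 * i) * ((i + 1) * (l - i))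
            * ((p (nextIdx i)).eval (cs ^ 2) - (p i).eval (cs ^ 2))
          - 3 * (n + l - i + 1) * (i * (l - i + 1))
            * ((p i).eval (cs ^ 2) - (p (prevIdx i)).eval (cs ^ 2))
          + cs ^ 2 * ((2 * n + l + 3) * (i * (l - i + 1))
            * ((p i).eval (cs ^ 2) - (p (prevIdx i)).eval (cs ^ 2))))
        = (3 * c2 - (4 * n + 2 * l) * c1 + (2 * n ^ 2 + 2 * n * l - l ^ 2 - 3 * l))
          * (p i).eval (cs ^ 2) := by
  have h0 : cs ≠ 0 := by exact_mod_cast cos_ne_zero_of_mem_Ioo hθ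
  have hs : sn ≠ 0 := by exact_mod_cast sin_ne_zero_of_mem_Ioo hθ
  have hcs : cs ^ 2 + sn ^ 2 = 1 := by exact_mod_cast Real.cos_sq_add_sin_sq θ
  have hprev := prevIdx_weight (n := n) h0 i
  have hprev' := prevIdx_coe i
  have hnext := nextIdx_weight (n := n) h0 i
  have s1 := casimirOne_entry θ hc1 i
  have s2 := hF.casimirTwo_entry θ hc2 i
  have e00 := hF.mixedDer_zero_zero_entry θ i
  have e11 := hF.mixedDer_one_one_entry θ i
  have e1 := hF.mixedDer_one_zero_entry θ i
  have e2 := hF.mixedDer_zero_one_entry θ i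
  have hd := hp θ hθ
  have hu := fun i => hp.up hF hθ i
  have hl := fun i => hp.down hF hθ i
  have hdd := hp.second_der hθ i
  rw [hd] at s1 s2
  simp only [hd, hu, hl, hdd] at e00 e11 e1 e2
  refine radial_algebra h0 (pow_ne_zero 2 hs) (zpow_ne_zero _ h0) (by linear_combination hcs)
    ?_ ?_ ?_ ?_ s1 s2
  · apply mul_left_cancel₀ hs
    linear_combination e00
  · rw [e11]
    linear_combination (-cs * (p (prevIdx i)).eval (cs ^ 2)) * hprev
      - cs * (p (nextIdx i)).eval (cs ^ 2) * hnext
  · apply mul_left_cancel₀ hs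
    rw [e1]
    have hA : cs ^ (n + l - (i : ℕ) : ℤ) * cs / cs = cs ^ (n + l - (i : ℕ) : ℤ) := by field_simp
    linear_combination sn * (((n + l - (prevIdx i : ℕ)) / cs * (p (prevIdx i)).eval (cs ^ 2)
      + cs * (p (prevIdx i)).derivative.eval (cs ^ 2))) * hprev
      - sn * (cs ^ (n + l - (i : ℕ) : ℤ)) * cs / cs * (p (prevIdx i)).eval (cs ^ 2) * hprev'
      + sn * ((i : ℂ) * (l - i + 1)) * (n + l - i + 1) * (p (prevIdx i)).eval (cs ^ 2) * hA
  · apply mul_left_cancel₀ hs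
    rw [e2]
    have hA : cs ^ (n + l - (i : ℕ) : ℤ) / cs * cs = cs ^ (n + l - (i : ℕ) : ℤ) := by field_simp
    linear_combination (-sn * cs * (p (nextIdx i)).derivative.eval (cs ^ 2)) * hnext
      - sn * ((i + 1 : ℂ) * (l - i)) * (p (nextIdx i)).derivative.eval (cs ^ 2) * hA

end

/-! ### The differential equations -/

theorem deriv_polynomial_vector (p : Fin (l + 1) → Polynomial ℂ) :
    deriv (fun (t : ℝ) i => (p i).eval (t : ℂ))
      = fun (t : ℝ) i => (p i).derivative.eval (t : ℂ) := by
  funext t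
  refine HasDerivAt.deriv (hasDerivAt_pi.mpr fun i => ?_)
  exact ((p i).hasDerivAt (t : ℂ)).comp_ofReal

theorem exists_opD_opE_eq (hF : IsMatSpherical n l F) {p : Fin (l + 1) → Polynomial ℂ}
    (hp : HasRadialForm n F p) : ∃ lam mu : ℂ, ∀ t ∈ Set.Ioo (0 : ℝ) 1,
      opD n l (fun (t : ℝ) i => (p i).eval (t : ℂ)) t
        = lam • (fun i => (p i).eval (t : ℂ)) ∧
      opE n l (fun (t : ℝ) i => (p i).eval (t : ℂ)) t
        = mu • (fun i => (p i).eval (t : ℂ)) := by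
  obtain ⟨c1, hc1⟩ := hF.exists_casimirOne_eq
  obtain ⟨c2, hc2⟩ := hF.exists_casimirTwo_eq
  refine ⟨-c1 + 2 * n + l, 3 * c2 - (4 * n + 2 * l) * c1
    + (2 * n ^ 2 + 2 * n * l - l ^ 2 - 3 * l), fun t ht => ?_⟩
  have hsq : 0 < √t := Real.sqrt_pos.mpr ht.1
  have hsq1 : √t < 1 := (Real.sqrt_lt' one_pos).mpr (by simpa using ht.2)
  -- The substitution `t = cos² θ` stays where `sin θ` and `cos θ` are nonzero.
  have hθ : Real.arccos √t ∈ Set.Ioo (0 : ℝ) (Real.pi / 2) :=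
    ⟨Real.arccos_pos.mpr hsq1, Real.arccos_lt_pi_div_two.mpr hsq⟩
  have hc : ((Real.cos (Real.arccos √t) : ℝ) : ℂ) ^ 2 = t := by
    rw [Real.cos_arccos (by linarith) hsq1.le]
    exact_mod_cast Real.sq_sqrt ht.1.le
  have hs : ((Real.sin (Real.arccos √t) : ℝ) : ℂ) ^ 2 = 1 - t := by
    have : ((Real.cos (Real.arccos √t) : ℝ) : ℂ) ^ 2
      + ((Real.sin (Real.arccos √t) : ℝ) : ℂ) ^ 2 = 1 := by
        exact_mod_cast Real.cos_sq_add_sin_sq _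
    rw [hc] at this
    linear_combination this
  constructor
  · funext i
    have h1 := (hF.radial_equations hp hc1 hc2 hθ i).1
    rw [hc, hs] at h1
    simp only [opD, deriv_polynomial_vector, Pi.add_apply, Pi.smul_apply, Matrix.sub_mulVec,
      Matrix.smul_mulVec, Pi.sub_apply, Complex.real_smul, smul_eq_mul, coeffA0, coeffA1, coeffB0,
      coeffB1]
    rw [tridiag_mulVec_apply _ _ _ rfl rfl, tridiag_mulVec_apply _ _ _ rfl rfl,
      tridiag_mulVec_apply _ _ _ rfl (by simp), tridiag_mulVec_apply _ _ _ (by simp) rfl, ← h1]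
    push_cast
    simp only [Pi.zero_apply]
    ring
  · funext i
    have h1 := (hF.radial_equations hp hc1 hc2 hθ i).2
    rw [hc, hs] at h1
    simp only [opE, deriv_polynomial_vector, Pi.add_apply, Pi.smul_apply, Matrix.sub_mulVec,
      Matrix.add_mulVec, Matrix.smul_mulVec, Pi.sub_apply, Complex.real_smul, smul_eq_mul, coeffM,
      coeffC0, coeffC1, coeffD0, coeffD1]
    rw [tridiag_mulVec_apply _ _ _ rfl rfl, tridiag_mulVec_apply _ _ _ rfl (by simp),
      tridiag_mulVec_apply _ _ _ (by simp) rfl, tridiag_mulVec_apply _ _ _ (by simp) (by simp),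
      tridiag_mulVec_apply _ _ _ (by simp) rfl, ← h1]
    push_cast
    simp only [Pi.zero_apply]
    ring

end IsMatSpherical

namespace IsMatSpherical

variable {n : ℤ} {l : ℕ} {F : Matrix (Fin (l + 1)) (Fin (l + 1)) MatPoly}

/-! ### The diagonal entries are polynomials in `cos² θ` -/

/-- The characters `(z, w) ↦ z ^ a w ^ b` of the torus. -/
noncomputable def torusChar (a b : ℤ) : Circle × Circle →* ℂ where
  toFun u := ((u.1 ^ a * u.2 ^ b : Circle) : ℂ)
  map_one' := by simp
  map_mul' u v := by
    rw [← Circle.coe_mul]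
    congr 1
    simp only [Prod.fst_mul, Prod.snd_mul, mul_zpow]
    exact mul_mul_mul_comm _ _ _ _

theorem torusChar_apply (a b : ℤ) (z w : Circle) :
    torusChar a b (z, w) = (z : ℂ) ^ a * (w : ℂ) ^ b := by
  simp [torusChar]

/-- At `z = exp(πi/(a - b))` the quotient of the two powers is `-1`. -/
theorem eq_of_circle_zpow_eq {a b : ℤ} (h : ∀ z : Circle, (z : ℂ) ^ a = (z : ℂ) ^ b) : a = b := by
  by_contra hab
  have hk : ((a - b : ℤ) : ℂ) ≠ 0 := by exact_mod_cast sub_ne_zero.mpr hab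
  have h1 := h (Circle.exp (Real.pi / ((a - b : ℤ) : ℝ)))
  have h2 : ((Circle.exp (Real.pi / ((a - b : ℤ) : ℝ)) : Circle) : ℂ) ^ (a - b) = 1 := by
    rw [zpow_sub₀ (Circle.coe_ne_zero _), h1, div_self (zpow_ne_zero _ (Circle.coe_ne_zero _))]
  rw [Circle.coe_exp, ← Complex.exp_int_mul] at h2
  have h3 : ((a - b : ℤ) : ℂ) * (((Real.pi / ((a - b : ℤ) : ℝ) : ℝ) : ℂ) * Complex.I)
      = Real.pi * Complex.I := by
    push_cast at hk ⊢
    field_simp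
  rw [h3, Complex.exp_pi_mul_I] at h2
  norm_num at h2

theorem torusChar_inj {a b a' b' : ℤ} (h : torusChar a b = torusChar a' b') :
    a = a' ∧ b = b' := by
  constructor
  · refine eq_of_circle_zpow_eq fun z => ?_
    have := DFunLike.congr_fun h (z, 1)
    simpa [torusChar_apply] using this
  · refine eq_of_circle_zpow_eq fun z => ?_
    have := DFunLike.congr_fun h (1, z)
    simpa [torusChar_apply] using this

/-- Distinct characters of the torus are linearly independent, so coefficients can be compared;
several `d` may share one character, hence the filtered sum. -/
theorem sum_filter_of_torusChar {ι : Type*} (s : Finset ι) (c : ι → ℂ) (a b : ι → ℤ) (A B : ℤ)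
    (φ : ℂ) (h : ∀ z w : Circle, ∑ d ∈ s, c d * ((z : ℂ) ^ a d * (w : ℂ) ^ b d)
      = φ * ((z : ℂ) ^ A * (w : ℂ) ^ B)) :
    φ = ∑ d ∈ s with (a d = A ∧ b d = B), c d := by
  classical
  have hli := linearIndependent_monoidHom (Circle × Circle) ℂ
  rw [linearIndependent_iff] at hli
  have h0 := hli (∑ d ∈ s, Finsupp.single (torusChar (a d) (b d)) (c d)
    - Finsupp.single (torusChar A B) φ) (by
      rw [map_sub, map_sum]
      simp only [Finsupp.linearCombination_single]
      funext u
      obtain ⟨z, w⟩ := u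
      simp only [Pi.sub_apply, Finset.sum_apply, Pi.smul_apply, torusChar_apply, smul_eq_mul, h,
        sub_self, Pi.zero_apply])
  have h1 := DFunLike.congr_fun (sub_eq_zero.mp h0) (torusChar A B)
  rw [Finsupp.single_eq_same, Finsupp.finsetSum_apply] at h1
  rw [← h1, Finset.sum_filter]
  refine Finset.sum_congr rfl fun d _ => ?_
  rw [Finsupp.single_apply]
  by_cases hd : a d = A ∧ b d = B
  · rw [if_pos hd, if_pos (by rw [hd.1, hd.2])]
  · rw [if_neg hd, if_neg fun h' => hd (torusChar_inj h')]

theorem torus_rotA_torus_entry (hF : IsMatSpherical n l F) (z w : Circle) (θ : ℝ)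
    (i : Fin (l + 1)) :
    matEval (diagSU z 1 * rotA θ * diagSU w 1).1 F i i
      = matEval (rotA θ).1 F i i * ((z : ℂ) ^ (n + l - (i : ℕ) : ℤ)
        * (w : ℂ) ^ (n + l - (i : ℕ) : ℤ)) := by
  rw [hF.map_mul_right _ _ (diagSU_mem w 1), hF.map_mul_left _ (diagSU_mem z 1),
    hF.map_K _ (diagSU_mem z 1), hF.map_K _ (diagSU_mem w 1), piMat_diagSU, piMat_diagSU,
    Matrix.mul_diagonal, Matrix.diagonal_mul]
  have h : ∀ z : Circle, (z : ℂ) ^ n * (z : ℂ) ^ (l - (i : ℕ)) = (z : ℂ) ^ (n + l - (i : ℕ) : ℤ) := by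
    intro z
    rw [← zpow_natCast, ← zpow_add₀ (Circle.coe_ne_zero z),
      Nat.cast_sub (Nat.lt_succ_iff.mp i.2)]
    congr 1
    ring
  rw [← h, ← h]
  simp only [Circle.coe_one, mul_one, one_pow]
  ring

/-- The powers of `0` stand for the vanishing entries of the matrix; with `0 ^ 0 = 1` they discard
exactly the monomials that involve one of them. -/
theorem torus_monomial {z w : ℂ} (hz : z ≠ 0) (hw : w ≠ 0) (A c s : ℂ)
    (d00 d01 d02 d10 d12 d20 d21 d22 : ℕ) :
    A * ((z * w * c) ^ d00 * 0 ^ d01 * (z * w⁻¹ * s) ^ d02 * (0 ^ d10 * 0 ^ d12)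
        * ((-(z⁻¹ * w * s)) ^ d20 * 0 ^ d21 * (z⁻¹ * w⁻¹ * c) ^ d22))
      = A * ((0 : ℂ) ^ (d01 + d10 + d12 + d21) * (-1) ^ d20) * (c ^ (d00 + d22) * s ^ (d02 + d20))
        * (z ^ ((d00 + d02 : ℤ) - (d20 + d22)) * w ^ ((d00 + d20 : ℤ) - (d02 + d22))) := by
  rw [zpow_sub₀ hz, zpow_sub₀ hw]
  simp only [← Nat.cast_add, zpow_natCast]
  rw [neg_pow]
  simp only [mul_pow, inv_pow, pow_add, div_eq_mul_inv, mul_inv]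
  ring

theorem evalMat_torus_rotA_torus (p : MatPoly) (z w : Circle) (θ : ℝ) :
    evalMat (diagSU z 1 * rotA θ * diagSU w 1).1 p
      = ∑ d ∈ p.support, (MvPolynomial.coeff d p * ((0 : ℂ) ^ (d (0, 1) + d (1, 0) + d (1, 2)
          + d (2, 1)) * (-1) ^ d (2, 0)) * (((Real.cos θ : ℝ) : ℂ) ^ (d (0, 0) + d (2, 2))
          * ((Real.sin θ : ℝ) : ℂ) ^ (d (0, 2) + d (2, 0))))
        * ((z : ℂ) ^ ((d (0, 0) + d (0, 2) : ℤ) - (d (2, 0) + d (2, 2)))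
          * (w : ℂ) ^ ((d (0, 0) + d (2, 0) : ℤ) - (d (0, 2) + d (2, 2)))) := by
  have hz := Circle.coe_ne_zero z
  have hw := Circle.coe_ne_zero w
  rw [evalMat, MvPolynomial.aeval_def, MvPolynomial.eval₂_eq']
  refine Finset.sum_congr rfl fun d _ => ?_
  have hentry : (diagSU z 1 * rotA θ * diagSU w 1).1
      = !![(z : ℂ) * w * ((Real.cos θ : ℝ) : ℂ), 0, (z : ℂ) * (w : ℂ)⁻¹ * ((Real.sin θ : ℝ) : ℂ);
          0, 1, 0;
          -((z : ℂ)⁻¹ * w * ((Real.sin θ : ℝ) : ℂ)), 0,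
            (z : ℂ)⁻¹ * (w : ℂ)⁻¹ * ((Real.cos θ : ℝ) : ℂ)] := by
    ext a b
    simp only [Submonoid.coe_mul, diagSU, Matrix.mul_diagonal, Matrix.diagonal_mul]
    fin_cases a <;> fin_cases b <;>
      simp [rotA, -Complex.ofReal_cos, -Complex.ofReal_sin] <;> ring
  rw [hentry]
  simp only [Fintype.prod_prod_type, Fin.prod_univ_three]
  simp only [Matrix.of_apply, Matrix.cons_val', Matrix.cons_val_zero, Matrix.cons_val_one,
    Matrix.cons_val, one_pow, mul_one]
  exact torus_monomial hz hw _ _ _ _ _ _ _ _ _ _ _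

/-- Up to the factor `|cos θ|^|m|`, the diagonal entries are polynomials in `cos² θ`. -/
theorem exists_polynomial_entry (hF : IsMatSpherical n l F) (i : Fin (l + 1)) :
    ∃ q : Polynomial ℂ, ∀ θ : ℝ, matEval (rotA θ).1 F i i
      = ((Real.cos θ : ℝ) : ℂ) ^ (n + l - (i : ℕ) : ℤ).natAbs
        * q.eval (((Real.cos θ : ℝ) : ℂ) ^ 2) := by
  set m : ℤ := n + l - (i : ℕ) with hm
  refine ⟨∑ d ∈ (F i i).support with
    ((d (0, 0) + d (0, 2) : ℤ) - (d (2, 0) + d (2, 2)) = m ∧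
      (d (0, 0) + d (2, 0) : ℤ) - (d (0, 2) + d (2, 2)) = m),
    Polynomial.C (MvPolynomial.coeff d (F i i) * ((0 : ℂ) ^ (d (0, 1) + d (1, 0) + d (1, 2)
          + d (2, 1)) * (-1) ^ d (2, 0))) * (Polynomial.X ^ min (d (0, 0)) (d (2, 2))
            * (1 - Polynomial.X) ^ d (0, 2)), fun θ => ?_⟩
  have h1 := sum_filter_of_torusChar (F i i).support
    (fun d => MvPolynomial.coeff d (F i i) * ((0 : ℂ) ^ (d (0, 1) + d (1, 0) + d (1, 2)
          + d (2, 1)) * (-1) ^ d (2, 0)) * (((Real.cos θ : ℝ) : ℂ) ^ (d (0, 0) + d (2, 2))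
          * ((Real.sin θ : ℝ) : ℂ) ^ (d (0, 2) + d (2, 0)))) _ _ m m (matEval (rotA θ).1 F i i)
    (fun z w => (evalMat_torus_rotA_torus (F i i) z w θ).symm.trans
      (hF.torus_rotA_torus_entry z w θ i))
  rw [h1, Polynomial.eval_finsetSum, Finset.mul_sum]
  refine Finset.sum_congr rfl fun d hd => ?_
  obtain ⟨ha, hb⟩ := (Finset.mem_filter.mp hd).2
  have hs : ((Real.sin θ : ℝ) : ℂ) ^ 2 = 1 - ((Real.cos θ : ℝ) : ℂ) ^ 2 := by
    have : ((Real.cos θ : ℝ) : ℂ) ^ 2 + ((Real.sin θ : ℝ) : ℂ) ^ 2 = 1 := by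
      exact_mod_cast Real.cos_sq_add_sin_sq θ
    linear_combination this
  -- The two weight conditions amount to `d₀₂ = d₂₀` and `d₀₀ - d₂₂ = m`: the power of the sine is
  -- even, and that of the cosine is `|m|` plus an even number.
  have h02 : d (0, 2) + d (2, 0) = 2 * d (0, 2) := by omega
  have h00 : d (0, 0) + d (2, 2) = m.natAbs + 2 * min (d (0, 0)) (d (2, 2)) := by omega
  rw [h02, h00, pow_add _ m.natAbs, pow_mul _ 2, pow_mul _ 2, hs]
  simp only [Polynomial.eval_mul, Polynomial.eval_C, Polynomial.eval_pow, Polynomial.eval_X,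
    Polynomial.eval_sub, Polynomial.eval_one]
  ring

theorem rotA_zero : rotA 0 = 1 := by
  apply Subtype.ext
  ext i j
  fin_cases i <;> fin_cases j <;> simp [rotA]

/-- The radial form of a spherical function, with the behaviour of its entries at `0` and `1`. -/
theorem exists_hasRadialForm (hF : IsMatSpherical n l F) :
    ∃ p : Fin (l + 1) → Polynomial ℂ, HasRadialForm n F p ∧ (∀ i, (p i).eval 1 = 1) ∧
      ∀ i : Fin (l + 1), Polynomial.X ^ (-(n + l - (i : ℕ)) : ℤ).toNat ∣ p i := by
  choose q hq using hF.exists_polynomial_entry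
  -- Since `cos^|m| = cos^m · (cos²)^max(-m, 0)`, a negative `m` contributes a power of `X`; this is
  -- the zero at `t = 0`.
  refine ⟨fun i => Polynomial.X ^ (-(n + l - (i : ℕ)) : ℤ).toNat * q i, fun θ hθ i => ?_,
    fun i => ?_, fun i => Dvd.intro _ rfl⟩
  · have h0 : ((Real.cos θ : ℝ) : ℂ) ≠ 0 := by exact_mod_cast cos_ne_zero_of_mem_Ioo hθ
    rw [hq, Polynomial.eval_mul, Polynomial.eval_pow, Polynomial.eval_X, ← mul_assoc, ← pow_mul,
      ← zpow_natCast _ (n + l - (i : ℕ) : ℤ).natAbs, ← zpow_natCast _ (2 * _), ← zpow_add₀ h0]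
    congr 2
    omega
  · have h := hq i 0
    rw [rotA_zero] at h
    change matEval 1 F i i = _ at h
    rw [hF.matEval_one, Matrix.one_apply_eq] at h
    simp only [Real.cos_zero, Complex.ofReal_one, one_pow, one_mul] at h
    simp [← h]

end IsMatSpherical

/-! ### Matrix form of a spherical function -/

section MatrixForm

variable {V : Type*} [NormedAddCommGroup V] [NormedSpace ℂ V] {n : ℤ} {l : ℕ}
  {Φ : SU3 → (V →L[ℂ] V)}

/-- The matrix coefficient of an operator in the basis of weight vectors. -/
noncomputable def weightCoeff (T : V ≃ₗ[ℂ] SymPow l) (i j : Fin (l + 1)) :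
    (V →L[ℂ] V) →ₗ[ℂ] ℂ :=
  ((weightBasis l).coord i ∘ₗ T.toLinearMap) ∘ₗ
    LinearMap.applyₗ (T.symm (weightBasis l j)) ∘ₗ ContinuousLinearMap.coeLM ℂ

theorem weightCoeff_apply (T : V ≃ₗ[ℂ] SymPow l) (i j : Fin (l + 1)) (a : V →L[ℂ] V) :
    weightCoeff T i j a
      = LinearMap.toMatrix (weightBasis l) (weightBasis l) (T.conj (a : V →ₗ[ℂ] V)) i j := by
  rw [LinearMap.toMatrix_apply]
  rfl

theorem toMatrix_conj_mul (T : V ≃ₗ[ℂ] SymPow l) (a b : V →L[ℂ] V) :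
    LinearMap.toMatrix (weightBasis l) (weightBasis l) (T.conj ((a * b : V →L[ℂ] V) : V →ₗ[ℂ] V))
      = LinearMap.toMatrix (weightBasis l) (weightBasis l) (T.conj (a : V →ₗ[ℂ] V))
        * LinearMap.toMatrix (weightBasis l) (weightBasis l) (T.conj (b : V →ₗ[ℂ] V)) := by
  rw [← LinearMap.toMatrix_mul]
  congr 1
  exact T.conj_comp _ _

theorem IsKIdentification.conj_eq {T : V ≃ₗ[ℂ] SymPow l} (hT : IsKIdentification n Φ T) {k : SU3}
    (hk : k ∈ subK) : T.conj (Φ k : V →ₗ[ℂ] V) = piRep n l (upperBlock k) := by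
  refine LinearMap.ext fun v => ?_
  have := hT k hk (T.symm v)
  rw [LinearEquiv.apply_symm_apply] at this
  exact this

theorem IsSphericalFunction.exists_isMatSpherical [FiniteDimensional ℂ V]
    (hΦ : IsSphericalFunction n l Φ) (hirr : IsIrreducibleFamily Φ) {T : V ≃ₗ[ℂ] SymPow l}
    (hT : IsKIdentification n Φ T) :
    ∃ F : Matrix (Fin (l + 1)) (Fin (l + 1)) MatPoly, IsMatSpherical n l F ∧ ∀ g : SU3,
      matEval g.1 F
        = LinearMap.toMatrix (weightBasis l) (weightBasis l) (T.conj (Φ g : V →ₗ[ℂ] V)) := by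
  have h : ∀ i j, ∃ p : MatPoly, ∀ g : SU3, weightCoeff T i j (Φ g) = evalMat g.1 p := fun i j =>
    hΦ.isPolyFun_functional hirr ((weightBasis l).coord i ∘ₗ T.toLinearMap)
      (T.symm (weightBasis l j))
  choose F hF using h
  have hM : ∀ g : SU3, matEval g.1 (Matrix.of F)
      = LinearMap.toMatrix (weightBasis l) (weightBasis l) (T.conj (Φ g : V →ₗ[ℂ] V)) := by
    intro g
    ext i j
    rw [← weightCoeff_apply, hF]
    rfl
  refine ⟨Matrix.of F, ⟨fun k hk => ?_, fun g k hk => ?_, fun k hk g => ?_, fun x y i j => ?_⟩, hM⟩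
  · rw [hM, hT.conj_eq hk, piMat]
  · rw [hM, hM, hM, hΦ.map_mul_right _ hk, toMatrix_conj_mul]
  · rw [hM, hM, hM, hΦ.map_mul_left hk, toMatrix_conj_mul]
  · rw [hM, hM, ← toMatrix_conj_mul, ← weightCoeff_apply, hΦ.functional_mul_eq]
    refine integral_congr_ae (Filter.Eventually.of_forall fun k => ?_)
    simp only [hF]
    rfl

end MatrixForm

/-! ### The attached function -/

/-- The adjoint of `g` is its adjugate, so `det A(g)` is the complex conjugate of `g₃₃`. -/
theorem apply_two_two_ne_zero {g : SU3} (h : (upperBlock g).det ≠ 0) : g.1 2 2 ≠ 0 := by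
  have h22 := congrFun (congrFun (star_eq_adjugate g).symm 2) 2
  intro h0
  apply h
  rw [Matrix.star_apply, h0, star_zero, Matrix.adjugate_fin_three] at h22
  rw [Matrix.det_fin_two]
  simpa [upperBlock_apply] using h22

/-- With `tan θ = r` the last column of `g` is a multiple of that of `rotA θ`. The last column of
`(rotA θ)⁻¹ g` is then along `e₃`, and unitarity clears the rest of its last row. -/
theorem exists_rotA_mul {g : SU3} {r : ℝ} (h22 : g.1 2 2 ≠ 0) (h02 : g.1 0 2 / g.1 2 2 = (r : ℂ))
    (h12 : g.1 1 2 / g.1 2 2 = 0) : ∃ k ∈ subK, g = rotA (Real.arctan r) * k := by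
  refine ⟨(rotA (Real.arctan r))⁻¹ * g, ?_, (mul_inv_cancel_left _ _).symm⟩
  rw [div_eq_iff h22] at h02
  have h12' : g.1 1 2 = 0 := by simpa [h22] using h12
  set a := rotA (Real.arctan r) with ha
  set k := a⁻¹ * g with hk
  have hentry : k.1 = star a.1 * g.1 := rfl
  have hsin : (Real.sin (Real.arctan r) : ℂ) = r * (Real.cos (Real.arctan r) : ℂ) := by
    rw [Real.sin_arctan, Real.cos_arctan]
    push_cast
    ring
  have k02 : k.1 0 2 = 0 := by
    rw [hentry, Matrix.mul_apply, Fin.sum_univ_three]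
    simp [Matrix.star_apply, ha, rotA, h02, -Complex.ofReal_cos, -Complex.ofReal_sin]
    rw [hsin]
    ring
  have k12 : k.1 1 2 = 0 := by
    rw [hentry, Matrix.mul_apply, Fin.sum_univ_three]
    simp [Matrix.star_apply, ha, rotA, h12']
  have hstar : star k.1 * k.1 = 1 :=
    Matrix.mem_unitaryGroup_iff'.mp (Matrix.mem_specialUnitaryGroup_iff.mp k.2).1
  have e : ∀ j, star (k.1 2 j) * k.1 2 2 = (1 : Matrix (Fin 3) (Fin 3) ℂ) j 2 := by
    intro j
    rw [← hstar, Matrix.mul_apply, Fin.sum_univ_three, k02, k12]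
    simp [Matrix.star_apply]
  have k22 : k.1 2 2 ≠ 0 := by
    intro h0
    have := e 2
    rw [h0, mul_zero] at this
    simp at this
  have e0 := e 0
  have e1 := e 1
  simp [k22] at e0 e1
  exact ⟨k02, k12, e0, e1⟩

theorem piRep_rotA_weightVec (n : ℤ) (l : ℕ) {θ : ℝ} (hθ : Real.cos θ ≠ 0) (i : Fin (l + 1)) :
    piRep n l (upperBlock (rotA θ)) (weightVec l i)
      = ((Real.cos θ : ℝ) : ℂ) ^ (n + l - (i : ℕ) : ℤ) • weightVec l i := by
  have h0 : ((Real.cos θ : ℝ) : ℂ) ≠ 0 := by exact_mod_cast hθ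
  have : upperBlock (rotA θ) = Matrix.diagonal ![((Real.cos θ : ℝ) : ℂ), 1] := by
    ext i j
    fin_cases i <;> fin_cases j <;> simp [upperBlock_apply, rotA]
  rw [this, piRep, LinearMap.smul_apply, symPowMap_diagonal_weightVec, smul_smul, one_pow, mul_one]
  congr 1
  rw [Matrix.det_diagonal, Fin.prod_univ_two, ← zpow_natCast, Nat.cast_sub (Nat.lt_succ_iff.mp i.2)]
  simp only [Matrix.cons_val_zero, Matrix.cons_val_one, mul_one]
  rw [← zpow_add₀ h0]
  congr 1
  ring

theorem isUnit_piRep (n : ℤ) (l : ℕ) {A : Matrix (Fin 2) (Fin 2) ℂ} (hA : A.det ≠ 0) :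
    IsUnit (piRep n l A) := by
  have h : A * A⁻¹ = 1 := Matrix.mul_nonsing_inv A (isUnit_iff_ne_zero.mpr hA)
  have h' : A⁻¹ * A = 1 := Matrix.nonsing_inv_mul A (isUnit_iff_ne_zero.mpr hA)
  exact ⟨⟨piRep n l A, piRep n l A⁻¹, by rw [← piRep_mul, h, piRep_one],
    by rw [← piRep_mul, h', piRep_one]⟩, rfl⟩

/-- For `g = a k` the factors of `k` cancel, so `H(g) = Φ(a) π(A(a))⁻¹`. The power of `cos θ` in the
radial form is exactly the eigenvalue of `π(A(a))` on `v_i`. -/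
theorem isAttachedFunction_of_hasRadialForm {V : Type*} [NormedAddCommGroup V] [NormedSpace ℂ V]
    {n : ℤ} {l : ℕ} {Φ : SU3 → (V →L[ℂ] V)} (hΦ : IsSphericalFunction n l Φ)
    {T : V ≃ₗ[ℂ] SymPow l} (hT : IsKIdentification n Φ T)
    {F : Matrix (Fin (l + 1)) (Fin (l + 1)) MatPoly} (hF : IsMatSpherical n l F)
    (hM : ∀ g : SU3, matEval g.1 F
      = LinearMap.toMatrix (weightBasis l) (weightBasis l) (T.conj (Φ g : V →ₗ[ℂ] V)))
    {p : Fin (l + 1) → Polynomial ℂ} (hp : IsMatSpherical.HasRadialForm n F p)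
    (hp1 : ∀ i, (p i).eval 1 = 1) :
    IsAttachedFunction n Φ T fun (t : ℝ) i => (p i).eval (t : ℂ) := by
  intro r hr g hg h02 h12 i
  obtain ⟨k, hk, rfl⟩ := exists_rotA_mul (apply_two_two_ne_zero hg) h02 h12
  set θ := Real.arctan r with hθ
  have hcos : Real.cos θ ≠ 0 := (Real.cos_arctan_pos r).ne'
  have h0 : ((Real.cos θ : ℝ) : ℂ) ≠ 0 := by exact_mod_cast hcos
  have hk' : IsUnit (piRep n l (upperBlock k)) := isUnit_piRep n l (det_upperBlock_ne_zero hk)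
  have h1 : sphericalH n Φ T (rotA θ * k) * piRep n l (upperBlock (rotA θ))
      = T.conj (Φ (rotA θ) : V →ₗ[ℂ] V) := by
    apply hk'.mul_right_cancel
    rw [mul_assoc, ← piRep_upperBlock_mul n l _ hk, sphericalH,
      Ring.inverse_mul_cancel_right _ _ (isUnit_piRep n l hg), hΦ.map_mul_right _ hk,
      ← hT.conj_eq hk]
    exact T.conj_comp _ _
  have hval : matEval (rotA θ).1 F i i = ((Real.cos θ : ℝ) : ℂ) ^ (n + l - (i : ℕ) : ℤ)
      * (p i).eval (((1 + r ^ 2)⁻¹ : ℝ) : ℂ) := by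
    have hsq : (((1 + r ^ 2)⁻¹ : ℝ) : ℂ) = ((Real.cos θ : ℝ) : ℂ) ^ 2 := by
      rw [← Complex.ofReal_pow, Real.cos_sq_arctan, one_div]
    rw [hsq]
    -- The radial form is stated for `0 < θ < π/2`; at `r = 0` the entry is that of the identity
    -- matrix, which matches `p_i(1) = 1`.
    rcases hr.eq_or_lt with h | h
    · rw [hθ, ← h, Real.arctan_zero, IsMatSpherical.rotA_zero]
      change matEval 1 F i i = _
      rw [hF.matEval_one]
      simp [hp1]
    · exact hp θ ⟨Real.arctan_pos.mpr h, Real.arctan_lt_pi_div_two r⟩ i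
  have h2 : T.conj (Φ (rotA θ) : V →ₗ[ℂ] V) (weightVec l i)
      = matEval (rotA θ).1 F i i • weightVec l i := by
    have h3 := congrArg (Matrix.toLin (weightBasis l) (weightBasis l)) (hM (rotA θ))
    rw [Matrix.toLin_toMatrix] at h3
    rw [← h3, ← weightBasis_apply, Matrix.toLin_self, Finset.sum_eq_single i]
    · intro j _ hj
      rw [hF.rotA_apply_of_ne θ hj, zero_smul]
    · simp
  have h3 := LinearMap.congr_fun h1 (weightVec l i)
  rw [h2, Module.End.mul_apply, piRep_rotA_weightVec n l hcos, map_smul, hval, mul_smul] at h3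
  exact smul_right_injective _ (zpow_ne_zero _ h0) h3

/-! ### Analytic properties of polynomial functions -/

theorem analyticAt_eval_ofReal (q : Polynomial ℂ) (t : ℝ) :
    AnalyticAt ℝ (fun s : ℝ => q.eval (s : ℂ)) t := by
  have h : AnalyticAt ℝ (fun s : ℝ => (s : ℂ)) t := Complex.ofRealCLM.analyticAt t
  simpa using h.aeval_polynomial q

theorem analyticAt_polynomial_vector {ι : Type*} [Fintype ι] (p : ι → Polynomial ℂ) (t : ℝ) :
    AnalyticAt ℝ (fun (s : ℝ) i => (p i).eval (s : ℂ)) t :=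
  AnalyticAt.pi fun i => analyticAt_eval_ofReal (p i) t

theorem natCast_le_analyticOrderAt_of_X_pow_dvd {ι : Type*} [Fintype ι] {p : ι → Polynomial ℂ}
    {N : ℕ} (h : ∀ i, Polynomial.X ^ N ∣ p i) :
    (N : ℕ∞) ≤ analyticOrderAt (fun (s : ℝ) i => (p i).eval (s : ℂ)) 0 := by
  choose q hq using h
  rw [natCast_le_analyticOrderAt (analyticAt_polynomial_vector p 0)]
  refine ⟨fun s i => (q i).eval (s : ℂ), analyticAt_polynomial_vector q 0,
    Filter.Eventually.of_forall fun s => funext fun i => ?_⟩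
  simp [hq]

/-- By continuity, vanishing on `(0, 1)` would extend to the endpoint `1`. -/
theorem exists_eval_ne_zero_of_eval_one {q : Polynomial ℂ} (h : q.eval 1 ≠ 0) :
    ∃ t ∈ Set.Ioo (0 : ℝ) 1, q.eval (t : ℂ) ≠ 0 := by
  by_contra! h0
  have hc : Continuous fun t : ℝ => q.eval (t : ℂ) := q.continuous.comp Complex.continuous_ofReal
  have hcl : Set.EqOn (fun t : ℝ => q.eval (t : ℂ)) 0 (closure (Set.Ioo (0 : ℝ) 1)) :=
    Set.EqOn.closure (fun t ht => h0 t ht) hc continuous_zero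
  rw [closure_Ioo zero_ne_one] at hcl
  exact h (by simpa using hcl (Set.right_mem_Icc.mpr zero_le_one))

theorem proposition9p1 (n : ℤ) (l : ℕ)
    {V : Type*} [NormedAddCommGroup V] [NormedSpace ℂ V] [FiniteDimensional ℂ V]
    (Φ : SU3 → (V →L[ℂ] V)) (hΦ : IsSphericalFunction n l Φ) (hirr : IsIrreducibleFamily Φ) :
    (∃ T : V ≃ₗ[ℂ] SymPow l, IsKIdentification n Φ T) ∧
    ∀ T : V ≃ₗ[ℂ] SymPow l, IsKIdentification n Φ T →
      ∃ H : ℝ → Fin (l + 1) → ℂ,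
        IsAttachedFunction n Φ T H ∧
        AnalyticOnNhd ℝ H (Set.Ico 0 1) ∧
        (∃ t ∈ Set.Ioo (0 : ℝ) 1, H t ≠ 0) ∧
        (∃ lam mu : ℂ, ∀ t ∈ Set.Ioo (0 : ℝ) 1,
          opD n l H t = lam • H t ∧ opE n l H t = mu • H t) ∧
        (n + l < 0 → ((-n - l).toNat : ℕ∞) ≤ analyticOrderAt H 0) := by
  refine ⟨hΦ.exists_identification hirr, fun T hT => ?_⟩
  obtain ⟨F, hF, hM⟩ := hΦ.exists_isMatSpherical hirr hT
  obtain ⟨p, hp, hp1, hdvd⟩ := hF.exists_hasRadialForm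
  refine ⟨fun t i => (p i).eval (t : ℂ), isAttachedFunction_of_hasRadialForm hΦ hT hF hM hp hp1,
    fun t _ => analyticAt_polynomial_vector p t, ?_, hF.exists_opD_opE_eq hp, fun _ => ?_⟩
  · obtain ⟨t, ht, h⟩ := exists_eval_ne_zero_of_eval_one (q := p 0) (by rw [hp1]; exact one_ne_zero)
    exact ⟨t, ht, fun h0 => h (congrFun h0 0)⟩
  -- Since `i ≥ 0`, every exponent `-(n + l - i)` is at least `-n - l`.
  · refine natCast_le_analyticOrderAt_of_X_pow_dvd fun i => (pow_dvd_pow _ ?_).trans (hdvd i)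
    omega
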